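/- Let $M$ be an oriented, second countable, Hausdorff smooth manifold of dimension $n$ with a smooth covariant derivative $\nabla$ on $TM$, and let $r,s\ge 0$. Write $\Omega^n_c(M)$ for the compactly supported smooth $n$-forms, $I=(0,1]$, and let $$\mathcal D'^r_s(M)=\Gamma_c(T^s_rM\otimes\Lambda^nT^*M)'$$ be the space of $(r,s)$-tensor distributions, i.e. the continuous dual for the usual (LF)-topology. Let $A$ be a transport operator (a smooth family of linear maps $A(p,q):T_pM\to T_qM$, $p,q\in M$) associated to $\nabla$: every point has an open neighbourhood $U$ in which any two points $x,y$ are joined by exactly one geodesic contained in $U$, and $A(x,y)$ is parallel transport along this geodesic for all $x,y\in U$. On tensors, $A(p,q)$ acts by $A(p,q)$ on the contravariant slots and by the adjoint of $A(q,p)$ on the covariant slots. For $T\in\mathcal D'^r_s(M)$ and $\omega\in\Omega^n_c(M)$ let $(\iota T)(\omega)$ be the $(r,s)$-tensor field determined by $$(\iota T)(\omega)(p)\cdot v=\langle T,\ A(p,\cdot)v\otimes\omega\rangle\qquad (p\in M,\ v\in (T^s_rM)_p).$$ A smoothing kernel is a smooth map $\Phi:I\times M\to\Omega^n_c(M)$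 with $\int_M\Phi(\varepsilon,p)=1$ for all $(\varepsilon,p)$ such that, for one (equivalently, every) Riemannian metric $g$ on $M$: (i) for every compact $K\subseteq M$ there are $\varepsilon_0,C>0$ with $\operatorname{supp}\Phi(\varepsilon,p)\subseteq B^g_{\varepsilon C}(p)$ for all $p\in K$, $\varepsilon\le\varepsilon_0$; (ii) for every compact $K\subseteq M$ and all smooth vector fields $\theta_1,\dots,\theta_m,\zeta_1,\dots,\zeta_l$ ($l,m\ge 0$), $$\sup_{p\in K,\,q\in M}\bigl\|\bigl(L_{\theta_1}\cdots L_{\theta_m}(L'_{\zeta_1}+L_{\zeta_1})\cdots(L'_{\zeta_l}+L_{\zeta_l})\Phi\bigr)(\varepsilon,p)(q)\bigr\|_g=O(\varepsilon^{-n-m})\quad(\varepsilon\to0),$$ where $L_X$ is the Lie derivative of $\Phi(\varepsilon,p)$ as an $n$-form and $L'_X$ is the derivative of $p\mapsto\Phi(\varepsilon,p)$ along $X$. Proposition. Let $T\in\mathcal D'^r_s(M)$, let $\Phi$ be a smoothing kernel, and put $T_\varepsilon(p)=(\iota T)(\Phi(\varepsilon,p))(p)$. Then $T_\varepsilon$ is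 a smooth $(r,s)$-tensor field for every $\varepsilon\in(0,1]$, and the regular distributions given by the $T_\varepsilon$ converge weakly to $T$ in $\mathcal D'^r_s(M)$ as $\varepsilon\to0$: for every $\xi\in\Gamma_c(T^s_rM\otimes\Lambda^nT^*M)$, $$\int_M T_\varepsilon\cdot\xi\ \longrightarrow\ \langle T,\xi\rangle\qquad(\varepsilon\to 0),$$ where $T_\varepsilon\cdot\xi$ is the $n$-form obtained by full contraction. -/

import Mathlib

open Set Filter Topology MeasureTheory Manifold
open scoped ContDiff

noncomputable section

namespace TensorRegularization

/-! ### Linear algebra of mixed tensors -/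

/-- `F`-valued mixed tensors with `a` contravariant and `b` covariant slots over a
finite-dimensional space `V`: multilinear maps in `a` covectors and `b` vectors.
For `F = ℝ` this is `V^{⊗a} ⊗ (V*)^{⊗b}`, in general it is `V^{⊗a} ⊗ (V*)^{⊗b} ⊗ F`. -/
abbrev MixedTensor (a b : ℕ) (V F : Type*) [AddCommGroup V] [Module ℝ V] [AddCommGroup F]
    [Module ℝ F] : Type _ :=
  MultilinearMap ℝ (fun _ : Fin a => Module.Dual ℝ V) (MultilinearMap ℝ (fun _ : Fin b => V) F)

section LinearAlgebra

variable {a b : ℕ} {V V' F : Type*} [AddCommGroup V] [Module ℝ V] [AddCommGroup V'] [Module ℝ V']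
  [AddCommGroup F] [Module ℝ F]

/-- The elementary tensor `w₁ ⊗ ⋯ ⊗ w_a ⊗ α₁ ⊗ ⋯ ⊗ α_b`. -/
def elementary (w : Fin a → V) (α : Fin b → Module.Dual ℝ V) : MixedTensor a b V ℝ :=
  ((MultilinearMap.mkPiAlgebra ℝ (Fin a) ℝ).compLinearMap
      fun k => Module.Dual.eval ℝ V (w k)).smulRight
    ((MultilinearMap.mkPiAlgebra ℝ (Fin b) ℝ).compLinearMap α)

/-- `f^{⊗a} ⊗ (g*)^{⊗b}` : vectors are moved by `f : V → V'`, covectors by the adjoint of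
`g : V' → V`. -/
def mapTensor (f : V →ₗ[ℝ] V') (g : V' →ₗ[ℝ] V) :
    MixedTensor a b V F →ₗ[ℝ] MixedTensor a b V' F where
  toFun t := (MultilinearMap.compLinearMapₗ (fun _ : Fin b => g)).compMultilinearMap
    (t.compLinearMap fun _ : Fin a => f.dualMap)
  map_add' _ _ := rfl
  map_smul' _ _ := rfl

/-- The tensor product `t ⊗ η` of a mixed tensor `t` with `η ∈ F`. -/
def tensorWith (η : F) : MixedTensor a b V ℝ →ₗ[ℝ] MixedTensor a b V F where
  toFun t := ((LinearMap.toSpanSingleton ℝ F η).compMultilinearMapₗ ℝ).compMultilinearMap t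
  map_add' x y := by ext; simp
  map_smul' c x := by ext; simp

/-- The full contraction `t · u` of an `(a, b)`-tensor `t` with a dual, `F`-valued
`(b, a)`-tensor `u`, computed in a basis (it does not depend on the basis). -/
def contract {ι : Type*} [Fintype ι] [DecidableEq ι] (B : Module.Basis ι ℝ V)
    (t : MixedTensor a b V ℝ) (u : MixedTensor b a V F) : F :=
  ∑ I : Fin a → ι, ∑ J : Fin b → ι,
    t (fun k => B.coord (I k)) (fun l => B (J l)) • u (fun l => B.coord (J l)) (fun k => B (I k))

/-- The `(a, b)`-tensor `t` with `t · u = L u` for all dual tensors `u`. -/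
def ofFunctional {ι : Type*} [Fintype ι] [DecidableEq ι] (B : Module.Basis ι ℝ V)
    (L : MixedTensor b a V ℝ →ₗ[ℝ] ℝ) : MixedTensor a b V ℝ :=
  ∑ I : Fin a → ι, ∑ J : Fin b → ι,
    L (elementary (fun l => B (J l)) (fun k => B.coord (I k))) •
      elementary (fun k => B (I k)) (fun l => B.coord (J l))

theorem elementary_apply (w : Fin a → V) (α : Fin b → Module.Dual ℝ V)
    (β : Fin a → Module.Dual ℝ V) (v : Fin b → V) :
    elementary w α β v = (∏ k, β k (w k)) * ∏ l, α l (v l) := by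
  simp [elementary]

theorem mapTensor_apply (f : V →ₗ[ℝ] V') (g : V' →ₗ[ℝ] V) (t : MixedTensor a b V F)
    (β : Fin a → Module.Dual ℝ V') (v : Fin b → V') :
    mapTensor f g t β v = t (fun k => (β k).comp f) (fun l => g (v l)) := rfl

theorem tensorWith_apply (η : F) (t : MixedTensor a b V ℝ)
    (β : Fin a → Module.Dual ℝ V) (v : Fin b → V) :
    tensorWith η t β v = t β v • η := rfl

/-- Two mixed tensors with the same components in a basis agree. -/
theorem ext_basis {ι : Type*} [Fintype ι] [DecidableEq ι] (B : Module.Basis ι ℝ V)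
    {t t' : MixedTensor a b V F}
    (h : ∀ (I : Fin a → ι) (J : Fin b → ι), t (fun k => B.coord (I k)) (fun l => B (J l)) =
      t' (fun k => B.coord (I k)) (fun l => B (J l))) : t = t' := by
  refine Module.Basis.ext_multilinear (fun _ => B.dualBasis) fun I => ?_
  refine Module.Basis.ext_multilinear (fun _ => B) fun J => ?_
  simpa [Module.Basis.coe_dualBasis] using h I J

/-- Expansion of a mixed tensor in elementary tensors. -/
theorem sum_elementary {ι : Type*} [Fintype ι] [DecidableEq ι] (B : Module.Basis ι ℝ V)
    (t : MixedTensor a b V ℝ) :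
    t = ∑ I : Fin a → ι, ∑ J : Fin b → ι,
      t (fun k => B.coord (I k)) (fun l => B (J l)) •
        elementary (fun k => B (I k)) (fun l => B.coord (J l)) := by
  refine ext_basis B fun I J => ?_
  simp only [sum_apply, smul_apply, elementary_apply,
    Module.Basis.coord_apply, Module.Basis.repr_self, Finsupp.single_apply]
  rw [Finset.sum_eq_single I, Finset.sum_eq_single J]
  · simp
  · intro J' _ hJ
    obtain ⟨l, hl⟩ := Function.ne_iff.1 hJ
    rw [Finset.prod_eq_zero (i := l) (f := fun l => if J l = J' l then (1 : ℝ) else 0)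
      (Finset.mem_univ _) (if_neg (Ne.symm hl))]
    simp
  · simp
  · intro I' _ hI
    obtain ⟨k, hk⟩ := Function.ne_iff.1 hI
    rw [Finset.prod_eq_zero (i := k) (f := fun k => if I' k = I k then (1 : ℝ) else 0)
      (Finset.mem_univ _) (if_neg hk)]
    simp
  · simp

/-- `ofFunctional` represents the given functional through the contraction. -/
theorem contract_ofFunctional {ι : Type*} [Fintype ι] [DecidableEq ι] (B : Module.Basis ι ℝ V)
    (L : MixedTensor b a V ℝ →ₗ[ℝ] ℝ) (u : MixedTensor b a V ℝ) :
    contract B (ofFunctional B L) u = L u := by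
  have key : ∀ (I : Fin a → ι) (J : Fin b → ι),
      ofFunctional B L (fun k => B.coord (I k)) (fun l => B (J l)) =
        L (elementary (fun l => B (J l)) (fun k => B.coord (I k))) := by
    intro I J
    simp only [ofFunctional, sum_apply, smul_apply, elementary_apply,
      Module.Basis.coord_apply, Module.Basis.repr_self, Finsupp.single_apply]
    rw [Finset.sum_eq_single I, Finset.sum_eq_single J]
    · simp
    · intro J' _ hJ
      obtain ⟨l, hl⟩ := Function.ne_iff.1 hJ
      rw [Finset.prod_eq_zero (i := l) (f := fun l => if J l = J' l then (1 : ℝ) else 0)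
        (Finset.mem_univ _) (if_neg (Ne.symm hl))]
      simp
    · simp
    · intro I' _ hI
      obtain ⟨k, hk⟩ := Function.ne_iff.1 hI
      rw [Finset.prod_eq_zero (i := k) (f := fun k => if I' k = I k then (1 : ℝ) else 0)
        (Finset.mem_univ _) (if_neg hk)]
      simp
    · simp
  rw [contract, Finset.sum_comm]
  conv_rhs => rw [sum_elementary B u]
  simp only [map_sum, map_smul, key, smul_eq_mul]
  refine Finset.sum_congr rfl fun J _ => Finset.sum_congr rfl fun I _ => mul_comm _ _

end LinearAlgebra

/-! ### Charts and frames -/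

section Manifold

variable (n : ℕ) (M : Type*) [TopologicalSpace M] [ChartedSpace (EuclideanSpace ℝ (Fin n)) M]

/-- The standard basis of `ℝⁿ`. -/
abbrev stdBasis : Module.Basis (Fin n) ℝ (EuclideanSpace ℝ (Fin n)) :=
  (EuclideanSpace.basisFun (Fin n) ℝ).toBasis

variable {n M}

/-- The differential `T_q e : T_q M → ℝⁿ` of a chart. -/
def chartDiff (e : OpenPartialHomeomorph M (EuclideanSpace ℝ (Fin n))) (q : M) :
    TangentSpace (𝓡 n) q →L[ℝ] EuclideanSpace ℝ (Fin n) :=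
  mfderiv (𝓡 n) (𝓡 n) e q

/-- The inverse `ℝⁿ → T_q M` of the differential of a chart at a point `q` of its domain. -/
def chartFrame (e : OpenPartialHomeomorph M (EuclideanSpace ℝ (Fin n))) (q : M) :
    EuclideanSpace ℝ (Fin n) →L[ℝ] TangentSpace (𝓡 n) q :=
  mfderiv (𝓡 n) (𝓡 n) e.symm (e q)

/-- The coordinate vector `∂_i` at `q`. -/
def coordVec (e : OpenPartialHomeomorph M (EuclideanSpace ℝ (Fin n))) (q : M) (i : Fin n) :
    TangentSpace (𝓡 n) q :=
  chartFrame e q (stdBasis n i)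

/-- The coordinate covector `dx^i` at `q`. -/
def coordCovec (e : OpenPartialHomeomorph M (EuclideanSpace ℝ (Fin n))) (q : M) (i : Fin n) :
    Module.Dual ℝ (TangentSpace (𝓡 n) q) :=
  (stdBasis n).coord i ∘ₗ (chartDiff e q).toLinearMap

/-- A basis of `T_q M`. Mathlib's `TangentSpace (𝓡 n) q` is `ℝⁿ`, through the coordinates of the
preferred chart at `q`. -/
def tangentBasis (q : M) : Module.Basis (Fin n) ℝ (TangentSpace (𝓡 n) q) :=
  stdBasis n

/-! ### Smooth tensor fields, `n`-forms and tensor-valued `n`-forms -/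

/-- `n`-forms at the point `q`. -/
abbrev NForm (n : ℕ) {M : Type*} [TopologicalSpace M]
    [ChartedSpace (EuclideanSpace ℝ (Fin n)) M] (q : M) : Type :=
  TangentSpace (𝓡 n) q [⋀^Fin n]→ₗ[ℝ] ℝ

/-- `(a, b)`-tensors at the point `q`: the fibre of `T^a_b M`. -/
abbrev TensorAt (n a b : ℕ) {M : Type*} [TopologicalSpace M]
    [ChartedSpace (EuclideanSpace ℝ (Fin n)) M] (q : M) : Type :=
  MixedTensor a b (TangentSpace (𝓡 n) q) ℝ

/-- The fibre of `T^a_b M ⊗ Λⁿ T*M` at the point `q`. -/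
abbrev FormTensorAt (n a b : ℕ) {M : Type*} [TopologicalSpace M]
    [ChartedSpace (EuclideanSpace ℝ (Fin n)) M] (q : M) : Type :=
  MixedTensor a b (TangentSpace (𝓡 n) q) (NForm n q)

/-- A field of `(a, b)`-tensors is smooth if its components in every chart are. -/
def IsSmoothTensor {a b : ℕ} (t : ∀ q : M, TensorAt n a b q) : Prop :=
  ∀ e ∈ atlas (EuclideanSpace ℝ (Fin n)) M, ∀ (J : Fin a → Fin n) (I : Fin b → Fin n),
    ContDiffOn ℝ ∞ (fun x => t (e.symm x) (fun k => coordCovec e (e.symm x) (J k))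
      (fun l => coordVec e (e.symm x) (I l))) e.target

/-- The coefficient `f` of an `n`-form `η = f dx¹ ∧ ⋯ ∧ dxⁿ` in a chart, as a function on the
range of the chart. -/
def coeff (e : OpenPartialHomeomorph M (EuclideanSpace ℝ (Fin n))) (η : ∀ q : M, NForm n q)
    (x : EuclideanSpace ℝ (Fin n)) : ℝ :=
  η (e.symm x) (coordVec e (e.symm x))

/-- The coefficients of a section of `T^a_b M ⊗ Λⁿ T*M` in a chart. -/
def tensorCoeff {a b : ℕ} (e : OpenPartialHomeomorph M (EuclideanSpace ℝ (Fin n)))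
    (ξ : ∀ q : M, FormTensorAt n a b q) (J : Fin a → Fin n) (I : Fin b → Fin n)
    (x : EuclideanSpace ℝ (Fin n)) : ℝ :=
  ξ (e.symm x) (fun k => coordCovec e (e.symm x) (J k)) (fun l => coordVec e (e.symm x) (I l))
    (coordVec e (e.symm x))

variable (n M)

/-- The space `Ωⁿ_c(M)` of smooth `n`-forms with compact support. -/
def CompactForms : Submodule ℝ (∀ q : M, NForm n q) where
  carrier := {η | (∀ e ∈ atlas (EuclideanSpace ℝ (Fin n)) M,
    ContDiffOn ℝ ∞ (coeff e η) e.target) ∧ ∃ K : Set M, IsCompact K ∧ ∀ q ∉ K, η q = 0}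
  add_mem' := by
    rintro η η' ⟨h, K, hK, h0⟩ ⟨h', K', hK', h0'⟩
    refine ⟨fun e he => (h e he).add (h' e he), K ∪ K', hK.union hK', fun q hq => ?_⟩
    rw [mem_union, not_or] at hq
    simp [h0 q hq.1, h0' q hq.2]
  zero_mem' := ⟨fun _ _ => contDiffOn_const, ∅, isCompact_empty, fun _ _ => rfl⟩
  smul_mem' := by
    rintro c η ⟨h, K, hK, h0⟩
    refine ⟨fun e he => (h e he).const_smul c, K, hK, fun q hq => ?_⟩
    simp [h0 q hq]

variable (a b : ℕ)

/-- The space `Γ_c(T^a_b M ⊗ Λⁿ T*M)` of smooth sections with compact support. -/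
def TestSections : Submodule ℝ (∀ q : M, FormTensorAt n a b q) where
  carrier := {ξ | (∀ e ∈ atlas (EuclideanSpace ℝ (Fin n)) M, ∀ J I,
    ContDiffOn ℝ ∞ (tensorCoeff e ξ J I) e.target) ∧
      ∃ K : Set M, IsCompact K ∧ ∀ q ∉ K, ξ q = 0}
  add_mem' := by
    rintro ξ ξ' ⟨h, K, hK, h0⟩ ⟨h', K', hK', h0'⟩
    refine ⟨fun e he J I => (h e he J I).add (h' e he J I), K ∪ K', hK.union hK', fun q hq => ?_⟩
    rw [mem_union, not_or] at hq
    simp [h0 q hq.1, h0' q hq.2]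
  zero_mem' := ⟨fun _ _ _ _ => contDiffOn_const, ∅, isCompact_empty, fun _ _ => rfl⟩
  smul_mem' := by
    rintro c ξ ⟨h, K, hK, h0⟩
    refine ⟨fun e he J I => (h e he J I).const_smul c, K, hK, fun q hq => ?_⟩
    simp [h0 q hq]

/-! ### Tensor distributions -/

/-- The topology of uniform convergence, on compact subsets of chart ranges, of all derivatives of
all coefficients. -/
@[reducible] def smoothTopology : TopologicalSpace (TestSections n M a b) :=
  ⨅ e ∈ atlas (EuclideanSpace ℝ (Fin n)) M, ⨅ (J : Fin a → Fin n) (I : Fin b → Fin n) (m : ℕ),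
    TopologicalSpace.induced
      (fun ξ => UniformOnFun.ofFun {L : Set (EuclideanSpace ℝ (Fin n)) | IsCompact L ∧ L ⊆ e.target}
        (iteratedFDeriv ℝ m (tensorCoeff e ξ.1 J I))) inferInstance

/-- The (LF)-topology on `Γ_c(T^a_b M ⊗ Λⁿ T*M)`: the finest locally convex vector space topology
for which the inclusions of the Fréchet spaces of sections supported in a fixed compact set `K`
are continuous. -/
instance lfTopology : TopologicalSpace (TestSections n M a b) :=
  sInf {t | (∀ K : Set M, IsCompact K →
      TopologicalSpace.coinduced
        (fun ξ : {ξ : TestSections n M a b // ∀ q ∉ K, ξ.1 q = 0} => ξ.1)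
        (TopologicalSpace.induced Subtype.val (smoothTopology n M a b)) ≤ t) ∧
    @IsTopologicalAddGroup _ t _ ∧ @ContinuousSMul ℝ _ _ _ t ∧
    @LocallyConvexSpace ℝ _ _ _ _ _ t}

/-- The space `𝓓'^r_s(M)` of `(r, s)`-tensor distributions: the continuous dual of
`Γ_c(T^s_r M ⊗ Λⁿ T*M)`. -/
abbrev TensorDistribution (r s : ℕ) : Type _ := TestSections n M s r →L[ℝ] ℝ

/-! ### Orientation and integration of `n`-forms -/

variable {n M}

/-- The sign `±1` of the frame of a chart `e` at `q` with respect to an orientation of `T_q M`. -/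
def chartSign (o : ∀ q : M, Orientation ℝ (TangentSpace (𝓡 n) q) (Fin n))
    (e : OpenPartialHomeomorph M (EuclideanSpace ℝ (Fin n))) (q : M) : ℝ :=
  Real.sign ((o q).someVector (coordVec e q))

variable (n M)

/-- An orientation of `M`: a choice of orientations of the tangent spaces which is locally
constant in charts. -/
structure ManifoldOrientation where
  /-- the orientation of each tangent space -/
  at_ : ∀ q : M, Orientation ℝ (TangentSpace (𝓡 n) q) (Fin n)
  locallyConstant : ∀ e ∈ atlas (EuclideanSpace ℝ (Fin n)) M, ∀ q ∈ e.source,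
    ∀ᶠ q' in 𝓝 q, chartSign at_ e q' = chartSign at_ e q

/-- A smooth partition of unity on `M` subordinate to the domains of the preferred charts. -/
def chartPartition [T2Space M] [SecondCountableTopology M] [IsManifold (𝓡 n) ∞ M] :
    SmoothPartitionOfUnity M (𝓡 n) M univ :=
  haveI : LocallyCompactSpace M := Manifold.locallyCompact_of_finiteDimensional (𝓡 n)
  (SmoothPartitionOfUnity.exists_isSubordinate_chartAt_source (𝓡 n) M).choose

variable {n M}

/-- `∫_M η` for an `n`-form supported in the domain of the chart `e`. -/
def chartIntegral (o : ManifoldOrientation n M)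
    (e : OpenPartialHomeomorph M (EuclideanSpace ℝ (Fin n))) (η : ∀ q : M, NForm n q) : ℝ :=
  ∫ x in e.target, chartSign o.at_ e (e.symm x) * coeff e η x

/-- The integral `∫_M η` of a compactly supported smooth `n`-form over the oriented manifold. -/
def formIntegral [T2Space M] [SecondCountableTopology M] [IsManifold (𝓡 n) ∞ M]
    (o : ManifoldOrientation n M) (η : ∀ q : M, NForm n q) : ℝ :=
  ∑ᶠ i : M, chartIntegral o (chartAt (EuclideanSpace ℝ (Fin n)) i)
    fun q => chartPartition n M i q • η q

/-- `⟨ρ(t), ξ⟩ = ∫_M t · ξ` for a smooth `(r, s)`-tensor field `t` and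
`ξ ∈ Γ_c(T^s_r M ⊗ Λⁿ T*M)`: the regular distribution given by `t`. -/
def regularDistribution [T2Space M] [SecondCountableTopology M] [IsManifold (𝓡 n) ∞ M] {r s : ℕ}
    (o : ManifoldOrientation n M) (t : ∀ q : M, TensorAt n r s q) (ξ : TestSections n M s r) : ℝ :=
  formIntegral o fun q => contract (tangentBasis q) (t q) (ξ.1 q)

/-! ### Smoothing kernels -/

/-- Smooth vector fields on `M`. -/
abbrev VField (n : ℕ) (M : Type*) [TopologicalSpace M]
    [ChartedSpace (EuclideanSpace ℝ (Fin n)) M] [IsManifold (𝓡 n) ∞ M] : Type _ :=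
  ContMDiffSection (𝓡 n) (EuclideanSpace ℝ (Fin n)) ∞ (fun q : M => TangentSpace (𝓡 n) q)

/-- `dx¹ ∧ ⋯ ∧ dxⁿ` at `q`. -/
def chartVolume (e : OpenPartialHomeomorph M (EuclideanSpace ℝ (Fin n))) (q : M) : NForm n q :=
  (stdBasis n).det.compLinearMap (chartDiff e q).toLinearMap

/-- The Lie derivative of an `n`-form: if `η = f dx¹ ∧ ⋯ ∧ dxⁿ` near `q` then
`L_X η = (∑ i, ∂_i (f X^i)) dx¹ ∧ ⋯ ∧ dxⁿ` at `q`. -/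
def lieForm [IsManifold (𝓡 n) ∞ M] (X : VField n M) (η : ∀ q : M, NForm n q) (q : M) :
    NForm n q :=
  let e := chartAt (EuclideanSpace ℝ (Fin n)) q
  (∑ i : Fin n, fderiv ℝ
    (fun x => coeff e η x * (stdBasis n).coord i (chartDiff e (e.symm x) (X (e.symm x))))
    (e q) (stdBasis n i)) • chartVolume e q

/-- The Lie derivative `(L_X Φ)(ε, p) = L_X (Φ(ε, p))` of a kernel in the form slot. -/
def lieKernel [IsManifold (𝓡 n) ∞ M] (X : VField n M) (Φ : ℝ → M → ∀ q : M, NForm n q) :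
    ℝ → M → ∀ q : M, NForm n q :=
  fun ε p => lieForm X (Φ ε p)

/-- The Lie derivative `(L'_X Φ)(ε, p) = d/dt|₀ Φ(ε, Fl^X_t p)` of a kernel in the point slot, that
is, the derivative of `p ↦ Φ(ε, p)(q) ∈ Λⁿ T_q* M` in the direction `X(p)`. -/
def lieKernel' [IsManifold (𝓡 n) ∞ M] (X : VField n M) (Φ : ℝ → M → ∀ q : M, NForm n q) :
    ℝ → M → ∀ q : M, NForm n q :=
  fun ε p q =>
    let e := chartAt (EuclideanSpace ℝ (Fin n)) q
    let c : ℝ := mfderiv (𝓡 n) 𝓘(ℝ, ℝ) (fun p' => Φ ε p' q (coordVec e q)) p (X p)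
    c • chartVolume e q

variable (n M)

/-- Smooth Riemannian metrics on `M`. -/
abbrev Metric [IsManifold (𝓡 n) ∞ M] : Type _ :=
  Bundle.ContMDiffRiemannianMetric (𝓡 n) ∞ (EuclideanSpace ℝ (Fin n))
    (fun q : M => TangentSpace (𝓡 n) q)

variable {n M}

open scoped Bundle in
/-- The open metric ball `B^g_ρ(p)` for the distance given by the Riemannian metric `g`. -/
def metricBall [IsManifold (𝓡 n) ∞ M] (g : Metric n M) (p : M) (ρ : ℝ) : Set M :=
  letI : Bundle.RiemannianBundle (fun q : M => TangentSpace (𝓡 n) q) := ⟨g.toRiemannianMetric⟩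
  {q | Manifold.riemannianEDist (𝓡 n) p q < ENNReal.ofReal ρ}

/-- `‖η‖_g ≤ c` for an `n`-form `η` at `q`. -/
def FormNormLE [IsManifold (𝓡 n) ∞ M] (g : Metric n M) {q : M} (η : NForm n q) (c : ℝ) : Prop :=
  ∀ v : Fin n → TangentSpace (𝓡 n) q, |η v| ≤ c * ∏ i, √(g.inner q (v i) (v i))

/-- The closed support of an `n`-form. -/
def formSupport (η : ∀ q : M, NForm n q) : Set M := closure {q | η q ≠ 0}

/-- `Φ ∈ C^∞(I × M, Ωⁿ_c(M))` with `I = (0, 1]`: the coefficients depend smoothly on all variables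
jointly, and locally in `(ε, p)` the supports stay in a fixed compact set. Values of `Φ` at
`ε ∉ (0, 1]` play no role. -/
structure IsSmoothKernel (Φ : ℝ → M → CompactForms n M) : Prop where
  smooth : ∀ e ∈ atlas (EuclideanSpace ℝ (Fin n)) M, ∀ e' ∈ atlas (EuclideanSpace ℝ (Fin n)) M,
    ContDiffOn ℝ ∞
      (fun z : ℝ × EuclideanSpace ℝ (Fin n) × EuclideanSpace ℝ (Fin n) =>
        coeff e' (Φ z.1 (e.symm z.2.1)).1 z.2.2)
      (Ioc 0 1 ×ˢ e.target ×ˢ e'.target)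
  support : ∀ ε₀ ∈ Ioc (0 : ℝ) 1, ∀ p₀ : M, ∃ L : Set M, IsCompact L ∧
    ∀ᶠ z in 𝓝[Ioc (0 : ℝ) 1 ×ˢ univ] (ε₀, p₀), formSupport (Φ z.1 z.2).1 ⊆ L

/-- Smoothing kernels: smooth maps `Φ` from `(0, 1] × M` to the `n`-forms of integral one which
satisfy the support condition and the growth conditions with respect to a Riemannian metric (none
of which depends on the choice of the metric). -/
structure IsSmoothingKernel [T2Space M] [SecondCountableTopology M] [IsManifold (𝓡 n) ∞ M]
    (o : ManifoldOrientation n M) (Φ : ℝ → M → CompactForms n M) : Prop where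
  smooth : IsSmoothKernel Φ
  integral_eq_one : ∀ ε ∈ Ioc (0 : ℝ) 1, ∀ p, formIntegral o (Φ ε p).1 = 1
  exists_metric : ∃ g : Metric n M,
    (∀ K : Set M, IsCompact K → ∃ ε₀ > (0 : ℝ), ∃ C > (0 : ℝ), ∀ p ∈ K, ∀ ε ∈ Ioc (0 : ℝ) 1,
      ε ≤ ε₀ → formSupport (Φ ε p).1 ⊆ metricBall g p (ε * C)) ∧
    (∀ K : Set M, IsCompact K → ∀ θ ζ : List (VField n M),
      ∃ ε₀ > (0 : ℝ), ∃ C > (0 : ℝ), ∀ p ∈ K, ∀ q : M, ∀ ε ∈ Ioc (0 : ℝ) 1, ε ≤ ε₀ →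
        FormNormLE g
          (θ.foldr lieKernel
            (ζ.foldr (fun X Ψ => lieKernel' X Ψ + lieKernel X Ψ) fun ε p => (Φ ε p).1) ε p q)
          (C * (ε ^ (n + θ.length))⁻¹))

/-! ### Covariant derivatives, geodesics and transport operators -/

variable (n M)

/-- Covariant derivatives on `M` (a smooth one is a `CovariantDerivative.ContMDiffCovariantDerivative _ ∞`). -/
abbrev Connection [IsManifold (𝓡 n) ∞ M] : Type _ :=
  CovariantDerivative (𝓡 n) (EuclideanSpace ℝ (Fin n)) (fun q : M => TangentSpace (𝓡 n) q)

variable {n M}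

/-- The Christoffel symbol `Γ(v, w)` at `q` in a chart: the coordinates of `∇_V W` at `q`, where
`V` and `W` are the vector fields with constant coordinates `v` and `w`. -/
def christoffel [IsManifold (𝓡 n) ∞ M] (cov : Connection n M)
    (e : OpenPartialHomeomorph M (EuclideanSpace ℝ (Fin n))) (q : M)
    (v w : EuclideanSpace ℝ (Fin n)) : EuclideanSpace ℝ (Fin n) :=
  chartDiff e q (cov (fun q' => chartFrame e q' w) q (chartFrame e q v))

/-- The velocity at time `t` of a curve on `[0, 1]` in a chart. -/
def velocity (e : OpenPartialHomeomorph M (EuclideanSpace ℝ (Fin n))) (γ : ℝ → M) (t : ℝ) :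
    EuclideanSpace ℝ (Fin n) :=
  derivWithin (fun τ => e (γ τ)) (Icc 0 1) t

/-- `γ : [0, 1] → M` is a geodesic: `u'' = -Γ(u)(u', u')` in charts. -/
structure IsGeodesic [IsManifold (𝓡 n) ∞ M] (cov : Connection n M) (γ : ℝ → M) : Prop where
  smooth : ContMDiffOn 𝓘(ℝ, ℝ) (𝓡 n) ∞ γ (Icc 0 1)
  eqn : ∀ t ∈ Icc (0 : ℝ) 1, ∀ e ∈ atlas (EuclideanSpace ℝ (Fin n)) M, γ t ∈ e.source →
    derivWithin (velocity e γ) (Icc 0 1) t =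
      -christoffel cov e (γ t) (velocity e γ t) (velocity e γ t)

/-- `Z` is parallel along `γ : [0, 1] → M`: `ρ' = -Γ(u)(u', ρ)` in charts. -/
def IsParallel [IsManifold (𝓡 n) ∞ M] (cov : Connection n M) (γ : ℝ → M)
    (Z : ∀ t : ℝ, TangentSpace (𝓡 n) (γ t)) : Prop :=
  ∀ t ∈ Icc (0 : ℝ) 1, ∀ e ∈ atlas (EuclideanSpace ℝ (Fin n)) M, γ t ∈ e.source →
    HasDerivWithinAt (fun τ => chartDiff e (γ τ) (Z τ))
      (-christoffel cov e (γ t) (velocity e γ t) (chartDiff e (γ t) (Z t))) (Icc 0 1) t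

variable (n M)

/-- Transport operators `A ∈ Γ(TO(TM, TM))`: smooth families of linear maps
`A(p, q) : T_p M → T_q M`. -/
structure TransportOperator where
  /-- the linear map from `T_p M` to `T_q M` -/
  map : ∀ p q : M, TangentSpace (𝓡 n) p →ₗ[ℝ] TangentSpace (𝓡 n) q
  smooth : ∀ e ∈ atlas (EuclideanSpace ℝ (Fin n)) M, ∀ e' ∈ atlas (EuclideanSpace ℝ (Fin n)) M,
    ∀ i j : Fin n, ContDiffOn ℝ ∞
      (fun z : EuclideanSpace ℝ (Fin n) × EuclideanSpace ℝ (Fin n) =>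
        coordCovec e' (e'.symm z.2) j
          (map (e.symm z.1) (e'.symm z.2) (coordVec e (e.symm z.1) i)))
      (e.target ×ˢ e'.target)

variable {n M}

/-- `A` is associated to the covariant derivative: every point has an open neighbourhood `U` in
which any two points are joined by exactly one geodesic contained in `U`, and for `x, y ∈ U` the map
`A(x, y)` is parallel transport along this geodesic. -/
def TransportOperator.IsAssociated [IsManifold (𝓡 n) ∞ M] (A : TransportOperator n M)
    (cov : Connection n M) : Prop :=
  ∀ p : M, ∃ U : Set M, IsOpen U ∧ p ∈ U ∧
    (∀ x ∈ U, ∀ y ∈ U,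
      (∃ γ : ℝ → M, IsGeodesic cov γ ∧ MapsTo γ (Icc 0 1) U ∧ γ 0 = x ∧ γ 1 = y) ∧
      (∀ γ γ' : ℝ → M, IsGeodesic cov γ → MapsTo γ (Icc 0 1) U → γ 0 = x → γ 1 = y →
        IsGeodesic cov γ' → MapsTo γ' (Icc 0 1) U → γ' 0 = x → γ' 1 = y →
          EqOn γ γ' (Icc 0 1))) ∧
    ∀ γ : ℝ → M, IsGeodesic cov γ → MapsTo γ (Icc 0 1) U →
      ∀ Z : ∀ t : ℝ, TangentSpace (𝓡 n) (γ t), IsParallel cov γ Z →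
        A.map (γ 0) (γ 1) (Z 0) = Z 1

/-- The action `A^a_b(p, q)` of a transport operator on `(a, b)`-tensors: `A(p, q)` in the
contravariant slots and the adjoint of `A(q, p)` in the covariant slots. -/
def TransportOperator.onTensors {a b : ℕ} (A : TransportOperator n M) (p q : M) :
    TensorAt n a b p →ₗ[ℝ] TensorAt n a b q :=
  mapTensor (A.map p q) (A.map q p)

/-! ### The embedding of tensor distributions -/

theorem sum_coordCovec_smul_coordVec [IsManifold (𝓡 n) ∞ M] (p : M)
    (w : TangentSpace (𝓡 n) p) :
    ∑ i, coordCovec (chartAt (EuclideanSpace ℝ (Fin n)) p) p i w •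
      coordVec (chartAt (EuclideanSpace ℝ (Fin n)) p) p i = w := by
  set e := chartAt (EuclideanSpace ℝ (Fin n)) p
  have he : e.MDifferentiable (𝓡 n) (𝓡 n) := mdifferentiable_chart p
  have h1 : chartFrame e p (chartDiff e p w) = w := by
    have := congrArg (fun f => f w) (he.symm_comp_deriv (mem_chart_source _ p))
    exact this
  conv_rhs => rw [← h1, ← (stdBasis n).sum_repr (chartDiff e p w), map_sum]
  refine Finset.sum_congr rfl fun i _ => ?_
  rw [map_smul]
  rfl

theorem TransportOperator.contDiffOn_covec [IsManifold (𝓡 n) ∞ M] (A : TransportOperator n M)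
    (p : M) (w : TangentSpace (𝓡 n) p) {e : OpenPartialHomeomorph M (EuclideanSpace ℝ (Fin n))}
    (he : e ∈ atlas (EuclideanSpace ℝ (Fin n)) M) (j : Fin n) :
    ContDiffOn ℝ ∞ (fun x => coordCovec e (e.symm x) j (A.map p (e.symm x) w)) e.target := by
  set e₀ := chartAt (EuclideanSpace ℝ (Fin n)) p with he₀
  have hp : e₀.symm (e₀ p) = p := e₀.left_inv (mem_chart_source _ p)
  have key : ∀ i, ContDiffOn ℝ ∞
      (fun x => coordCovec e (e.symm x) j (A.map p (e.symm x) (coordVec e₀ p i))) e.target := by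
    intro i
    have h := (A.smooth e₀ (chart_mem_atlas _ p) e he i j).comp
      (f := fun x => (e₀ p, x)) (contDiffOn_const.prodMk contDiffOn_id)
      (fun x hx => ⟨e₀.map_source (mem_chart_source _ p), hx⟩)
    have h' : ∀ p', e₀.symm (e₀ p) = p' → ContDiffOn ℝ ∞
        (fun x => coordCovec e (e.symm x) j (A.map p' (e.symm x) (coordVec e₀ p' i)))
          e.target := by
      rintro _ rfl
      exact h
    exact h' p hp
  have h2 : ∀ x, coordCovec e (e.symm x) j (A.map p (e.symm x) w) =
      ∑ i, coordCovec e₀ p i w *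
        coordCovec e (e.symm x) j (A.map p (e.symm x) (coordVec e₀ p i)) := by
    intro x
    conv_lhs => rw [← sum_coordCovec_smul_coordVec p w]
    simp only [map_sum, map_smul, smul_eq_mul]
    rfl
  simp only [h2]
  exact ContDiffOn.sum fun i _ => contDiffOn_const.mul (key i)

theorem TransportOperator.contDiffOn_vec [IsManifold (𝓡 n) ∞ M] (A : TransportOperator n M)
    (p : M) (β : Module.Dual ℝ (TangentSpace (𝓡 n) p))
    {e : OpenPartialHomeomorph M (EuclideanSpace ℝ (Fin n))}
    (he : e ∈ atlas (EuclideanSpace ℝ (Fin n)) M) (i : Fin n) :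
    ContDiffOn ℝ ∞ (fun x => β (A.map (e.symm x) p (coordVec e (e.symm x) i))) e.target := by
  set e₀ := chartAt (EuclideanSpace ℝ (Fin n)) p with he₀
  have hp : e₀.symm (e₀ p) = p := e₀.left_inv (mem_chart_source _ p)
  have key : ∀ j, ContDiffOn ℝ ∞
      (fun x => coordCovec e₀ p j (A.map (e.symm x) p (coordVec e (e.symm x) i))) e.target := by
    intro j
    have h := (A.smooth e he e₀ (chart_mem_atlas _ p) i j).comp
      (f := fun x => (x, e₀ p)) (contDiffOn_id.prodMk contDiffOn_const)
      (fun x hx => ⟨hx, e₀.map_source (mem_chart_source _ p)⟩)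
    have h' : ∀ p', e₀.symm (e₀ p) = p' → ContDiffOn ℝ ∞
        (fun x => coordCovec e₀ p' j (A.map (e.symm x) p' (coordVec e (e.symm x) i)))
          e.target := by
      rintro _ rfl
      exact h
    exact h' p hp
  have h2 : ∀ x, β (A.map (e.symm x) p (coordVec e (e.symm x) i)) =
      ∑ j, coordCovec e₀ p j (A.map (e.symm x) p (coordVec e (e.symm x) i)) *
        β (coordVec e₀ p j) := by
    intro x
    conv_lhs => rw [← sum_coordCovec_smul_coordVec p (A.map (e.symm x) p _)]
    simp only [map_sum, map_smul, smul_eq_mul]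
    rfl
  simp only [h2]
  exact ContDiffOn.sum fun j _ => (key j).mul contDiffOn_const

/-- The test section `A(p, ·) v ⊗ η` for a tensor `v` at `p` and `η ∈ Ωⁿ_c(M)`, as a linear
function of `v`. -/
def transportedSection [IsManifold (𝓡 n) ∞ M] {a b : ℕ} (A : TransportOperator n M) (p : M)
    (η : CompactForms n M) : TensorAt n a b p →ₗ[ℝ] TestSections n M a b where
  toFun v := ⟨fun q => tensorWith (η.1 q) (A.onTensors p q v), by
    obtain ⟨hη, K, hK, h0⟩ := η.2
    refine ⟨fun e he J I => ?_, K, hK, fun q hq => ?_⟩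
    · have h : ∀ x, tensorCoeff e (fun q => tensorWith (η.1 q) (A.onTensors p q v)) J I x =
          (∑ I' : Fin a → Fin n, ∑ J' : Fin b → Fin n,
            v (fun k => (tangentBasis p).coord (I' k)) (fun l => tangentBasis p (J' l)) *
            ((∏ k, coordCovec e (e.symm x) (J k) (A.map p (e.symm x) (tangentBasis p (I' k)))) *
             ∏ l, (tangentBasis p).coord (J' l)
                (A.map (e.symm x) p (coordVec e (e.symm x) (I l))))) * coeff e η.1 x := by
        intro x
        have h1 : tensorCoeff e (fun q => tensorWith (η.1 q) (A.onTensors p q v)) J I x =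
            v (fun k => (coordCovec e (e.symm x) (J k)).comp (A.map p (e.symm x)))
              (fun l => A.map (e.symm x) p (coordVec e (e.symm x) (I l))) * coeff e η.1 x := rfl
        rw [h1]
        congr 1
        conv_lhs => rw [sum_elementary (tangentBasis p) v]
        simp only [sum_apply, smul_apply, elementary_apply, smul_eq_mul]
        rfl
      refine ContDiffOn.congr ?_ fun x _ => h x
      refine ContDiffOn.mul ?_ (hη e he)
      refine ContDiffOn.sum fun I' _ => ContDiffOn.sum fun J' _ => contDiffOn_const.mul ?_
      exact (contDiffOn_prod fun k _ => A.contDiffOn_covec p _ he _).mul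
        (contDiffOn_prod fun l _ => A.contDiffOn_vec p _ he _)
    · ext
      simp [tensorWith_apply, h0 q hq]⟩
  map_add' v w := by
    ext q : 2
    simp
  map_smul' c v := by
    ext q : 2
    simp

/-- The embedding `ι` of `(r, s)`-tensor distributions: `(ι T)(η)` is the tensor field whose value
at `p` is determined by `(ι T)(η)(p) · v = ⟨T, A(p, ·) v ⊗ η⟩` for all `(s, r)`-tensors `v` at
`p`; see `contract_embed`. -/
def embed [IsManifold (𝓡 n) ∞ M] {r s : ℕ} (A : TransportOperator n M)
    (T : TensorDistribution n M r s) (η : CompactForms n M) (p : M) : TensorAt n r s p :=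
  ofFunctional (tangentBasis p) (T.toLinearMap ∘ₗ transportedSection A p η)

theorem contract_embed [IsManifold (𝓡 n) ∞ M] {r s : ℕ} (A : TransportOperator n M)
    (T : TensorDistribution n M r s) (η : CompactForms n M) (p : M) (v : TensorAt n s r p) :
    contract (tangentBasis p) (embed A T η p) v = T (transportedSection A p η v) :=
  contract_ofFunctional _ _ _

/-- The regularization `T_ε(p) = (ι T)(Φ(ε, p))(p)` of a tensor distribution. -/
def regularization [IsManifold (𝓡 n) ∞ M] {r s : ℕ} (A : TransportOperator n M)
    (T : TensorDistribution n M r s) (Φ : ℝ → M → CompactForms n M) (ε : ℝ) (p : M) :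
    TensorAt n r s p :=
  embed A T (Φ ε p) p

end Manifold

end TensorRegularization

end

/-! Smoothness. In a chart the components of `T_ε` are values of `T` on the sections `A(p, ·) v ⊗
Φ(ε, p)`, which depend smoothly on `p` and whose supports, locally in `p`, stay in one compact set.
A continuous functional may be differentiated with respect to such a parameter, because the Taylor
remainder divided by the increment tends to zero together with all derivatives in the test variable
(`IsTestContinuous.hasFDerivAt_slice`, `IsTestContinuous.contDiff_slice`).

Convergence. A partition of unity reduces to `ξ` supported in a chart. Let `φ_ε(x, y)` be the signed
coefficient of `Φ(ε, x)` at `y`, and `a(x, y)` a component of `A(x, y) ξ(x)`, cut off in `y`.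
Continuous functionals commute with integrals of smooth families, by Riemann sums
(`IsTestContinuous.integral_slice`), so `∫ T_ε · ξ` is the sum over components `S` of `T` of `S (y ↦
∫ a(x, y) φ_ε(x, y) dx)`. It remains to show that these test functions converge to `a(y, y)` with
all derivatives. Since `A(y, y)` is the identity (constant curves are geodesics with constant
parallel fields), `a(y, y)` is the component of `ξ`.

The difficulty is that the integral runs over `x` while `φ_ε` has mass one in `y`. For coordinate
fields the operators `L'_X + L_X` are the diagonal derivatives `∂_{x_i} + ∂_{y_i}`, and these do not
worsen the bound `ε⁻ⁿ`. Hence `φ_ε(y - w, y)` and `φ_ε(y, y + w)`, taken at two points of one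
diagonal line, differ by `O(‖w‖ ε⁻ⁿ)`. Over a ball of radius `O(ε)` this integrates to `O(ε)`
(`IsKernelFamily.tendsto_integral`). For derivatives, `∂_{y_i}` of the integral equals the integral
of the diagonal derivative, because `∂_{x_i}` integrates to zero. The Leibniz rule then distributes
it over `a` and `φ_ε`, and a diagonal derivative of a kernel family is a kernel family of mass zero
(`IsKernelFamily.dirDeriv_diag`), so induction applies
(`IsKernelFamily.tendsto_dirDerivs_integral`).

Two translations bring the kernel into a chart (`IsSmoothingKernel.isKernelFamily`). Lie derivatives
of forms, defined through the preferred chart at each point, are carried to a fixed chart by the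
divergence identity for cofactor matrices (`sum_fderiv_pullback`). Small Riemannian balls are
compared with coordinate balls (`exists_metricBall_subset`). -/

noncomputable section

namespace TensorRegularization

/-! ### Iterated directional derivatives -/

section DirectionalDerivatives

variable {E : Type*} [NormedAddCommGroup E] [NormedSpace ℝ E]

/-- The derivative of `f` in the constant direction `v`. -/
def dirDeriv (v : E) (f : E → ℝ) : E → ℝ := fun z => fderiv ℝ f z v

/-- The iterated derivative of `f` in the directions of a list, starting with its head. -/
def dirDerivs : List E → (E → ℝ) → E → ℝ
  | [], f => f
  | v :: l, f => dirDerivs l (dirDeriv v f)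

@[simp] theorem dirDerivs_nil (f : E → ℝ) : dirDerivs [] f = f := rfl

@[simp] theorem dirDerivs_cons (v : E) (l : List E) (f : E → ℝ) :
    dirDerivs (v :: l) f = dirDerivs l (dirDeriv v f) := rfl

theorem ContDiffOn.dirDeriv {f : E → ℝ} {U : Set E} (hU : IsOpen U) (hf : ContDiffOn ℝ ∞ f U)
    (v : E) : ContDiffOn ℝ ∞ (dirDeriv v f) U :=
  (hf.fderiv_of_isOpen hU (m := ∞) le_rfl).clm_apply contDiffOn_const

theorem ContDiffOn.dirDerivs {f : E → ℝ} {U : Set E} (hU : IsOpen U) (l : List E)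
    (hf : ContDiffOn ℝ ∞ f U) : ContDiffOn ℝ ∞ (dirDerivs l f) U := by
  induction l generalizing f with
  | nil => exact hf
  | cons v l ih => exact ih (ContDiffOn.dirDeriv hU hf v)

theorem contDiff_dirDeriv {f : E → ℝ} (hf : ContDiff ℝ ∞ f) (v : E) :
    ContDiff ℝ ∞ (dirDeriv v f) :=
  (hf.fderiv_right (m := ∞) le_rfl).clm_apply contDiff_const

theorem contDiff_dirDerivs {f : E → ℝ} (hf : ContDiff ℝ ∞ f) (l : List E) :
    ContDiff ℝ ∞ (dirDerivs l f) := by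
  induction l generalizing f with
  | nil => exact hf
  | cons v l ih => exact ih (contDiff_dirDeriv hf v)

theorem dirDeriv_congr {f g : E → ℝ} {x : E} (h : f =ᶠ[𝓝 x] g) (v : E) :
    dirDeriv v f =ᶠ[𝓝 x] dirDeriv v g := by
  filter_upwards [h.fderiv (𝕜 := ℝ)] with y hy
  simp [dirDeriv, hy]

theorem dirDerivs_congr {f g : E → ℝ} {x : E} (l : List E) (h : f =ᶠ[𝓝 x] g) :
    dirDerivs l f =ᶠ[𝓝 x] dirDerivs l g := by
  induction l generalizing f g with
  | nil => exact h
  | cons v l ih => exact ih (dirDeriv_congr h v)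

theorem dirDeriv_zero (v : E) : dirDeriv v (fun _ : E => (0 : ℝ)) = fun _ => 0 := by
  ext; simp [dirDeriv]

theorem dirDerivs_zero (l : List E) : dirDerivs l (fun _ : E => (0 : ℝ)) = fun _ => 0 := by
  induction l with
  | nil => rfl
  | cons v l ih => simp [dirDeriv_zero, ih]

theorem dirDerivs_eq_zero {f : E → ℝ} {x : E} (l : List E) (h : f =ᶠ[𝓝 x] fun _ => 0) :
    dirDerivs l f x = 0 := by
  simpa [dirDerivs_zero] using (dirDerivs_congr l h).eq_of_nhds

theorem dirDerivs_eq_zero_of_isClosed {f : E → ℝ} {K : Set E} (hK : IsClosed K)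
    (h : ∀ y ∉ K, f y = 0) (l : List E) {x : E} (hx : x ∉ K) : dirDerivs l f x = 0 :=
  dirDerivs_eq_zero l <| by
    filter_upwards [hK.isOpen_compl.mem_nhds hx] with y hy using h y hy

theorem dirDeriv_add {f g : E → ℝ} (hf : ContDiff ℝ ∞ f) (hg : ContDiff ℝ ∞ g) (v : E) :
    dirDeriv v (fun z => f z + g z) = fun z => dirDeriv v f z + dirDeriv v g z := by
  ext z
  simp only [dirDeriv]
  rw [fderiv_fun_add (hf.differentiable (by simp) z) (hg.differentiable (by simp) z)]
  rfl

theorem dirDerivs_add {f g : E → ℝ} (hf : ContDiff ℝ ∞ f) (hg : ContDiff ℝ ∞ g) (l : List E) :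
    dirDerivs l (fun z => f z + g z) = fun z => dirDerivs l f z + dirDerivs l g z := by
  induction l generalizing f g with
  | nil => rfl
  | cons v l ih =>
    simp only [dirDerivs_cons, dirDeriv_add hf hg]
    exact ih (contDiff_dirDeriv hf v) (contDiff_dirDeriv hg v)

theorem dirDeriv_const_mul (c : ℝ) (f : E → ℝ) (v : E) :
    dirDeriv v (fun z => c * f z) = fun z => c * dirDeriv v f z := by
  ext z
  simp only [dirDeriv]
  have : fderiv ℝ (fun z => c * f z) z = c • fderiv ℝ f z := by
    exact congrFun (fderiv_const_smul_field (𝕜 := ℝ) (f := f) c) z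
  rw [this]
  rfl

theorem dirDerivs_const_mul (c : ℝ) (f : E → ℝ) (l : List E) :
    dirDerivs l (fun z => c * f z) = fun z => c * dirDerivs l f z := by
  induction l generalizing f with
  | nil => rfl
  | cons v l ih => simp only [dirDerivs_cons, dirDeriv_const_mul, ih]

theorem dirDerivs_sub {f g : E → ℝ} (hf : ContDiff ℝ ∞ f) (hg : ContDiff ℝ ∞ g) (l : List E) :
    dirDerivs l (fun z => f z - g z) = fun z => dirDerivs l f z - dirDerivs l g z := by
  have h : (fun z => f z - g z) = fun z => f z + (-1) * g z := by ext; ring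
  rw [h, dirDerivs_add hf (contDiff_const.mul hg), dirDerivs_const_mul]
  ext; ring

theorem dirDerivs_sum {ι : Type*} (s : Finset ι) {f : ι → E → ℝ} (hf : ∀ i, ContDiff ℝ ∞ (f i))
    (l : List E) :
    dirDerivs l (fun z => ∑ i ∈ s, f i z) = fun z => ∑ i ∈ s, dirDerivs l (f i) z := by
  classical
  induction s using Finset.induction_on with
  | empty => simp [dirDerivs_zero]
  | insert i s hi ih =>
    simp only [Finset.sum_insert hi]
    rw [dirDerivs_add (hf i) (ContDiff.sum fun j _ => hf j), ih]

theorem dirDeriv_comm {f : E → ℝ} (hf : ContDiff ℝ ∞ f) (v w : E) :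
    dirDeriv v (dirDeriv w f) = dirDeriv w (dirDeriv v f) := by
  ext z
  have hd : Differentiable ℝ (fderiv ℝ f) :=
    (hf.fderiv_right (m := ∞) le_rfl).differentiable (by simp)
  have key : ∀ a b : E, dirDeriv a (dirDeriv b f) z = fderiv ℝ (fderiv ℝ f) z a b := by
    intro a b
    have : HasFDerivAt (fun x => fderiv ℝ f x b)
        ((fderiv ℝ (fderiv ℝ f) z).flip b) z := by
      have := (hd z).hasFDerivAt.clm_apply (hasFDerivAt_const b z)
      simpa using this
    change fderiv ℝ (fun x => fderiv ℝ f x b) z a = _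
    rw [this.fderiv]
    rfl
  rw [key, key]
  exact (hf.contDiffAt.isSymmSndFDerivAt (by simpa using WithTop.coe_le_coe.2 (le_top : (2 : ℕ∞) ≤ ⊤))).eq v w

/-- Lets a parameter derivative pass the derivatives in the test variable in
`IsTestContinuous.hasFDerivAt_slice`. -/
theorem dirDerivs_dirDeriv {f : E → ℝ} (hf : ContDiff ℝ ∞ f) (l : List E) (v : E) :
    dirDerivs l (dirDeriv v f) = dirDeriv v (dirDerivs l f) := by
  induction l generalizing f with
  | nil => rfl
  | cons w l ih =>
    simp only [dirDerivs_cons]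
    rw [← ih (contDiff_dirDeriv hf w), dirDeriv_comm hf]

theorem fderiv_eq_sum_dirDeriv {ι : Type*} [Fintype ι] [FiniteDimensional ℝ E]
    (b : Module.Basis ι ℝ E) (f : E → ℝ) (z : E) :
    fderiv ℝ f z = ∑ i, dirDeriv (b i) f z • (b.coord i).toContinuousLinearMap := by
  ext v
  conv_lhs => rw [← b.sum_repr v, map_sum]
  simp [dirDeriv, mul_comm]

/-- Bounds for the iterated partial derivatives bound the iterated Fréchet derivative. -/
theorem exists_norm_iteratedFDeriv_le {ι : Type*} [Fintype ι] [FiniteDimensional ℝ E]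
    (b : Module.Basis ι ℝ E) (m : ℕ) :
    ∃ C : ℝ, 0 ≤ C ∧ ∀ (f : E → ℝ), ContDiff ℝ ∞ f → ∀ (x : E) (B : ℝ),
      (∀ l : Fin m → ι, |dirDerivs (List.ofFn fun k => b (l k)) f x| ≤ B) →
        ‖iteratedFDeriv ℝ m f x‖ ≤ C * B := by
  induction m with
  | zero =>
    refine ⟨1, zero_le_one, fun f hf x B h => ?_⟩
    simpa using h Fin.elim0
  | succ m ih =>
    obtain ⟨C, hC, h⟩ := ih
    -- `fderiv ℝ f` is the sum of the coordinate functionals weighted by the partial derivatives;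
    -- each summand costs the norm of its functional times the constant for order `m`.
    refine ⟨∑ i, ‖(b.coord i).toContinuousLinearMap‖ * C,
      Finset.sum_nonneg fun i _ => mul_nonneg (norm_nonneg _) hC, fun f hf x B hB => ?_⟩
    rw [← norm_iteratedFDeriv_fderiv]
    have h1 : fderiv ℝ f =
        fun z => ∑ i, dirDeriv (b i) f z • (b.coord i).toContinuousLinearMap :=
      funext fun z => fderiv_eq_sum_dirDeriv b f z
    rw [h1, iteratedFDeriv_fun_sum_apply (fun i _ => ?_), Finset.sum_mul]
    · refine (norm_sum_le _ _).trans (Finset.sum_le_sum fun i _ => ?_)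
      have h2 : (fun z => dirDeriv (b i) f z • (b.coord i).toContinuousLinearMap) =
          (ContinuousLinearMap.toSpanSingleton ℝ (b.coord i).toContinuousLinearMap) ∘
            dirDeriv (b i) f := by
        ext; simp
      have hsm := contDiff_dirDeriv hf (b i)
      rw [h2, mul_assoc]
      refine (ContinuousLinearMap.norm_iteratedFDeriv_comp_left (N := m) _
        (hsm.of_le (by exact_mod_cast le_top)).contDiffAt le_rfl).trans ?_
      rw [ContinuousLinearMap.norm_toSpanSingleton]
      refine mul_le_mul_of_nonneg_left (h _ hsm x B fun l => ?_) (norm_nonneg _)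
      -- `dirDerivs` consumes lists from the head, so the directions for `∂_i f` are preceded by
      -- `i`.
      have := hB (Fin.cons i l)
      simpa [List.ofFn_succ] using this
    · exact ((contDiff_dirDeriv hf (b i)).of_le (by exact_mod_cast le_top)).contDiffAt.smul contDiffAt_const

end DirectionalDerivatives

/-! ### Partial functions and extension by zero -/

section Slices

variable {E F : Type*} [NormedAddCommGroup E] [NormedSpace ℝ E] [NormedAddCommGroup F]
  [NormedSpace ℝ F]

theorem dirDeriv_slice {G : E × F → ℝ} (hG : ContDiff ℝ ∞ G) (x : E) (v : F) :
    dirDeriv v (fun y => G (x, y)) = fun y => dirDeriv (0, v) G (x, y) := by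
  ext y
  have h : HasFDerivAt (fun y => G (x, y))
      ((fderiv ℝ G (x, y)).comp (ContinuousLinearMap.inr ℝ E F)) y :=
    (hG.differentiable (by simp) (x, y)).hasFDerivAt.comp y (hasFDerivAt_prodMk_right x y)
  simp [dirDeriv, h.fderiv]

theorem dirDerivs_slice {G : E × F → ℝ} (hG : ContDiff ℝ ∞ G) (x : E) (l : List F) :
    dirDerivs l (fun y => G (x, y)) =
      fun y => dirDerivs (l.map fun v => ((0 : E), v)) G (x, y) := by
  induction l generalizing G with
  | nil => rfl
  | cons v l ih =>
    simp only [dirDerivs_cons, List.map_cons, dirDeriv_slice hG]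
    exact ih (contDiff_dirDeriv hG _)

/-- Extension by zero of a function which is smooth on an open set. -/
theorem contDiff_indicator {f : E → ℝ} {U K : Set E} (hU : IsOpen U) (hK : IsClosed K)
    (hKU : K ⊆ U) (hf : ContDiffOn ℝ ∞ f U) (h0 : ∀ x ∈ U, x ∉ K → f x = 0) :
    ContDiff ℝ ∞ (U.indicator f) := by
  rw [contDiff_iff_contDiffAt]
  intro x
  by_cases hx : x ∈ K
  · have hx' := hU.mem_nhds (hKU hx)
    refine (hf.contDiffAt hx').congr_of_eventuallyEq ?_
    filter_upwards [hx'] with y hy using indicator_of_mem hy f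
  · refine (contDiffAt_const (c := (0 : ℝ))).congr_of_eventuallyEq ?_
    filter_upwards [hK.isOpen_compl.mem_nhds hx] with y hy
    by_cases hyU : y ∈ U
    · rw [indicator_of_mem hyU, h0 y hyU hy]
    · rw [indicator_of_notMem hyU]

end Slices

/-! ### Continuous functionals on spaces of test functions -/

section TestFunctions

/-- Smooth functions which vanish outside `K`. -/
def testSpace {n : ℕ} (K : Set (EuclideanSpace ℝ (Fin n))) :
    Submodule ℝ (EuclideanSpace ℝ (Fin n) → ℝ) where
  carrier := {f | ContDiff ℝ ∞ f ∧ ∀ y ∉ K, f y = 0}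
  add_mem' := by
    rintro f g ⟨hf, hf0⟩ ⟨hg, hg0⟩
    exact ⟨hf.add hg, fun y hy => by simp [hf0 y hy, hg0 y hy]⟩
  zero_mem' := ⟨contDiff_const, fun _ _ => rfl⟩
  smul_mem' := by
    rintro c f ⟨hf, hf0⟩
    exact ⟨hf.const_smul c, fun y hy => by simp [hf0 y hy]⟩

/-- All partial derivatives of the `f t` converge uniformly to zero. -/
def NullFamily {n : ℕ} {ι : Type*} (L : Filter ι) (f : ι → EuclideanSpace ℝ (Fin n) → ℝ) : Prop :=
  ∀ l : List (Fin n), ∀ δ > (0 : ℝ), ∀ᶠ t in L, ∀ y,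
    |dirDerivs (l.map (stdBasis n)) (f t) y| ≤ δ

/-- A functional on test functions is continuous if it maps null families to null families. -/
def IsTestContinuous {n : ℕ} {K : Set (EuclideanSpace ℝ (Fin n))} (S : testSpace K →ₗ[ℝ] ℝ) :
    Prop :=
  ∀ (ι : Type) (L : Filter ι) (f : ι → testSpace K), NullFamily L (fun t => (f t).1) →
    Tendsto (fun t => S (f t)) L (𝓝 0)

variable {n d : ℕ}

local notation "E" => EuclideanSpace ℝ (Fin n)
local notation "X" => EuclideanSpace ℝ (Fin d)

/-- The test function `F(x, ·)`. -/
def slice {K : Set E} (F : X × E → ℝ) (hF : ContDiff ℝ ∞ F) (h0 : ∀ x, ∀ y ∉ K, F (x, y) = 0)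
    (x : X) : testSpace K :=
  ⟨fun y => F (x, y), hF.comp (contDiff_const.prodMk contDiff_id), fun y hy => h0 x y hy⟩

theorem dirDeriv_fst_eq_zero {K : Set E} {F : X × E → ℝ} (hK : IsClosed K)
    (h0 : ∀ x, ∀ y ∉ K, F (x, y) = 0) (v : X × E) (x : X) (y : E) (hy : y ∉ K) :
    dirDeriv v F (x, y) = 0 :=
  dirDerivs_eq_zero_of_isClosed (K := univ ×ˢ K) (isClosed_univ.prod hK)
    (fun z hz => h0 z.1 z.2 (by simpa using hz)) [v] (by simpa using hy)

theorem dirDerivs_fst_eq_zero {K : Set E} {F : X × E → ℝ} (hK : IsClosed K)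
    (h0 : ∀ x, ∀ y ∉ K, F (x, y) = 0) (l : List (X × E)) (x : X) (y : E) (hy : y ∉ K) :
    dirDerivs l F (x, y) = 0 :=
  dirDerivs_eq_zero_of_isClosed (K := univ ×ˢ K) (isClosed_univ.prod hK)
    (fun z hz => h0 z.1 z.2 (by simpa using hz)) l (by simpa using hy)

/-- First order Taylor expansion in the first variable, uniform in the second one. -/
theorem eventually_taylor_le {K : Set E} (hK : IsCompact K) {H : X × E → ℝ}
    (hH : ContDiff ℝ ∞ H) (x : X) {δ : ℝ} (hδ : 0 < δ) :
    ∀ᶠ x' in 𝓝 x, ∀ y ∈ K,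
      |H (x', y) - H (x, y) - fderiv ℝ H (x, y) (x' - x, 0)| ≤ δ * ‖x' - x‖ := by
  -- By compactness it suffices to treat `(x', z)` near `(x, y)` for each `y ∈ K`. Strict
  -- differentiability at `(x, y)` lets both end points `(x', z)` and `(x, z)` move, at the cost of
  -- `δ / 2`; replacing the derivative at `(x, y)` by the one at `(x, z)` costs the other half.
  refine hK.eventually_forall_of_forall_eventually fun y _ => ?_
  have h1 := (hH.contDiffAt (x := (x, y))).hasStrictFDerivAt (by simp)
  have h2 := (h1.isLittleO.def (half_pos hδ))
  have hc : ContinuousAt (fun z : X × E => fderiv ℝ H (x, z.2)) (x, y) :=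
    ((hH.continuous_fderiv (by simp)).comp (continuous_const.prodMk continuous_snd)).continuousAt
  have h3 := Metric.continuousAt_iff'.1 hc (δ / 2) (half_pos hδ)
  have h4 : Tendsto (fun z : X × E => (((z.1, z.2), (x, z.2)) : (X × E) × (X × E)))
      (𝓝 (x, y)) (𝓝 ((x, y), (x, y))) := by
    have : Continuous fun z : X × E => (((z.1, z.2), (x, z.2)) : (X × E) × (X × E)) := by
      fun_prop
    exact this.tendsto (x, y)
  filter_upwards [h4.eventually h2, h3] with z hz1 hz2
  have e1 : ((z.1, z.2) : X × E) - (x, z.2) = (z.1 - x, 0) := by ext1 <;> simp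
  have e2 : ‖((z.1 - x, 0) : X × E)‖ = ‖z.1 - x‖ := by simp [Prod.norm_def]
  rw [e1, e2] at hz1
  have hz3 : |(fderiv ℝ H (x, y) - fderiv ℝ H (x, z.2)) (z.1 - x, 0)| ≤ δ / 2 * ‖z.1 - x‖ := by
    have := (fderiv ℝ H (x, y) - fderiv ℝ H (x, z.2)).le_opNorm (z.1 - x, 0)
    rw [e2] at this
    refine this.trans (mul_le_mul_of_nonneg_right ?_ (norm_nonneg _))
    rw [← dist_eq_norm, dist_comm]
    exact hz2.le
  have := abs_add_le (H (z.1, z.2) - H (x, z.2) - fderiv ℝ H (x, y) (z.1 - x, 0))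
    ((fderiv ℝ H (x, y) - fderiv ℝ H (x, z.2)) (z.1 - x, 0))
  rw [Real.norm_eq_abs] at hz1
  simp only [_root_.sub_apply] at this hz3
  rw [show H (z.1, z.2) - H (x, z.2) - fderiv ℝ H (x, y) (z.1 - x, 0) +
    (fderiv ℝ H (x, y) (z.1 - x, 0) - fderiv ℝ H (x, z.2) (z.1 - x, 0)) =
      H (z.1, z.2) - H (x, z.2) - fderiv ℝ H (x, z.2) (z.1 - x, 0) by ring] at this
  linarith

/-- A continuous functional may be differentiated with respect to parameters. -/
theorem IsTestContinuous.hasFDerivAt_slice {K : Set E} {S : testSpace K →ₗ[ℝ] ℝ}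
    (hS : IsTestContinuous S) (hK : IsCompact K)
    {F : X × E → ℝ} (hF : ContDiff ℝ ∞ F) (h0 : ∀ x, ∀ y ∉ K, F (x, y) = 0) (x : X) :
    HasFDerivAt (fun x => S (slice F hF h0 x))
      (∑ i, S (slice (dirDeriv (stdBasis d i, 0) F) (contDiff_dirDeriv hF _)
        (fun x y hy => dirDeriv_fst_eq_zero hK.isClosed h0 _ x y hy) x) •
          ((stdBasis d).coord i).toContinuousLinearMap) x := by
  set F' : Fin d → testSpace K := fun i => slice (dirDeriv (stdBasis d i, 0) F)
    (contDiff_dirDeriv hF _) (fun x y hy => dirDeriv_fst_eq_zero hK.isClosed h0 _ x y hy) x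
  -- `g x'` is the Taylor remainder divided by the increment. Differentiability means that `S (g
  -- x')` tends to zero, which holds once `g` is a null family.
  set g : X → testSpace K := fun x' => ‖x' - x‖⁻¹ • (slice F hF h0 x' - slice F hF h0 x -
    ∑ i, (stdBasis d).coord i (x' - x) • F' i) with hg
  have hnull : NullFamily (𝓝 x) (fun x' => (g x').1) := by
    intro l δ hδ
    set l' : List (X × E) := (l.map (stdBasis n)).map fun v => ((0 : X), v)
    set H := dirDerivs l' F
    have hH : ContDiff ℝ ∞ H := contDiff_dirDerivs hF l'
    have hH0 : ∀ x, ∀ y ∉ K, H (x, y) = 0 := fun x y hy =>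
      dirDerivs_fst_eq_zero hK.isClosed h0 l' x y hy
    filter_upwards [eventually_taylor_le hK hH x hδ] with x' hx' y
    -- Since derivatives in the parameter and in the test variable commute, a `y`-derivative of the
    -- remainder of `F` is the remainder of `H`.
    have hval : dirDerivs (l.map (stdBasis n)) (g x').1 y =
        ‖x' - x‖⁻¹ * (H (x', y) - H (x, y) - fderiv ℝ H (x, y) (x' - x, 0)) := by
      have e1 : (g x').1 = fun y => ‖x' - x‖⁻¹ * ((F (x', y) - F (x, y)) -
          ∑ i, (stdBasis d).coord i (x' - x) * dirDeriv (stdBasis d i, 0) F (x, y)) := by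
        ext y
        simp [hg, F', slice]
      have c1 : ∀ x', ContDiff ℝ ∞ fun y => F (x', y) := fun x' =>
        hF.comp (contDiff_const.prodMk contDiff_id)
      have c2 : ∀ i, ContDiff ℝ ∞ fun y => (stdBasis d).coord i (x' - x) *
          dirDeriv (stdBasis d i, 0) F (x, y) := fun i =>
        contDiff_const.mul ((contDiff_dirDeriv hF _).comp (contDiff_const.prodMk contDiff_id))
      rw [e1, dirDerivs_const_mul, dirDerivs_sub ((c1 x').sub (c1 x))
        (ContDiff.sum fun i _ => c2 i), dirDerivs_sub (c1 x') (c1 x), dirDerivs_sum _ c2]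
      simp only [dirDerivs_const_mul, dirDerivs_slice hF, dirDerivs_slice (contDiff_dirDeriv hF _)]
      congr 2
      have e2 : ((x' - x, 0) : X × E) =
          ∑ i, (stdBasis d).coord i (x' - x) • ((stdBasis d i, 0) : X × E) := by
        ext1
        · rw [Prod.fst_sum]
          exact ((stdBasis d).sum_repr (x' - x)).symm
        · simp [Prod.snd_sum]
      rw [e2, map_sum]
      refine Finset.sum_congr rfl fun i _ => ?_
      rw [map_smul, smul_eq_mul]
      congr 1
      exact congrFun (dirDerivs_dirDeriv hF l' _) (x, y)
    rw [hval]
    by_cases hy : y ∈ K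
    -- At `x' = x` the convention `0⁻¹ = 0` makes the quotient vanish.
    · rcases eq_or_ne (‖x' - x‖) 0 with h | h
      · simp [h, hδ.le]
      · have hpos : 0 < ‖x' - x‖ := lt_of_le_of_ne (norm_nonneg _) h.symm
        rw [abs_mul, abs_of_pos (inv_pos.2 hpos), inv_mul_le_iff₀ hpos, mul_comm]
        exact hx' y hy
    · have e3 : fderiv ℝ H (x, y) (x' - x, 0) = 0 :=
        dirDeriv_fst_eq_zero hK.isClosed hH0 (x' - x, 0) x y hy
      simp [hH0 _ y hy, e3, hδ.le]
  have hlim := hS X (𝓝 x) g hnull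
  rw [hasFDerivAt_iff_tendsto]
  refine (tendsto_zero_iff_norm_tendsto_zero.1 hlim).congr fun x' => ?_
  simp only [hg, map_smul, map_sub, map_sum, norm_mul, norm_inv, norm_norm, smul_eq_mul]
  congr 2
  simp [F', mul_comm, mul_sub, sub_mul, Finset.sum_sub_distrib]

/-- Induction on the order: the derivative is a combination of functions of the same kind, with `F`
replaced by its partial derivatives in the parameter. -/
theorem IsTestContinuous.contDiff_slice {K : Set E} {S : testSpace K →ₗ[ℝ] ℝ}
    (hS : IsTestContinuous S) (hK : IsCompact K)
    {F : X × E → ℝ} (hF : ContDiff ℝ ∞ F) (h0 : ∀ x, ∀ y ∉ K, F (x, y) = 0) :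
    ContDiff ℝ ∞ (fun x => S (slice F hF h0 x)) := by
  rw [contDiff_infty]
  intro k
  induction k generalizing F with
  | zero =>
    exact contDiff_zero.2 (continuous_iff_continuousAt.2 fun x =>
      (hS.hasFDerivAt_slice hK hF h0 x).continuousAt)
  | succ k ih =>
    rw [Nat.cast_add, Nat.cast_one, contDiff_succ_iff_fderiv]
    refine ⟨fun x => (hS.hasFDerivAt_slice hK hF h0 x).differentiableAt, by simp, ?_⟩
    have : fderiv ℝ (fun x => S (slice F hF h0 x)) = fun x =>
      (∑ i, S (slice (dirDeriv (stdBasis d i, 0) F) (contDiff_dirDeriv hF _)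
        (fun x y hy => dirDeriv_fst_eq_zero hK.isClosed h0 _ x y hy) x) •
          ((stdBasis d).coord i).toContinuousLinearMap) :=
      funext fun x => (hS.hasFDerivAt_slice hK hF h0 x).fderiv
    rw [this]
    exact ContDiff.sum fun i _ => (ih _ _).smul contDiff_const

/-- Integration is a continuous functional. -/
def integralFunctional {K : Set E} (hK : IsCompact K) : testSpace K →ₗ[ℝ] ℝ where
  toFun f := ∫ x, f.1 x
  map_add' f g := by
    have h : ∀ f : testSpace K, Integrable f.1 := fun f =>
      f.2.1.continuous.integrable_of_hasCompactSupport (HasCompactSupport.intro hK f.2.2)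
    exact integral_add (h f) (h g)
  map_smul' c f := integral_const_mul c _

/-- Uniform convergence suffices on a set of finite volume. Differentiation under the integral
thereby becomes a case of `IsTestContinuous.hasFDerivAt_slice`. -/
theorem isTestContinuous_integralFunctional {K : Set E} (hK : IsCompact K) :
    IsTestContinuous (integralFunctional hK) := by
  intro ι L f hf
  rw [Metric.tendsto_nhds]
  intro ε hε
  have hpos : 0 < volume.real K + 1 := by positivity
  -- The `+ 1` keeps the denominator positive when `K` is a null set.
  filter_upwards [hf [] (ε / (volume.real K + 1) / 2) (by positivity)] with t ht
  rw [Real.dist_eq, sub_zero]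
  have h1 : integralFunctional hK (f t) = ∫ x in K, (f t).1 x :=
    (setIntegral_eq_integral_of_forall_compl_eq_zero (f t).2.2).symm
  rw [h1]
  refine (norm_setIntegral_le_of_norm_le_const (f := (f t).1) hK.measure_lt_top fun x _ => ht x).trans_lt ?_
  rw [div_div, div_mul_eq_mul_div, div_lt_iff₀ (by positivity)]
  have := measureReal_nonneg (μ := volume) (s := K)
  nlinarith

end TestFunctions

/-! ### Interchanging continuous functionals and integrals -/

section Interchange

variable {n d : ℕ}

local notation "E" => EuclideanSpace ℝ (Fin n)
local notation "X" => EuclideanSpace ℝ (Fin d)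

/-- The fibres of `σ` cut `K` into finitely many measurable pieces with tags close to their points:
these are the partitions for the Riemann sums. -/
theorem exists_simpleFunc_dist_lt {K : Set X} (hK : IsCompact K) {η : ℝ} (hη : 0 < η) :
    ∃ σ : SimpleFunc X X, ∀ x ∈ K, dist (σ x) x < η := by
  have hcover : K ⊆ ⋃ k, Metric.ball (TopologicalSpace.denseSeq X k) η := fun x _ => by
    obtain ⟨k, hk⟩ := (TopologicalSpace.denseRange_denseSeq X).exists_dist_lt x hη
    exact mem_iUnion.2 ⟨k, hk⟩
  obtain ⟨t, ht⟩ := hK.elim_finite_subcover _ (fun k => Metric.isOpen_ball) hcover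
  -- `t.sup id` is the largest index of the finite subcover, so the nearest point is chosen in a
  -- finite initial segment containing all its centres.
  refine ⟨SimpleFunc.nearestPt (TopologicalSpace.denseSeq X) (t.sup id), fun x hx => ?_⟩
  obtain ⟨k, hk, hxk⟩ := mem_iUnion₂.1 (ht hx)
  have h1 := SimpleFunc.edist_nearestPt_le (TopologicalSpace.denseSeq X) x
    (Finset.le_sup (f := id) hk)
  have h2 : edist (TopologicalSpace.denseSeq X k) x < ENNReal.ofReal η := by
    rw [edist_comm]
    simpa [edist_lt_ofReal] using hxk
  have := h1.trans_lt h2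
  rwa [edist_lt_ofReal] at this

/-- The error of a Riemann sum. -/
theorem abs_riemannSum_sub_le {K : Set X} (hK : IsCompact K) (σ : SimpleFunc X X) {η δ : ℝ}
    (hσ : ∀ x ∈ K, dist (σ x) x < η) {h : X → ℝ} (hh : Continuous h) (h0 : ∀ x ∉ K, h x = 0)
    (hδ : ∀ x x', dist x x' < η → dist (h x) (h x') < δ) :
    |∑ v ∈ σ.range, volume.real (K ∩ σ ⁻¹' {v}) * h v - ∫ x, h x| ≤ δ * volume.real K := by
  have hm : ∀ v, MeasurableSet (σ ⁻¹' {v}) := fun v => σ.measurableSet_fiber v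
  have e1 : ∀ x, h (σ x) = ∑ v ∈ σ.range, (σ ⁻¹' {v}).indicator (fun _ => h v) x := by
    intro x
    rw [Finset.sum_eq_single (σ x)]
    · simp
    · intro v _ hv
      rw [indicator_of_notMem]
      simpa using hv.symm
    · intro hx
      exact absurd (SimpleFunc.mem_range_self σ x) hx
  have hi : ∀ v ∈ σ.range, Integrable ((σ ⁻¹' {v}).indicator fun _ => h v) (volume.restrict K) :=
    fun v _ => (integrableOn_const hK.measure_ne_top).integrable.indicator (hm v)
  have e2 : ∫ x in K, h (σ x) = ∑ v ∈ σ.range, volume.real (K ∩ σ ⁻¹' {v}) * h v := by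
    simp only [e1]
    rw [integral_finsetSum _ hi]
    refine Finset.sum_congr rfl fun v _ => ?_
    rw [integral_indicator_const _ (hm v), measureReal_restrict_apply (hm v), inter_comm,
      smul_eq_mul]
  have hi2 : IntegrableOn (fun x => h (σ x)) K := by
    simp only [e1]
    exact integrable_finsetSum _ hi
  rw [← e2, ← setIntegral_eq_integral_of_forall_compl_eq_zero h0,
    ← integral_sub hi2 (hh.continuousOn.integrableOn_compact hK)]
  exact norm_setIntegral_le_of_norm_le_const (f := fun x => h (σ x) - h x) hK.measure_lt_top
    fun x hx => (hδ _ _ (hσ x hx)).le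

variable {F : EuclideanSpace ℝ (Fin d) × EuclideanSpace ℝ (Fin n) → ℝ}

/-- Slices fix the first variable; after a swap it is the first variable that can be integrated out.
-/
theorem dirDeriv_swap (v : X × E) (x : X) (y : E) :
    dirDeriv (v.2, v.1) (F ∘ Prod.swap) (y, x) = dirDeriv v F (x, y) := by
  have h : F ∘ Prod.swap = F ∘ (ContinuousLinearEquiv.prodComm ℝ E X) := rfl
  simp only [dirDeriv]
  rw [h, ContinuousLinearEquiv.comp_right_fderiv]
  rfl

/-- The integral over the first variable of a smooth function with compact support is smooth,
and it may be differentiated under the integral. -/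
theorem hasFDerivAt_integral_fst {K : Set X} (hK : IsCompact K) (hF : ContDiff ℝ ∞ F)
    (h0 : ∀ x ∉ K, ∀ y, F (x, y) = 0) (y : E) :
    HasFDerivAt (fun y => ∫ x, F (x, y))
      (∑ i, (∫ x, dirDeriv (0, stdBasis n i) F (x, y)) •
        ((stdBasis n).coord i).toContinuousLinearMap) y := by
  -- After the swap `y` is the parameter, and integration over `x` is the continuous functional.
  have h := (isTestContinuous_integralFunctional hK).hasFDerivAt_slice hK
    (F := F ∘ Prod.swap) (hF.comp (contDiff_snd.prodMk contDiff_fst)) (fun y x hx => h0 x hx y) y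
  simp only [integralFunctional, slice, LinearMap.coe_mk, AddHom.coe_mk] at h
  refine h.congr_fderiv (Finset.sum_congr rfl fun i _ => ?_)
  congr 2
  ext x
  exact dirDeriv_swap (0, stdBasis n i) x y

theorem contDiff_integral_fst {K : Set X} (hK : IsCompact K) (hF : ContDiff ℝ ∞ F)
    (h0 : ∀ x ∉ K, ∀ y, F (x, y) = 0) : ContDiff ℝ ∞ fun y => ∫ x, F (x, y) :=
  (isTestContinuous_integralFunctional hK).contDiff_slice hK
    (F := F ∘ Prod.swap) (hF.comp (contDiff_snd.prodMk contDiff_fst)) (fun y x hx => h0 x hx y)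

theorem dirDeriv_integral_fst {K : Set X} (hK : IsCompact K) (hF : ContDiff ℝ ∞ F)
    (h0 : ∀ x ∉ K, ∀ y, F (x, y) = 0) (i : Fin n) :
    dirDeriv (stdBasis n i) (fun y => ∫ x, F (x, y)) =
      fun y => ∫ x, dirDeriv (0, stdBasis n i) F (x, y) := by
  ext y
  rw [dirDeriv, (hasFDerivAt_integral_fst hK hF h0 y).fderiv]
  rw [_root_.sum_apply, Finset.sum_eq_single i]
  · simp
  · intro j _ hj
    simp [Pi.single_apply, hj]
  · simp

theorem dirDeriv_snd_eq_zero {K : Set X} (hK : IsClosed K)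
    (h0 : ∀ x ∉ K, ∀ y, F (x, y) = 0) (v : X × E) (x : X) (hx : x ∉ K) (y : E) :
    dirDeriv v F (x, y) = 0 :=
  dirDerivs_eq_zero_of_isClosed (K := K ×ˢ univ) (hK.prod isClosed_univ)
    (fun z hz => h0 z.1 (by simpa using hz) z.2) [v] (by simpa using hx)

theorem dirDerivs_snd_eq_zero {K : Set X} (hK : IsClosed K)
    (h0 : ∀ x ∉ K, ∀ y, F (x, y) = 0) (l : List (X × E)) (x : X) (hx : x ∉ K) (y : E) :
    dirDerivs l F (x, y) = 0 :=
  dirDerivs_eq_zero_of_isClosed (K := K ×ˢ univ) (hK.prod isClosed_univ)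
    (fun z hz => h0 z.1 (by simpa using hz) z.2) l (by simpa using hx)

theorem dirDerivs_integral_fst {K : Set X} (hK : IsCompact K) (hF : ContDiff ℝ ∞ F)
    (h0 : ∀ x ∉ K, ∀ y, F (x, y) = 0) (l : List (Fin n)) :
    dirDerivs (l.map (stdBasis n)) (fun y => ∫ x, F (x, y)) =
      fun y => ∫ x, dirDerivs ((l.map (stdBasis n)).map fun v => ((0 : X), v)) F (x, y) := by
  induction l generalizing F with
  | nil => rfl
  | cons i l ih =>
    simp only [List.map_cons, dirDerivs_cons]
    rw [dirDeriv_integral_fst hK hF h0]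
    exact ih (contDiff_dirDeriv hF _) fun x hx y => dirDeriv_snd_eq_zero hK.isClosed h0 _ x hx y

/-- A continuous functional commutes with integrals of smooth families of test functions. -/
theorem IsTestContinuous.integral_slice {K : Set E} {S : testSpace K →ₗ[ℝ] ℝ}
    (hS : IsTestContinuous S) (hK : IsCompact K) {K' : Set X} (hK' : IsCompact K')
    (hF : ContDiff ℝ ∞ F) (h0 : ∀ x, ∀ y ∉ K, F (x, y) = 0)
    (h0' : ∀ x ∉ K', ∀ y, F (x, y) = 0) :
    S ⟨fun y => ∫ x, F (x, y), contDiff_integral_fst hK' hF h0', fun y hy => by simp [h0 _ y hy]⟩ =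
      ∫ x, S (slice F hF h0 x) := by
  set G : testSpace K := ⟨fun y => ∫ x, F (x, y), contDiff_integral_fst hK' hF h0',
    fun y hy => by simp [h0 _ y hy]⟩ with hG
  have hη : ∀ N : ℕ, (0 : ℝ) < 1 / (N + 1) := fun N => by positivity
  choose σ hσ using fun N => exists_simpleFunc_dist_lt hK' (hη N)
  set w : ℕ → X → ℝ := fun N v => volume.real (K' ∩ σ N ⁻¹' {v})
  have key : ∀ (δ : ℝ), 0 < δ → ∃ δ' > 0, δ' * volume.real K' ≤ δ := fun δ hδ =>
    ⟨δ / (volume.real K' + 1), by positivity, by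
      have := measureReal_nonneg (μ := volume) (s := K')
      rw [div_mul_eq_mul_div, div_le_iff₀ (by positivity)]
      nlinarith⟩
  have hN : ∀ η : ℝ, 0 < η → ∀ᶠ N : ℕ in atTop, 1 / ((N : ℝ) + 1) < η := fun η hη' =>
    (tendsto_one_div_add_atTop_nhds_zero_nat (𝕜 := ℝ)).eventually_lt_const hη'
  -- Riemann sums of the test functions
  have hnull : NullFamily atTop (fun N => (∑ v ∈ (σ N).range, w N v • slice F hF h0 v - G).1) := by
    intro l δ hδ
    obtain ⟨δ', hδ', hle⟩ := key δ hδ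
    set l' : List (X × E) := (l.map (stdBasis n)).map fun v => ((0 : X), v)
    have hH := contDiff_dirDerivs hF l'
    -- Every `y`-derivative of `F` is supported in `K' ×ˢ K`, hence uniformly continuous, so one
    -- mesh size serves all `y`.
    have hHs : HasCompactSupport (dirDerivs l' F) := by
      refine HasCompactSupport.intro (hK'.prod hK) fun z hz => ?_
      rw [mem_prod, not_and_or] at hz
      rcases hz with hz | hz
      · exact dirDerivs_snd_eq_zero hK'.isClosed h0' l' z.1 hz z.2
      · exact dirDerivs_fst_eq_zero hK.isClosed h0 l' z.1 z.2 hz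
    obtain ⟨η, hη', hu⟩ := Metric.uniformContinuous_iff.1
      (hHs.uniformContinuous_of_continuous hH.continuous) δ' hδ'
    filter_upwards [hN η hη'] with N hN y
    have e1 : (∑ v ∈ (σ N).range, w N v • slice F hF h0 v - G).1 =
        fun y => (∑ v ∈ (σ N).range, w N v * F (v, y)) - ∫ x, F (x, y) := by
      ext y
      simp [slice, hG]
    have c1 : ∀ v : X, ContDiff ℝ ∞ fun y => w N v * F (v, y) := fun v =>
      contDiff_const.mul (hF.comp (contDiff_const.prodMk contDiff_id))
    rw [e1, dirDerivs_sub (ContDiff.sum fun v _ => c1 v) G.2.1, dirDerivs_sum _ c1,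
      dirDerivs_integral_fst hK' hF h0']
    simp only [dirDerivs_const_mul, dirDerivs_slice hF]
    refine (abs_riemannSum_sub_le (h := fun x => dirDerivs l' F (x, y)) hK' (σ N)
      (fun x hx => (hσ N x hx).trans hN)
      (hH.continuous.comp (continuous_id.prodMk continuous_const))
      (fun x hx => dirDerivs_snd_eq_zero hK'.isClosed h0' l' x hx y) fun x x' hxx => ?_).trans hle
    exact hu (by simpa [Prod.dist_eq] using hxx)
  have lim1 := hS ℕ atTop _ hnull
  -- Riemann sums of the values
  have hc : Continuous fun x => S (slice F hF h0 x) := (hS.contDiff_slice hK hF h0).continuous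
  have hz : ∀ x ∉ K', S (slice F hF h0 x) = 0 := fun x hx => by
    have : slice F hF h0 x = 0 := by
      ext y
      exact h0' x hx y
    rw [this, map_zero]
  have lim2 : Tendsto (fun N => ∑ v ∈ (σ N).range, w N v * S (slice F hF h0 v) -
      ∫ x, S (slice F hF h0 x)) atTop (𝓝 0) := by
    rw [Metric.tendsto_nhds]
    intro ε hε
    obtain ⟨δ', hδ', hle⟩ := key (ε / 2) (half_pos hε)
    obtain ⟨η, hη', hu⟩ := Metric.uniformContinuous_iff.1
      ((HasCompactSupport.intro hK' hz).uniformContinuous_of_continuous hc) δ' hδ'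
    filter_upwards [hN η hη'] with N hN
    rw [Real.dist_eq, sub_zero]
    refine ((abs_riemannSum_sub_le hK' (σ N) (fun x hx => (hσ N x hx).trans hN) hc hz
      fun x x' hxx => hu hxx).trans hle).trans_lt (half_lt_self hε)
  -- The weighted sum of the values of `S` occurs in both limits. It cancels in the difference,
  -- leaving a constant sequence that tends to zero.
  have lim3 := lim1.sub lim2
  simp only [map_sub, map_sum, map_smul, smul_eq_mul, sub_zero] at lim3
  have : Tendsto (fun _ : ℕ => (∫ x, S (slice F hF h0 x)) - S G) atTop (𝓝 0) :=
    lim3.congr fun N => by ring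
  exact (sub_eq_zero.1 (tendsto_const_nhds_iff.1 this)).symm

end Interchange

/-! ### Families of kernels concentrating at the diagonal -/

section Kernels

variable {n : ℕ}

local notation "E" => EuclideanSpace ℝ (Fin n)

theorem dirDeriv_add_vec {V : Type*} [NormedAddCommGroup V] [NormedSpace ℝ V] (v w : V)
    (f : V → ℝ) : dirDeriv (v + w) f = fun z => dirDeriv v f z + dirDeriv w f z := by
  ext z
  simp [dirDeriv]

/-- Integration by parts against the constant function one. -/
theorem integral_dirDeriv_eq_zero {f : E → ℝ} (hf : ContDiff ℝ ∞ f) {K : Set E}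
    (hK : IsCompact K) (h0 : ∀ x ∉ K, f x = 0) (v : E) : ∫ x, dirDeriv v f x = 0 := by
  have hi : Integrable f :=
    hf.continuous.integrable_of_hasCompactSupport (HasCompactSupport.intro hK h0)
  have hi' : Integrable (dirDeriv v f) :=
    (contDiff_dirDeriv hf v).continuous.integrable_of_hasCompactSupport
      (HasCompactSupport.intro hK fun x hx =>
        dirDerivs_eq_zero_of_isClosed hK.isClosed h0 [v] hx)
  have := integral_mul_fderiv_eq_neg_fderiv_mul_of_integrable (μ := volume)
    (f := fun _ : E => (1 : ℝ)) (g := f) (v := v) (by simp)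
    (by simpa [dirDeriv] using! hi') (by simpa using hi)
    (fun x _ => differentiableAt_const _) (fun x _ => hf.differentiable (by simp) x)
  simpa [dirDeriv] using! this

/-- The direction `(∂_i, ∂_i)`. -/
def diag (i : Fin n) : E × E := (stdBasis n i, stdBasis n i)

theorem diag_eq (i : Fin n) : diag i = (stdBasis n i, (0 : E)) + ((0 : E), stdBasis n i) := by
  simp [diag]

/-- Differentiation of `y ↦ ∫ F(x, y) dx` in terms of the derivatives along the diagonal. -/
theorem dirDeriv_integral_diag {F : E × E → ℝ} {K : Set E} (hK : IsCompact K)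
    (hF : ContDiff ℝ ∞ F) (h0 : ∀ x ∉ K, ∀ y, F (x, y) = 0) (i : Fin n) :
    dirDeriv (stdBasis n i) (fun y => ∫ x, F (x, y)) =
      fun y => ∫ x, dirDeriv (diag i) F (x, y) := by
  rw [dirDeriv_integral_fst hK hF h0]
  ext y
  simp only [diag_eq, dirDeriv_add_vec]
  have hi : ∀ v : E × E, Integrable fun x => dirDeriv v F (x, y) := fun v =>
    ((contDiff_dirDeriv hF v).continuous.comp
      (continuous_id.prodMk continuous_const)).integrable_of_hasCompactSupport
      (HasCompactSupport.intro hK fun x hx => dirDeriv_snd_eq_zero hK.isClosed h0 v x hx y)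
  rw [integral_add (hi _) (hi _)]
  have hs : ContDiff ℝ ∞ (F ∘ Prod.swap) := hF.comp (contDiff_snd.prodMk contDiff_fst)
  have h1 : (fun x => dirDeriv (stdBasis n i, (0 : E)) F (x, y)) =
      dirDeriv (stdBasis n i) fun x => F (x, y) := by
    have := dirDeriv_slice hs y (stdBasis n i)
    ext x
    rw [← dirDeriv_swap]
    exact (congrFun this x).symm
  -- Passing from `∂_{y_i}` to the diagonal derivative adds `∂_{x_i} F`, whose integral over `x`
  -- vanishes.
  have hz := integral_dirDeriv_eq_zero (f := fun x => F (x, y)) (hF.comp (contDiff_id.prodMk contDiff_const)) hK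
    (fun x hx => h0 x hx y) (stdBasis n i)
  rw [h1, hz, zero_add]

/-- The version for integration over `y`, the variable in which the mass of a kernel is computed. -/
theorem dirDeriv_integral_diag' {F : E × E → ℝ} {K : Set E} (hK : IsCompact K)
    (hF : ContDiff ℝ ∞ F) (h0 : ∀ x, ∀ y ∉ K, F (x, y) = 0) (i : Fin n) :
    dirDeriv (stdBasis n i) (fun x => ∫ y, F (x, y)) =
      fun x => ∫ y, dirDeriv (diag i) F (x, y) := by
  have hs : ContDiff ℝ ∞ (F ∘ Prod.swap) := hF.comp (contDiff_snd.prodMk contDiff_fst)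
  have := dirDeriv_integral_diag hK hs (fun y hy x => h0 x y hy) i
  refine this.trans ?_
  ext x
  refine integral_congr_ae (Eventually.of_forall fun y => ?_)
  exact dirDeriv_swap (diag i) x y

/-- Families of kernels `φ_ε(x, y)`, `x ∈ Ω`, of mass `c` in `y`, which concentrate at the
diagonal at scale `ε` and whose derivatives along the diagonal are of order `ε⁻ⁿ`. -/
structure IsKernelFamily (Ω : Set (EuclideanSpace ℝ (Fin n)))
    (φ : ℝ → EuclideanSpace ℝ (Fin n) × EuclideanSpace ℝ (Fin n) → ℝ) (c : ℝ) : Prop where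
  smooth : ∀ᶠ ε in 𝓝[>] (0 : ℝ), ContDiffOn ℝ ∞ (φ ε) (Ω ×ˢ univ)
  bound : ∀ l : List (Fin n), ∃ C : ℝ, ∀ᶠ ε in 𝓝[>] (0 : ℝ), ∀ x ∈ Ω, ∀ y,
    |dirDerivs (l.map diag) (φ ε) (x, y)| ≤ C * (ε ^ n)⁻¹
  supp : ∃ C > (0 : ℝ), ∀ᶠ ε in 𝓝[>] (0 : ℝ), ∀ x ∈ Ω, ∀ y, C * ε < dist x y → φ ε (x, y) = 0
  mass : ∀ᶠ ε in 𝓝[>] (0 : ℝ), ∀ x ∈ Ω, ∫ y, φ ε (x, y) = c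

/-- The mass is constant in `x`, and its derivative is the integral of the diagonal derivative
(`dirDeriv_integral_diag'`), hence the new mass `0`. The bounds are inherited, since one more
diagonal direction only lengthens the list. This stability drives the induction in
`IsKernelFamily.tendsto_dirDerivs_integral`. -/
theorem IsKernelFamily.dirDeriv_diag {Ω : Set E} {φ : ℝ → E × E → ℝ} {c : ℝ} (hΩ : IsOpen Ω)
    (h : IsKernelFamily Ω φ c) (i : Fin n) :
    IsKernelFamily Ω (fun ε => dirDeriv (diag i) (φ ε)) 0 := by
  obtain ⟨C, hC, hsupp⟩ := h.supp
  have hΩu : IsOpen (Ω ×ˢ (univ : Set E)) := hΩ.prod isOpen_univ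
  refine ⟨?_, fun l => h.bound (i :: l), ⟨C, hC, ?_⟩, ?_⟩
  · filter_upwards [h.smooth] with ε hε using ContDiffOn.dirDeriv hΩu hε _
  · filter_upwards [hsupp] with ε hε x hx y hxy
    refine dirDerivs_eq_zero [diag i] ?_
    have ho : IsOpen {z : E × E | C * ε < dist z.1 z.2} :=
      isOpen_lt continuous_const (by fun_prop)
    filter_upwards [hΩu.mem_nhds (show (x, y) ∈ Ω ×ˢ univ from ⟨hx, mem_univ _⟩),
      ho.mem_nhds hxy] with z hz1 hz2 using hε z.1 hz1.1 z.2 hz2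
  · filter_upwards [h.smooth, hsupp, h.mass, self_mem_nhdsWithin] with ε hsm hsu hma hε x₀ hx₀
    have hε : 0 < ε := hε
    obtain ⟨r, hr, hrΩ⟩ := Metric.isOpen_iff.1 hΩ x₀ hx₀
    -- `φ ε` is smooth over `Ω` only. The bump `κ`, equal to one near `x₀`, yields a globally smooth
    -- function with compact support that agrees with `φ ε` near the slice over `x₀`.
    let κ : ContDiffBump x₀ := ⟨r / 4, r / 2, by positivity, by linarith⟩
    set F : E × E → ℝ := (Ω ×ˢ (univ : Set E)).indicator fun z => κ z.1 * φ ε z with hFdef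
    have hκ0 : ∀ x ∉ Metric.closedBall x₀ (r / 2), κ x = 0 := fun x hx =>
      κ.zero_of_le_dist (by simpa using (not_le.1 (by simpa using hx)).le)
    have hF : ContDiff ℝ ∞ F := by
      refine contDiff_indicator hΩu (K := Metric.closedBall x₀ (r / 2) ×ˢ univ)
        (Metric.isClosed_closedBall.prod isClosed_univ) (Set.prod_mono
          ((Metric.closedBall_subset_ball (by linarith)).trans hrΩ) le_rfl)
        ((κ.contDiff.comp contDiff_fst).contDiffOn.mul hsm) fun z _ hz => ?_
      rw [hκ0 z.1 (fun h => hz ⟨h, mem_univ _⟩), zero_mul]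
    -- `κ` keeps `x` within `r / 2` of `x₀`, and the kernel keeps `y` within `C * ε` of `x`.
    have hF0 : ∀ x, ∀ y ∉ Metric.closedBall x₀ (r / 2 + C * ε), F (x, y) = 0 := by
      intro x y hy
      rw [hFdef]
      by_cases hx : x ∈ Metric.closedBall x₀ (r / 2)
      · by_cases hxΩ : x ∈ Ω
        · rw [indicator_of_mem (show (x, y) ∈ Ω ×ˢ univ from ⟨hxΩ, mem_univ _⟩),
            hsu x hxΩ y, mul_zero]
          rw [Metric.mem_closedBall] at hx hy
          have := dist_triangle y x x₀
          rw [dist_comm y x] at this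
          linarith
        · rw [indicator_of_notMem]
          exact fun h => hxΩ h.1
      · by_cases hxΩ : x ∈ Ω
        · rw [indicator_of_mem (show (x, y) ∈ Ω ×ˢ univ from ⟨hxΩ, mem_univ _⟩)]
          simp [hκ0 x hx]
        · rw [indicator_of_notMem]
          exact fun h => hxΩ h.1
    have hnear : ∀ x, κ =ᶠ[𝓝 x] 1 → x ∈ Ω → ∀ y, F =ᶠ[𝓝 (x, y)] φ ε := by
      intro x hx hxΩ y
      have : Tendsto Prod.fst (𝓝 (x, y)) (𝓝 x) := continuous_fst.tendsto (x, y)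
      filter_upwards [this.eventually hx,
        hΩu.mem_nhds (show (x, y) ∈ Ω ×ˢ univ from ⟨hxΩ, mem_univ _⟩)] with z hz hzΩ
      rw [hFdef, indicator_of_mem hzΩ]
      simp [hz]
    have h1 := congrFun (dirDeriv_integral_diag' (isCompact_closedBall _ _) hF hF0 i) x₀
    have h2 : (fun x => ∫ y, F (x, y)) =ᶠ[𝓝 x₀] fun _ => c := by
      filter_upwards [κ.eventuallyEq_one.eventuallyEq_nhds, hΩ.mem_nhds hx₀] with x hx hxΩ
      rw [← hma x hxΩ]
      exact integral_congr_ae (Eventually.of_forall fun y => (hnear x hx hxΩ y).eq_of_nhds)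
    have h3 : dirDeriv (stdBasis n i) (fun x => ∫ y, F (x, y)) x₀ = 0 := by
      rw [(dirDeriv_congr h2 _).eq_of_nhds]
      simp [dirDeriv]
    rw [h3] at h1
    rw [h1]
    exact integral_congr_ae (Eventually.of_forall fun y =>
      (dirDeriv_congr (hnear x₀ κ.eventuallyEq_one hx₀ y) _).eq_of_nhds.symm)

/-- The total variation of a kernel along the diagonal. -/
theorem IsKernelFamily.exists_lipschitz {Ω : Set E} {φ : ℝ → E × E → ℝ} {c : ℝ} (hΩ : IsOpen Ω)
    (h : IsKernelFamily Ω φ c) : ∃ C : ℝ, ∀ᶠ ε in 𝓝[>] (0 : ℝ), ∀ x y w : E,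
      (∀ t ∈ Icc (0 : ℝ) 1, x + t • w ∈ Ω) →
        |φ ε (x + w, y + w) - φ ε (x, y)| ≤ C * ‖w‖ * (ε ^ n)⁻¹ := by
  choose C hC using fun i : Fin n => h.bound [i]
  -- Mean value theorem along `t ↦ (x + t • w, y + t • w)`: the velocity `(w, w)` combines the `diag
  -- i` with the coordinates of `w`, each at most `‖w‖`, so the first order diagonal bounds add up.
  refine ⟨∑ i, C i, ?_⟩
  filter_upwards [h.smooth, eventually_all.2 hC] with ε hsm hb x y w hxw
  have hd : ∀ t ∈ Icc (0 : ℝ) 1, HasDerivAt (fun t : ℝ => φ ε (x + t • w, y + t • w))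
      (fderiv ℝ (φ ε) (x + t • w, y + t • w) (w, w)) t := by
    intro t ht
    have h1 : DifferentiableAt ℝ (φ ε) (x + t • w, y + t • w) :=
      (hsm.contDiffAt ((hΩ.prod isOpen_univ).mem_nhds ⟨hxw t ht, mem_univ _⟩)).differentiableAt
        (by simp)
    have h2 : ∀ x : E, HasDerivAt (fun t : ℝ => x + t • w) w t := fun x => by
      simpa using! ((hasDerivAt_id t).smul_const w).const_add x
    exact h1.hasFDerivAt.comp_hasDerivAt t ((h2 x).prodMk (h2 y))
  have := norm_image_sub_le_of_norm_deriv_le_segment_01' (f := fun t : ℝ =>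
    φ ε (x + t • w, y + t • w)) (C := (∑ i, C i) * ‖w‖ * (ε ^ n)⁻¹)
    (fun t ht => (hd t ht).hasDerivWithinAt) fun t ht => ?_
  · simpa using this
  · have e1 : ((w, w) : E × E) = ∑ i, (stdBasis n).repr w i • diag i := by
      ext1
      · simp only [Prod.fst_sum, Prod.smul_fst, diag]
        exact ((stdBasis n).sum_repr w).symm
      · simp only [Prod.snd_sum, Prod.smul_snd, diag]
        exact ((stdBasis n).sum_repr w).symm
    rw [e1, map_sum, Finset.sum_mul, Finset.sum_mul]
    refine (norm_sum_le _ _).trans (Finset.sum_le_sum fun i _ => ?_)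
    rw [map_smul, smul_eq_mul, norm_mul, mul_comm,
      show C i * ‖w‖ * (ε ^ n)⁻¹ = C i * (ε ^ n)⁻¹ * ‖w‖ by ring]
    have hcoord : ‖(stdBasis n).repr w i‖ ≤ ‖w‖ := by
      simpa using PiLp.norm_apply_le w i
    have hbi := hb i (x + t • w) (hxw t ⟨ht.1, ht.2.le⟩) (y + t • w)
    simp only [List.map_cons, List.map_nil, dirDerivs_cons, dirDerivs_nil, dirDeriv] at hbi
    exact mul_le_mul hbi hcoord (norm_nonneg _) ((abs_nonneg _).trans hbi)

/-- The integral runs over `x`, but the mass is prescribed in `y`. Substituting `x = y - w` gives `∫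
a (y - w, y) φ (y - w, y) dw`, to be compared with `c a (y, y) = ∫ a (y, y) φ (y, y + w) dw`. The
two arguments of `φ` lie on one diagonal line, so `exists_lipschitz` bounds the difference of the
kernels by a multiple of `‖w‖ ε⁻ⁿ`, and `a` is Lipschitz. On `‖w‖ ≤ C ε` both errors are of order `ε
· ε⁻ⁿ`, and the ball has volume of order `εⁿ`. -/
theorem IsKernelFamily.tendsto_integral {Ω : Set E} {φ : ℝ → E × E → ℝ} {c : ℝ} (hΩ : IsOpen Ω)
    (h : IsKernelFamily Ω φ c) {a : E × E → ℝ} (ha : ContDiff ℝ ∞ a) {K K' : Set E}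
    (hK : IsCompact K) (hK' : IsCompact K') (hKΩ : K ⊆ Ω)
    (h0 : ∀ x ∉ K, ∀ y, a (x, y) = 0) (h0' : ∀ x, ∀ y ∉ K', a (x, y) = 0) {δ : ℝ} (hδ : 0 < δ) :
    ∀ᶠ ε in 𝓝[>] (0 : ℝ), ∀ y, |(∫ x, a (x, y) * φ ε (x, y)) - c * a (y, y)| ≤ δ := by
  have has : HasCompactSupport a := HasCompactSupport.intro (hK.prod hK') fun z hz => by
    rw [mem_prod, not_and_or] at hz
    exact hz.elim (fun hz => h0 z.1 hz z.2) fun hz => h0' z.1 z.2 hz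
  obtain ⟨L, hL⟩ := ha.lipschitzWith_of_hasCompactSupport has (by simp)
  obtain ⟨A, hA⟩ := has.exists_bound_of_continuous ha.continuous
  obtain ⟨C, hC, hsupp⟩ := h.supp
  obtain ⟨B, hB⟩ := h.bound []
  obtain ⟨D, hD⟩ := h.exists_lipschitz hΩ
  obtain ⟨r, hr, hrΩ⟩ := hK.exists_cthickening_subset_open hΩ hKΩ
  set V := volume.real (Metric.ball (0 : E) 1)
  -- The pointwise error on the ball, with `R = C * ε` and the factor `ε⁻ⁿ`, times the volume `(C
  -- ε)ⁿ V`: a single power of `ε` is left.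
  have hlim : Tendsto (fun ε : ℝ => (L * |B| + 2 * |A| * |D|) * C * (C ^ n * V) * ε)
      (𝓝[>] 0) (𝓝 0) := by
    have : Tendsto (fun ε : ℝ => (L * |B| + 2 * |A| * |D|) * C * (C ^ n * V) * ε) (𝓝 0)
        (𝓝 ((L * |B| + 2 * |A| * |D|) * C * (C ^ n * V) * 0)) := tendsto_id.const_mul _
    rw [mul_zero] at this
    exact this.mono_left nhdsWithin_le_nhds
  -- One `C * ε` for the distance of `y` from `K`, one for the distance of `x` from `y`; all base
  -- points then stay in `Ω`.
  have hsmall : ∀ᶠ ε : ℝ in 𝓝[>] 0, C * ε + C * ε < r := by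
    have : Tendsto (fun ε : ℝ => C * ε + C * ε) (𝓝 0) (𝓝 (C * 0 + C * 0)) :=
      (tendsto_id.const_mul _).add (tendsto_id.const_mul _)
    rw [mul_zero, add_zero] at this
    exact (this.mono_left nhdsWithin_le_nhds).eventually_lt_const hr
  filter_upwards [h.smooth, hsupp, hB, hD, h.mass, hsmall, hlim.eventually_lt_const hδ,
    self_mem_nhdsWithin] with ε hsm hsu hB hD hma hεr hεδ hε y
  have hε : 0 < ε := hε
  set R := C * ε
  have hR : 0 < R := mul_pos hC hε
  have hprod : ∀ x y, a (x, y) * φ ε (x, y) ≠ 0 → x ∈ K ∧ dist x y ≤ R := by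
    intro x y hne
    have hx : x ∈ K := by
      by_contra hx
      exact hne (by rw [h0 x hx, zero_mul])
    refine ⟨hx, ?_⟩
    by_contra hd
    exact hne (by rw [hsu x (hKΩ hx) y (not_le.1 hd), mul_zero])
  -- Farther than `R` from `K` both terms vanish, since a nonzero integrand needs some `x ∈ K`
  -- within `R` of `y`.
  by_cases hy : y ∈ Metric.cthickening R K
  swap
  · have hz : ∀ x, a (x, y) * φ ε (x, y) = 0 := by
      intro x
      by_contra hne
      obtain ⟨hx, hd⟩ := hprod x y hne
      exact hy (Metric.mem_cthickening_of_dist_le y x R K hx (by rwa [dist_comm]))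
    have hyK : y ∉ K := fun hyK => hy (Metric.self_subset_cthickening K hyK)
    simp [hz, h0 y hyK, hδ.le]
  have hball : ∀ x, dist x y ≤ R → x ∈ Ω := fun x hx => by
    refine hrΩ (Metric.cthickening_mono hεr.le K
      (Metric.cthickening_cthickening_subset hR.le hR.le K
        (Metric.mem_cthickening_of_dist_le x y R _ hy hx)))
  have hyΩ : y ∈ Ω := hball y (by simp [hR.le])
  set ball := Metric.closedBall (0 : E) R
  have hcb : IsCompact ball := isCompact_closedBall _ _
  have hφc : ∀ f : E → E × E, Continuous f → (∀ w ∈ ball, (f w).1 ∈ Ω) →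
      ContinuousOn (fun w => φ ε (f w)) ball := fun f hf hfb =>
    hsm.continuousOn.comp hf.continuousOn fun w hw => ⟨hfb w hw, mem_univ _⟩
  have hsub : ∀ w ∈ ball, y - w ∈ Ω := fun w hw =>
    hball _ (by simpa [ball, dist_eq_norm] using hw)
  have e1 : ∫ x, a (x, y) * φ ε (x, y) = ∫ w in ball, a (y - w, y) * φ ε (y - w, y) := by
    rw [← integral_sub_left_eq_self _ volume y]
    refine (setIntegral_eq_integral_of_forall_compl_eq_zero fun w hw => ?_).symm
    by_contra hne
    exact hw (by simpa [ball, dist_eq_norm] using (hprod _ _ hne).2)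
  have e2 : c * a (y, y) = ∫ w in ball, a (y, y) * φ ε (y, y + w) := by
    rw [integral_const_mul, ← hma y hyΩ, ← integral_add_left_eq_self _ y, mul_comm]
    congr 1
    refine (setIntegral_eq_integral_of_forall_compl_eq_zero fun w hw => ?_).symm
    refine hsu y hyΩ _ ?_
    simpa [ball, dist_eq_norm] using hw
  rw [e1, e2, ← integral_sub]
  rotate_left
  · exact (((ha.continuous.comp (by fun_prop : Continuous fun w => (y - w, y))).continuousOn).mul
      (hφc (fun w => (y - w, y)) (by fun_prop) hsub)).integrableOn_compact (μ := volume) hcb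
  · exact (continuousOn_const.mul
      (hφc (fun w => (y, y + w)) (by fun_prop) fun _ _ => hyΩ)).integrableOn_compact (μ := volume) hcb
  have hpos : 0 < (ε ^ n)⁻¹ := by positivity
  refine (norm_setIntegral_le_of_norm_le_const
    (f := fun w => a (y - w, y) * φ ε (y - w, y) - a (y, y) * φ ε (y, y + w))
    (C := (L * |B| + 2 * |A| * |D|) * R * (ε ^ n)⁻¹) hcb.measure_lt_top fun w hw => ?_).trans ?_
  · have hw' : ‖w‖ ≤ R := by simpa [ball] using hw
    have t1 : |a (y - w, y) - a (y, y)| ≤ L * R := by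
      have := hL.dist_le_mul (y - w, y) (y, y)
      rw [Real.dist_eq] at this
      refine this.trans (mul_le_mul_of_nonneg_left ?_ L.2)
      rw [Prod.dist_eq]
      exact max_le (by simpa [dist_eq_norm] using hw') (by simp [hR.le])
    have t2 : |φ ε (y - w, y)| ≤ |B| * (ε ^ n)⁻¹ :=
      (hB _ (hsub w hw) y).trans (mul_le_mul_of_nonneg_right (le_abs_self B) hpos.le)
    have t3 : |φ ε (y - w, y) - φ ε (y, y + w)| ≤ |D| * R * (ε ^ n)⁻¹ := by
      -- The segment from `y - w` to `y` stays within `R` of `y`, hence in `Ω`.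
      have := hD (y - w) y w fun t ht => hball _ ?_
      · rw [abs_sub_comm]
        rw [sub_add_cancel] at this
        refine this.trans (mul_le_mul_of_nonneg_right ?_ hpos.le)
        exact mul_le_mul (le_abs_self D) hw' (norm_nonneg _) (abs_nonneg _)
      · rw [dist_eq_norm, show y - w + t • w - y = (t - 1) • w by module, norm_smul]
        have : ‖t - 1‖ ≤ 1 := by
          rw [Real.norm_eq_abs, abs_le]
          constructor <;> linarith [ht.1, ht.2]
        nlinarith [norm_nonneg w]
    have t4 : |a (y, y)| ≤ |A| := (hA (y, y)).trans (le_abs_self A)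
    calc ‖a (y - w, y) * φ ε (y - w, y) - a (y, y) * φ ε (y, y + w)‖
        = |(a (y - w, y) - a (y, y)) * φ ε (y - w, y) +
            a (y, y) * (φ ε (y - w, y) - φ ε (y, y + w))| := by
          rw [Real.norm_eq_abs]; congr 1; ring
      _ ≤ |a (y - w, y) - a (y, y)| * |φ ε (y - w, y)| +
            |a (y, y)| * |φ ε (y - w, y) - φ ε (y, y + w)| := by
          rw [← abs_mul, ← abs_mul]; exact abs_add_le _ _
      _ ≤ (L * R) * (|B| * (ε ^ n)⁻¹) + |A| * (|D| * R * (ε ^ n)⁻¹) := by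
          gcongr
      _ ≤ _ := by
          have : 0 ≤ |A| * |D| * R * (ε ^ n)⁻¹ := by positivity
          nlinarith
  · rw [show volume.real ball = R ^ n * V by
      simpa using Measure.addHaar_real_closedBall volume (0 : E) hR.le]
    refine le_trans (le_of_eq ?_) hεδ.le
    simp only [R, mul_pow]
    field_simp

/-- The product of a function smooth over `Ω` with a smooth function supported over a compact
subset of `Ω`. -/
theorem contDiff_mul_of_support {Ω K : Set E} (hΩ : IsOpen Ω) (hK : IsCompact K) (hKΩ : K ⊆ Ω)
    {b ψ : E × E → ℝ} (hb : ContDiff ℝ ∞ b) (hb0 : ∀ x ∉ K, ∀ y, b (x, y) = 0)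
    (hψ : ContDiffOn ℝ ∞ ψ (Ω ×ˢ univ)) : ContDiff ℝ ∞ fun z => b z * ψ z := by
  have := contDiff_indicator (hΩ.prod isOpen_univ) (hK.isClosed.prod isClosed_univ)
    (Set.prod_mono hKΩ le_rfl) (hb.contDiffOn.mul hψ) fun z _ hz => by
      rw [hb0 z.1 (fun h => hz ⟨h, mem_univ _⟩) z.2, zero_mul]
  convert this using 1
  ext z
  by_cases hz : z ∈ Ω ×ˢ (univ : Set E)
  · rw [indicator_of_mem hz]
  · rw [indicator_of_notMem hz, hb0 z.1 (fun h => hz ⟨hKΩ h, mem_univ _⟩) z.2, zero_mul]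

/-- Integration against a kernel family approximates the restriction to the diagonal, together
with all derivatives. -/
theorem IsKernelFamily.tendsto_dirDerivs_integral {Ω : Set E} {φ : ℝ → E × E → ℝ} {c : ℝ}
    (hΩ : IsOpen Ω) (h : IsKernelFamily Ω φ c) {a : E × E → ℝ} (ha : ContDiff ℝ ∞ a)
    {K K' : Set E} (hK : IsCompact K) (hK' : IsCompact K') (hKΩ : K ⊆ Ω)
    (h0 : ∀ x ∉ K, ∀ y, a (x, y) = 0) (h0' : ∀ x, ∀ y ∉ K', a (x, y) = 0) (l : List (Fin n))
    {δ : ℝ} (hδ : 0 < δ) :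
    ∀ᶠ ε in 𝓝[>] (0 : ℝ), ∀ y,
      |dirDerivs (l.map (stdBasis n)) (fun y => ∫ x, a (x, y) * φ ε (x, y)) y -
        c * dirDerivs (l.map (stdBasis n)) (fun y => a (y, y)) y| ≤ δ := by
  induction l generalizing φ c a δ with
  | nil => exact h.tendsto_integral hΩ ha hK hK' hKΩ h0 h0' hδ
  | cons i l ih =>
    have ha' := contDiff_dirDeriv ha (diag i)
    have h0a : ∀ x ∉ K, ∀ y, dirDeriv (diag i) a (x, y) = 0 := fun x hx y =>
      dirDeriv_snd_eq_zero hK.isClosed h0 _ x hx y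
    have h0a' : ∀ x, ∀ y ∉ K', dirDeriv (diag i) a (x, y) = 0 := fun x y hy =>
      dirDeriv_fst_eq_zero hK'.isClosed h0' _ x y hy
    have hφ' := h.dirDeriv_diag hΩ i
    have hdiag : dirDeriv (stdBasis n i) (fun y => a (y, y)) =
        fun y => dirDeriv (diag i) a (y, y) := by
      ext y
      have : HasFDerivAt (fun y => a (y, y)) ((fderiv ℝ a (y, y)).comp
          ((ContinuousLinearMap.id ℝ E).prod (ContinuousLinearMap.id ℝ E))) y :=
        (ha.differentiable (by simp) (y, y)).hasFDerivAt.comp (f := fun y => (y, y)) y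
          ((hasFDerivAt_id y).prodMk (hasFDerivAt_id y))
      simp [dirDeriv, this.fderiv, diag]
    -- Leibniz rule with diagonal derivatives: the term with the derivative of `a` tends to `c`
    -- times that derivative on the diagonal, and the term with the derivative of `φ` tends to zero
    -- because its mass is `0`. Each may use `δ / 2`.
    filter_upwards [ih h ha' h0a h0a' (half_pos hδ), ih hφ' ha h0 h0' (half_pos hδ), h.smooth,
      hφ'.smooth] with ε h1 h2 h3 h4 y
    have s0 := contDiff_mul_of_support hΩ hK hKΩ ha h0 h3
    have s1 := contDiff_mul_of_support hΩ hK hKΩ ha' h0a h3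
    have s2 := contDiff_mul_of_support hΩ hK hKΩ ha h0 h4
    have hz0 : ∀ {b : E × E → ℝ} {ψ : E × E → ℝ}, (∀ x ∉ K, ∀ y, b (x, y) = 0) →
        ∀ x ∉ K, ∀ y, b (x, y) * ψ (x, y) = 0 := fun hb x hx y => by rw [hb x hx, zero_mul]
    have e1 : dirDeriv (stdBasis n i) (fun y => ∫ x, a (x, y) * φ ε (x, y)) =
        fun y => (∫ x, dirDeriv (diag i) a (x, y) * φ ε (x, y)) +
          ∫ x, a (x, y) * dirDeriv (diag i) (φ ε) (x, y) := by
      rw [dirDeriv_integral_diag hK s0 (hz0 h0) i]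
      ext y
      have hint : ∀ {g : E × E → ℝ}, ContDiff ℝ ∞ g → (∀ x ∉ K, ∀ y, g (x, y) = 0) →
          Integrable fun x => g (x, y) := fun hg hg0 =>
        (hg.continuous.comp
          (continuous_id.prodMk continuous_const)).integrable_of_hasCompactSupport
          (HasCompactSupport.intro hK fun x hx => hg0 x hx y)
      rw [← integral_add (hint s1 (hz0 h0a)) (hint s2 (hz0 h0))]
      refine integral_congr_ae (Eventually.of_forall fun x => ?_)
      by_cases hx : x ∈ K
      · have hd : DifferentiableAt ℝ (φ ε) (x, y) :=
          (h3.contDiffAt ((hΩ.prod isOpen_univ).mem_nhds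
            ⟨hKΩ hx, mem_univ _⟩)).differentiableAt (by simp)
        simp only [dirDeriv]
        rw [fderiv_fun_mul (ha.differentiable (by simp) _) hd]
        simp
        ring
      · simp only [h0 x hx, h0a x hx, zero_mul, add_zero]
        exact dirDeriv_snd_eq_zero hK.isClosed (hz0 h0) _ x hx y
    simp only [List.map_cons, dirDerivs_cons]
    rw [e1, hdiag, dirDerivs_add (contDiff_integral_fst hK s1 (hz0 h0a))
      (contDiff_integral_fst hK s2 (hz0 h0))]
    have h1y := h1 y
    have h2y := h2 y
    rw [zero_mul, sub_zero] at h2y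
    rw [abs_le] at *
    constructor <;> linarith [h1y.1, h1y.2, h2y.1, h2y.2]

end Kernels

/-! ### The divergence of the cofactor matrix -/

section Piola

variable {n : ℕ}

local notation "E" => EuclideanSpace ℝ (Fin n)

/-- The determinant in the standard basis, as a continuous multilinear map. -/
def stdDet (n : ℕ) : ContinuousMultilinearMap ℝ (fun _ : Fin n => EuclideanSpace ℝ (Fin n)) ℝ where
  toMultilinearMap := (stdBasis n).det.toMultilinearMap
  cont := by
    change Continuous fun v : Fin n → EuclideanSpace ℝ (Fin n) => (stdBasis n).det v
    simp only [Module.Basis.det_apply]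
    refine Continuous.matrix_det (continuous_matrix fun i j => ?_)
    simp only [Module.Basis.toMatrix_apply]
    exact ((stdBasis n).coord i).continuous_of_finiteDimensional.comp (continuous_apply j)

theorem stdDet_apply (v : Fin n → E) : stdDet n v = (stdBasis n).det v := rfl

theorem det_eq_stdDet (P : E →L[ℝ] E) : P.det = stdDet n fun j => P (stdBasis n j) := by
  have := (stdBasis n).det_comp P.toLinearMap (stdBasis n)
  rw [(stdBasis n).det_self, mul_one] at this
  exact this.symm

/-- When `w` is expanded in the basis, every component other than the `i`-th repeats a basis vector.
-/
theorem stdBasis_det_update (i : Fin n) (w : E) :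
    (stdBasis n).det (Function.update (stdBasis n) i w) = (stdBasis n).coord i w := by
  conv_lhs => rw [← (stdBasis n).sum_repr w]
  rw [AlternatingMap.map_update_sum, Finset.sum_eq_single i]
  · rw [AlternatingMap.map_update_smul, Function.update_eq_self, (stdBasis n).det_self]
    simp
  · intro j _ hj
    rw [AlternatingMap.map_update_smul, AlternatingMap.map_update_self _ _ hj.symm, smul_zero]
  · simp

/-- Jacobi's formula. -/
theorem hasFDerivAt_det {V : Type*} [NormedAddCommGroup V] [NormedSpace ℝ V] {P : V → E →L[ℝ] E}
    {P' : V →L[ℝ] E →L[ℝ] E} {x : V} (hP : HasFDerivAt P P' x) {R : E →L[ℝ] E}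
    (hR : (P x).comp R = ContinuousLinearMap.id ℝ E) :
    ∃ D : V →L[ℝ] ℝ, HasFDerivAt (fun x => (P x).det) D x ∧
      ∀ h, D h = (P x).det * ∑ j, (stdBasis n).coord j (R (P' h (stdBasis n j))) := by
  have h1 : ∀ j : Fin n, HasFDerivAt (fun x => P x (stdBasis n j)) (P'.flip (stdBasis n j)) x :=
    fun j => by simpa using hP.clm_apply (hasFDerivAt_const (stdBasis n j) x)
  have h2 := HasFDerivAt.multilinear_comp (stdDet n) h1
  simp only [← det_eq_stdDet] at h2
  refine ⟨_, h2, fun h => ?_⟩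
  rw [_root_.sum_apply, Finset.mul_sum]
  refine Finset.sum_congr rfl fun j _ => ?_
  -- As `P R = 1`, the new column is `P (R (P' h e_j))`, so `P` factors out of the whole
  -- determinant.
  have e1 : Function.update (fun j => P x (stdBasis n j)) j (P' h (stdBasis n j)) =
      (P x) ∘ Function.update (stdBasis n) j (R (P' h (stdBasis n j))) := by
    rw [Function.comp_update]
    congr 1
    exact (congrArg (fun f => f (P' h (stdBasis n j))) hR).symm
  change stdDet n (Function.update (fun j => P x (stdBasis n j)) j (P' h (stdBasis n j))) = _
  rw [e1, stdDet_apply]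
  exact ((stdBasis n).det_comp (P x).toLinearMap _).trans (by rw [stdBasis_det_update])

/-- The divergence of the pullback of the constant vector field `v`, as a density. -/
theorem sum_fderiv_pullback {τ : E → E} {x₀ : E} (hτ : ContDiffAt ℝ ∞ τ x₀) {r : E → E}
    (hr : DifferentiableAt ℝ r x₀) {v : E} (hrv : ∀ᶠ x in 𝓝 x₀, fderiv ℝ τ x (r x) = v)
    {R : E →L[ℝ] E} (hR : (fderiv ℝ τ x₀).comp R = ContinuousLinearMap.id ℝ E)
    (hR' : R.comp (fderiv ℝ τ x₀) = ContinuousLinearMap.id ℝ E)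
    {f : E → ℝ} (hf : DifferentiableAt ℝ f (τ x₀)) :
    ∑ i, fderiv ℝ (fun x => (fderiv ℝ τ x).det * f (τ x) * (stdBasis n).coord i (r x)) x₀
      (stdBasis n i) = (fderiv ℝ τ x₀).det * fderiv ℝ f (τ x₀) v := by
  set P := fderiv ℝ τ
  have hPd : HasFDerivAt P (fderiv ℝ P x₀) x₀ :=
    ((hτ.fderiv_right (m := ∞) le_rfl).differentiableAt (by simp)).hasFDerivAt
  set P' := fderiv ℝ P x₀
  have hsymm : ∀ a b, P' a b = P' b a := fun a b =>
    (hτ.isSymmSndFDerivAt (by simpa using WithTop.coe_le_coe.2 (le_top : (2 : ℕ∞) ≤ ⊤))).eq a b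
  obtain ⟨D, hD, hDv⟩ := hasFDerivAt_det hPd hR
  -- Differentiating the identity `P(x) r(x) = v` expresses `r'` through the second derivative of
  -- `τ`.
  have hPr : ∀ h, P x₀ (fderiv ℝ r x₀ h) = -P' h (r x₀) := by
    intro h
    have h1 := hPd.clm_apply hr.hasFDerivAt
    have h2 : HasFDerivAt (fun x => P x (r x)) (0 : E →L[ℝ] E) x₀ :=
      (hasFDerivAt_const v x₀).congr_of_eventuallyEq hrv
    have := congrArg (fun L => L h) (h1.unique h2)
    simp only [_root_.add_apply, ContinuousLinearMap.comp_apply, ContinuousLinearMap.flip_apply,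
      _root_.zero_apply] at this
    exact eq_neg_of_add_eq_zero_left this
  have hr' : ∀ h, fderiv ℝ r x₀ h = -R (P' h (r x₀)) := by
    intro h
    rw [← map_neg, ← hPr]
    exact (congrArg (fun L => L (fderiv ℝ r x₀ h)) hR').symm
  have hτ' : HasFDerivAt τ (P x₀) x₀ := (hτ.differentiableAt (by simp)).hasFDerivAt
  have hfτ := hf.hasFDerivAt.comp x₀ hτ'
  have hterm : ∀ i, fderiv ℝ (fun x => (P x).det * f (τ x) * (stdBasis n).coord i (r x)) x₀
      (stdBasis n i) = D (stdBasis n i) * f (τ x₀) * (stdBasis n).coord i (r x₀) +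
        (P x₀).det * fderiv ℝ f (τ x₀) (P x₀ (stdBasis n i)) * (stdBasis n).coord i (r x₀) -
        (P x₀).det * f (τ x₀) * (stdBasis n).coord i (R (P' (stdBasis n i) (r x₀))) := by
    intro i
    have hc : HasFDerivAt (fun x => (stdBasis n).coord i (r x))
        (((stdBasis n).coord i).toContinuousLinearMap.comp (fderiv ℝ r x₀)) x₀ :=
      ((stdBasis n).coord i).toContinuousLinearMap.hasFDerivAt.comp x₀ hr.hasFDerivAt
    have := (hD.mul hfτ).mul hc
    rw [show (fun x => (P x).det * f (τ x) * (stdBasis n).coord i (r x)) =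
      ((fun x => (P x).det) * (f ∘ τ)) * (fun x => (stdBasis n).coord i (r x)) from rfl, this.fderiv]
    simp only [_root_.add_apply, _root_.smul_apply, ContinuousLinearMap.comp_apply, hr',
      smul_eq_mul, Pi.mul_apply, Function.comp_apply, LinearMap.coe_toContinuousLinearMap', map_neg]
    ring
  have hexp : ∀ w : E, ∑ i, (stdBasis n).coord i w • stdBasis n i = w := (stdBasis n).sum_repr
  have hrx : P x₀ (r x₀) = v := hrv.self_of_nhds
  simp only [hterm]
  rw [Finset.sum_sub_distrib, Finset.sum_add_distrib]
  have s1 : ∑ i, D (stdBasis n i) * f (τ x₀) * (stdBasis n).coord i (r x₀) =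
      f (τ x₀) * D (r x₀) := by
    conv_rhs => rw [← hexp (r x₀), map_sum, Finset.mul_sum]
    refine Finset.sum_congr rfl fun i _ => ?_
    rw [map_smul, smul_eq_mul]
    ring
  have s2 : ∑ i, (P x₀).det * fderiv ℝ f (τ x₀) (P x₀ (stdBasis n i)) *
      (stdBasis n).coord i (r x₀) = (P x₀).det * fderiv ℝ f (τ x₀) v := by
    conv_rhs => rw [← hrx, ← hexp (r x₀), map_sum, map_sum, Finset.mul_sum]
    refine Finset.sum_congr rfl fun i _ => ?_
    rw [map_smul, map_smul, smul_eq_mul]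
    ring
  rw [s1, s2, hDv, ← Finset.mul_sum]
  -- The term from Jacobi's formula and the one from `r'` carry the same trace of `R P'`, with the
  -- arguments `r` and `e_i` in opposite orders; symmetry of the second derivative cancels them.
  simp only [hsymm (r x₀)]
  ring

end Piola

/-! ### Change of charts -/

section Charts

variable {n : ℕ} {M : Type*} [TopologicalSpace M] [ChartedSpace (EuclideanSpace ℝ (Fin n)) M]
  [IsManifold (𝓡 n) ∞ M]

variable {e e' : OpenPartialHomeomorph M (EuclideanSpace ℝ (Fin n))}

local notation "E" => EuclideanSpace ℝ (Fin n)

theorem isOpen_transition (e e' : OpenPartialHomeomorph M (EuclideanSpace ℝ (Fin n))) :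
    IsOpen (e.target ∩ e.symm ⁻¹' e'.source) :=
  e.symm.isOpen_inter_preimage e'.open_source

theorem contDiffOn_transition (he : e ∈ atlas E M) (he' : e' ∈ atlas E M) :
    ContDiffOn ℝ ∞ (fun x => e' (e.symm x)) (e.target ∩ e.symm ⁻¹' e'.source) := by
  have h1 := contMDiffOn_of_mem_maximalAtlas
    (IsManifold.subset_maximalAtlas (I := 𝓡 n) (n := ∞) he')
  have h2 := contMDiffOn_symm_of_mem_maximalAtlas
    (IsManifold.subset_maximalAtlas (I := 𝓡 n) (n := ∞) he)
  exact (h1.comp (h2.mono inter_subset_left) fun x hx => hx.2).contDiffOn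

theorem chartDiff_chartFrame (he : e ∈ atlas E M) {q : M} (hq : q ∈ e.source) (v : E) :
    chartDiff e q (chartFrame e q v) = v := by
  have h := (mdifferentiable_of_mem_atlas (I := 𝓡 n) he).comp_symm_deriv (e.map_source hq)
  rw [e.left_inv hq] at h
  exact congrArg (fun f => f v) h

theorem chartFrame_chartDiff (he : e ∈ atlas E M) {q : M} (hq : q ∈ e.source)
    (w : TangentSpace (𝓡 n) q) : chartFrame e q (chartDiff e q w) = w :=
  congrArg (fun f => f w) ((mdifferentiable_of_mem_atlas (I := 𝓡 n) he).symm_comp_deriv hq)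

theorem chartDiff_chartFrame' (he : e ∈ atlas E M) (he' : e' ∈ atlas E M) {q : M}
    (hq : q ∈ e.source) (hq' : q ∈ e'.source) (v : E) :
    chartDiff e' q (chartFrame e q v) = fderiv ℝ (fun x => e' (e.symm x)) (e q) v := by
  have hs := (mdifferentiable_of_mem_atlas (I := 𝓡 n) he).mdifferentiableAt_symm (e.map_source hq)
  have hd := (mdifferentiable_of_mem_atlas (I := 𝓡 n) he').mdifferentiableAt
    (x := e.symm (e q)) (by rwa [e.left_inv hq])
  have h := mfderiv_comp (e q) hd hs
  rw [e.left_inv hq, mfderiv_eq_fderiv] at h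
  exact (congrArg (fun f => f v) h).symm

theorem fderiv_transition_comp (he : e ∈ atlas E M) (he' : e' ∈ atlas E M) {q : M}
    (hq : q ∈ e.source) (hq' : q ∈ e'.source) :
    (fderiv ℝ (fun x => e' (e.symm x)) (e q)).comp (fderiv ℝ (fun x => e (e'.symm x)) (e' q)) =
      ContinuousLinearMap.id ℝ E := by
  ext1 v
  rw [ContinuousLinearMap.comp_apply, ← chartDiff_chartFrame' he he' hq hq',
    ← chartDiff_chartFrame' he' he hq' hq, chartFrame_chartDiff he hq,
    chartDiff_chartFrame he' hq']
  rfl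

theorem coordCovec_coordVec (he : e ∈ atlas E M) {q : M} (hq : q ∈ e.source) (i j : Fin n) :
    coordCovec e q i (coordVec e q j) = if j = i then 1 else 0 := by
  have : coordCovec e q i (coordVec e q j) =
    (stdBasis n).coord i (chartDiff e q (chartFrame e q (stdBasis n j))) := rfl
  rw [this, chartDiff_chartFrame he hq, Module.Basis.coord_apply, Module.Basis.repr_self,
    Finsupp.single_apply]

/-- The basis of coordinate vectors. -/
def chartBasis (he : e ∈ atlas E M) {q : M} (hq : q ∈ e.source) :
    Module.Basis (Fin n) ℝ (TangentSpace (𝓡 n) q) :=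
  (stdBasis n).map (LinearEquiv.ofLinear (chartFrame e q).toLinearMap (chartDiff e q).toLinearMap
    (LinearMap.ext fun w => chartFrame_chartDiff he hq w)
    (LinearMap.ext fun v => chartDiff_chartFrame he hq v))

theorem coe_chartBasis (he : e ∈ atlas E M) {q : M} (hq : q ∈ e.source) :
    ⇑(chartBasis he hq) = coordVec e q := rfl

theorem chartVolume_coordVec (he : e ∈ atlas E M) {q : M} (hq : q ∈ e.source) :
    chartVolume e q (coordVec e q) = 1 := by
  have : (fun i => (chartDiff e q) (coordVec e q i)) = stdBasis n :=
    funext fun i => chartDiff_chartFrame he hq _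
  rw [chartVolume, AlternatingMap.compLinearMap_apply]
  exact (congrArg _ this).trans (stdBasis n).det_self

/-- The space of top degree forms is one-dimensional, and `chartVolume e q` takes the value one on
the coordinate frame. -/
theorem nform_eq_smul_chartVolume (he : e ∈ atlas E M) {q : M} (hq : q ∈ e.source)
    (η : NForm n q) : η = η (coordVec e q) • chartVolume e q := by
  have h1 := η.eq_smul_basis_det (chartBasis he hq)
  have h2 := (chartVolume e q).eq_smul_basis_det (chartBasis he hq)
  rw [coe_chartBasis, chartVolume_coordVec he hq, one_smul] at h2
  rw [coe_chartBasis, ← h2] at h1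
  exact h1

/-- The transformation of the coefficients of an `n`-form under a change of charts. -/
theorem nform_coordVec (he : e ∈ atlas E M) (he' : e' ∈ atlas E M) {q : M}
    (hq : q ∈ e.source) (hq' : q ∈ e'.source) (η : NForm n q) :
    η (coordVec e q) = (fderiv ℝ (fun x => e' (e.symm x)) (e q)).det * η (coordVec e' q) := by
  conv_lhs => rw [nform_eq_smul_chartVolume he' hq' η]
  rw [AlternatingMap.smul_apply, smul_eq_mul, mul_comm]
  congr 1
  have : (fun i => (chartDiff e' q) (coordVec e q i)) =
      (fderiv ℝ (fun x => e' (e.symm x)) (e q)) ∘ stdBasis n :=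
    funext fun i => chartDiff_chartFrame' he he' hq hq' _
  rw [chartVolume, AlternatingMap.compLinearMap_apply]
  refine (congrArg _ this).trans (((stdBasis n).det_comp _ _).trans ?_)
  rw [(stdBasis n).det_self, mul_one]

theorem coeff_eq (he : e ∈ atlas E M) (he' : e' ∈ atlas E M) {x : E} (hx : x ∈ e.target)
    (hx' : e.symm x ∈ e'.source) (η : ∀ q : M, NForm n q) :
    coeff e η x = (fderiv ℝ (fun x => e' (e.symm x)) x).det * coeff e' η (e' (e.symm x)) := by
  rw [coeff, nform_coordVec he he' (e.map_target hx) hx', coeff, e.right_inv hx, e'.left_inv hx']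

/-- The Lie derivative of an `n`-form along a vector field with constant coordinates. -/
theorem lieForm_coordVec (he : e ∈ atlas E M) {q : M} (hq : q ∈ e.source) (X : VField n M)
    (η : ∀ q : M, NForm n q) {v : E} (hX : ∀ᶠ q' in 𝓝 q, X q' = chartFrame e q' v)
    (hη : DifferentiableAt ℝ (coeff e η) (e q)) :
    lieForm X η q (coordVec e q) = dirDeriv v (coeff e η) (e q) := by
  -- `lieForm` is computed in the preferred chart `e₀` at `q` rather than in `e`. There the field is
  -- the pullback `r` of `v` and the coefficient acquires the Jacobian determinant, which is the
  -- situation of `sum_fderiv_pullback`.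
  set e₀ := chartAt E q with he₀
  have h₀ : e₀ ∈ atlas E M := chart_mem_atlas E q
  have hq₀ : q ∈ e₀.source := mem_chart_source E q
  set x₀ := e₀ q
  have hx₀ : x₀ ∈ e₀.target := e₀.map_source hq₀
  have hsx : e₀.symm x₀ = q := e₀.left_inv hq₀
  set τ : E → E := fun x => e (e₀.symm x)
  have hτx : τ x₀ = e q := by simp only [τ, hsx]
  have hmem : x₀ ∈ e₀.target ∩ e₀.symm ⁻¹' e.source := ⟨hx₀, by rwa [mem_preimage, hsx]⟩
  have hnhds := (isOpen_transition e₀ e).mem_nhds hmem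
  have hτ : ContDiffAt ℝ ∞ τ x₀ := (contDiffOn_transition h₀ he).contDiffAt hnhds
  set r : E → E := fun x => fderiv ℝ (fun y => e₀ (e.symm y)) (τ x) v with hr
  have hmem' : τ x₀ ∈ e.target ∩ e.symm ⁻¹' e₀.source := by
    rw [hτx]
    exact ⟨e.map_source hq, by rwa [mem_preimage, e.left_inv hq]⟩
  have hrd : DifferentiableAt ℝ r x₀ := by
    have h1 : ContDiffAt ℝ ∞ (fderiv ℝ (fun y => e₀ (e.symm y))) (τ x₀) :=
      (((contDiffOn_transition he h₀).contDiffAt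
        ((isOpen_transition e e₀).mem_nhds hmem')).fderiv_right (m := ∞) le_rfl)
    exact (((h1.comp x₀ hτ).differentiableAt (by simp)).clm_apply (differentiableAt_const v))
  have hpt : ∀ x ∈ e₀.target ∩ e₀.symm ⁻¹' e.source,
      r x = chartDiff e₀ (e₀.symm x) (chartFrame e (e₀.symm x) v) := fun x hx => by
    rw [chartDiff_chartFrame' he h₀ hx.2 (e₀.map_target hx.1)]
  have hrv : ∀ᶠ x in 𝓝 x₀, fderiv ℝ τ x (r x) = v := by
    filter_upwards [hnhds] with x hx
    have := fderiv_transition_comp h₀ he (e₀.map_target hx.1) hx.2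
    rw [e₀.right_inv hx.1] at this
    exact congrArg (fun f => f v) this
  have hR := fderiv_transition_comp h₀ he hq₀ hq
  have hR' := fderiv_transition_comp he h₀ hq hq₀
  have key := sum_fderiv_pullback hτ hrd hrv hR hR' (f := coeff e η) (by rwa [hτx])
  have hcont : Tendsto e₀.symm (𝓝 x₀) (𝓝 q) := by
    have := (e₀.continuousAt_symm hx₀).tendsto
    rwa [hsx] at this
  have hsum : ∑ i, fderiv ℝ (fun x => coeff e₀ η x * (stdBasis n).coord i
      (chartDiff e₀ (e₀.symm x) (X (e₀.symm x)))) x₀ (stdBasis n i) =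
        (fderiv ℝ τ x₀).det * fderiv ℝ (coeff e η) (τ x₀) v := by
    rw [← key]
    refine Finset.sum_congr rfl fun i _ => ?_
    congr 1
    refine Filter.EventuallyEq.fderiv_eq ?_
    filter_upwards [hnhds, hcont.eventually hX] with x hx hXx
    rw [coeff_eq h₀ he hx.1 hx.2, hXx, hpt x hx]
  -- The remaining Jacobian is compensated by evaluating the volume form of `e₀` on the frame of
  -- `e`.
  have hvol : (fderiv ℝ τ x₀).det * chartVolume e₀ q (coordVec e q) = 1 := by
    rw [← nform_coordVec h₀ he hq₀ hq, chartVolume_coordVec h₀ hq₀]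
  have : lieForm X η q (coordVec e q) = (∑ i, fderiv ℝ (fun x => coeff e₀ η x * (stdBasis n).coord i
      (chartDiff e₀ (e₀.symm x) (X (e₀.symm x)))) x₀ (stdBasis n i)) *
        chartVolume e₀ q (coordVec e q) := rfl
  rw [this, hsum, mul_right_comm, hvol, one_mul, hτx]
  rfl

/-- The derivative of a kernel in the point slot along a vector field. -/
theorem lieKernel'_coordVec (he : e ∈ atlas E M) {p q : M} (hp : p ∈ e.source) (hq : q ∈ e.source)
    (X : VField n M) (Ψ : ℝ → M → ∀ q : M, NForm n q) (ε : ℝ) {v : E}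
    (hX : X p = chartFrame e p v)
    (hΨ : DifferentiableAt ℝ (fun x => Ψ ε (e.symm x) q (coordVec e q)) (e p)) :
    lieKernel' X Ψ ε p q (coordVec e q) =
      dirDeriv v (fun x => Ψ ε (e.symm x) q (coordVec e q)) (e p) := by
  set e₀ := chartAt E q with he₀
  have h₀ : e₀ ∈ atlas E M := chart_mem_atlas E q
  have hq₀ : q ∈ e₀.source := mem_chart_source E q
  set d := (fderiv ℝ (fun x => e (e₀.symm x)) (e₀ q)).det
  -- While `p'` moves, `q` is fixed, so the change of frame at `q` is multiplication by the constant
  -- `d`.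
  have hd : ∀ p', Ψ ε p' q (coordVec e₀ q) = d * Ψ ε p' q (coordVec e q) := fun p' =>
    nform_coordVec h₀ he hq₀ hq _
  have hvol : d * chartVolume e₀ q (coordVec e q) = 1 := by
    rw [← nform_coordVec h₀ he hq₀ hq, chartVolume_coordVec h₀ hq₀]
  set G : M → ℝ := fun p' => Ψ ε p' q (coordVec e₀ q) with hG
  set g : E → ℝ := fun x => d * Ψ ε (e.symm x) q (coordVec e q)
  have hg : DifferentiableAt ℝ g (e p) := hΨ.const_mul d
  have hGg : G =ᶠ[𝓝 p] g ∘ e := by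
    filter_upwards [e.open_source.mem_nhds hp] with p' hp'
    simp only [hG, hd, g, Function.comp_apply, e.left_inv hp']
  let c : ℝ := mfderiv (𝓡 n) 𝓘(ℝ, ℝ) G p (X p)
  have hm : c = fderiv ℝ g (e p) v := by
    change mfderiv (𝓡 n) 𝓘(ℝ, ℝ) G p (X p) = _
    rw [hGg.mfderiv_eq]
    have h1 := mfderiv_comp p (I'' := 𝓘(ℝ, ℝ)) hg.mdifferentiableAt
      ((mdifferentiable_of_mem_atlas (I := 𝓡 n) he).mdifferentiableAt hp)
    rw [h1, hX, mfderiv_eq_fderiv]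
    exact congrArg _ (chartDiff_chartFrame he hp v)
  have : lieKernel' X Ψ ε p q (coordVec e q) =
      c * chartVolume e₀ q (coordVec e q) := rfl
  rw [this, hm]
  have h2 : fderiv ℝ g (e p) v = d * dirDeriv v (fun x => Ψ ε (e.symm x) q (coordVec e q)) (e p) :=
    congrFun (dirDeriv_const_mul d (fun x => Ψ ε (e.symm x) q (coordVec e q)) v) (e p)
  rw [h2, mul_right_comm, hvol, one_mul]

end Charts

/-! ### Integration of `n`-forms in a chart -/

section FormIntegral

variable {n : ℕ} {M : Type*} [TopologicalSpace M] [ChartedSpace (EuclideanSpace ℝ (Fin n)) M]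

variable {e e' : OpenPartialHomeomorph M (EuclideanSpace ℝ (Fin n))}

local notation "E" => EuclideanSpace ℝ (Fin n)

theorem abs_chartSign_le (o : ManifoldOrientation n M)
    (e : OpenPartialHomeomorph M (EuclideanSpace ℝ (Fin n))) (q : M) :
    |chartSign o.at_ e q| ≤ 1 := by
  rw [chartSign]
  rcases Real.sign_apply_eq ((o.at_ q).someVector (coordVec e q)) with h | h | h <;> simp [h]

theorem eventually_chartSign_eq (o : ManifoldOrientation n M) (he : e ∈ atlas E M) {x : E}
    (hx : x ∈ e.target) :
    ∀ᶠ x' in 𝓝 x, chartSign o.at_ e (e.symm x') = chartSign o.at_ e (e.symm x) :=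
  (e.continuousAt_symm hx).tendsto.eventually (o.locallyConstant e he _ (e.map_target hx))

theorem contDiffOn_chartSign (o : ManifoldOrientation n M) (he : e ∈ atlas E M) :
    ContDiffOn ℝ ∞ (fun x => chartSign o.at_ e (e.symm x)) e.target := fun _ hx =>
  (contDiffAt_const.congr_of_eventuallyEq (eventually_chartSign_eq o he hx)).contDiffWithinAt

/-- A ball is connected and the sign is locally constant. The sign at the centre can thus replace
the sign at the points of a kernel's support. -/
theorem chartSign_eq_of_ball_subset (o : ManifoldOrientation n M) (he : e ∈ atlas E M) {x y : E}
    {r : ℝ} (hr : Metric.ball x r ⊆ e.target) (hy : y ∈ Metric.ball x r) :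
    chartSign o.at_ e (e.symm y) = chartSign o.at_ e (e.symm x) := by
  refine Metric.isOpen_ball.is_const_of_fderiv_eq_zero (𝕜 := ℝ)
    (f := fun x => chartSign o.at_ e (e.symm x))
    (convex_ball x r).isPreconnected
    (((contDiffOn_chartSign o he).differentiableOn (by simp)).mono hr) (fun z hz => ?_) hy
    (Metric.mem_ball_self (Metric.pos_of_mem_ball hy))
  have : (fun x => chartSign o.at_ e (e.symm x)) =ᶠ[𝓝 z] fun _ => chartSign o.at_ e (e.symm z) :=
    eventually_chartSign_eq o he (hr hz)
  rw [this.fderiv_eq]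
  simp

theorem coeff_smul (ρ : M → ℝ) (η : ∀ q : M, NForm n q) (x : E) :
    coeff e (fun q => ρ q • η q) x = ρ (e.symm x) * coeff e η x := rfl

variable [IsManifold (𝓡 n) ∞ M]

/-- The integral of a form supported in the intersection of two chart domains does not depend
on the chart. -/
theorem chartIntegral_eq_chartIntegral (o : ManifoldOrientation n M) (he : e ∈ atlas E M)
    (he' : e' ∈ atlas E M) (η : ∀ q : M, NForm n q)
    (h0 : ∀ q, q ∉ e.source ∩ e'.source → η q = 0) :
    chartIntegral o e η = chartIntegral o e' η := by
  set A := e.target ∩ e.symm ⁻¹' e'.source with hA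
  set A' := e'.target ∩ e'.symm ⁻¹' e.source with hA'
  set τ : E → E := fun x => e' (e.symm x)
  have hAo : IsOpen A := isOpen_transition e e'
  have red : ∀ {e₁ e₂ : OpenPartialHomeomorph M E}, (∀ q, q ∉ e₁.source ∩ e₂.source → η q = 0) →
      chartIntegral o e₁ η = ∫ x in e₁.target ∩ e₁.symm ⁻¹' e₂.source,
        chartSign o.at_ e₁ (e₁.symm x) * coeff e₁ η x := by
    intro e₁ e₂ h
    refine setIntegral_eq_of_subset_of_forall_sdiff_eq_zero e₁.open_target.measurableSet
      inter_subset_left fun x hx => ?_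
    rw [coeff, h _ fun hq => hx.2 ⟨hx.1, hq.2⟩]
    simp
  have himg : τ '' A = A' := by
    ext y
    constructor
    · rintro ⟨x, hx, rfl⟩
      refine ⟨e'.map_source hx.2, ?_⟩
      simp only [τ, mem_preimage, e'.left_inv hx.2]
      exact e.map_target hx.1
    · intro hy
      refine ⟨e (e'.symm y), ⟨e.map_source hy.2, ?_⟩, ?_⟩
      · rw [mem_preimage, e.left_inv hy.2]
        exact e'.map_target hy.1
      · simp only [τ, e.left_inv hy.2, e'.right_inv hy.1]
  have hinj : InjOn τ A := fun x hx y hy hxy => by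
    have h1 := congrArg e'.symm hxy
    simp only [τ, e'.left_inv hx.2, e'.left_inv hy.2] at h1
    exact e.symm.injOn hx.1 hy.1 h1
  have hτ : ∀ x ∈ A, HasFDerivWithinAt τ (fderiv ℝ τ x) A x := fun x hx =>
    (((contDiffOn_transition he he').contDiffAt (hAo.mem_nhds hx)).differentiableAt
      (by simp)).hasFDerivAt.hasFDerivWithinAt
  rw [red h0, red (e₁ := e') (e₂ := e) (by rwa [inter_comm]), ← hA, ← hA', ← himg,
    integral_image_eq_integral_abs_det_fderiv_smul volume hAo.measurableSet hτ hinj]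
  refine setIntegral_congr_fun hAo.measurableSet fun x hx => ?_
  -- The orientation signs of the two charts differ by the sign of the Jacobian determinant; this
  -- turns the determinant in the coefficient into the absolute value of the substitution rule.
  have h1 : (fderiv ℝ τ x).det * (o.at_ (e.symm x)).someVector (coordVec e' (e.symm x)) =
      (o.at_ (e.symm x)).someVector (coordVec e (e.symm x)) := by
    rw [nform_coordVec he he' (e.map_target hx.1) hx.2 (o.at_ (e.symm x)).someVector,
      e.right_inv hx.1]
  have h2 := coeff_eq he he' hx.1 hx.2 η
  have h3 : chartSign o.at_ e' (e'.symm (τ x)) = chartSign o.at_ e' (e.symm x) :=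
    congrArg (chartSign o.at_ e') (e'.left_inv hx.2)
  simp only [smul_eq_mul]
  rw [h3, h2]
  simp only [chartSign]
  rw [← h1]
  simp only [τ]
  generalize (fderiv ℝ (fun x => e' (e.symm x)) x).det = d
  have hs : ∀ a b : ℝ, Real.sign (a * b) * a = |a| * Real.sign b := by
    intro a b
    rcases lt_trichotomy a 0 with ha | rfl | ha
    · rw [abs_of_neg ha]
      rcases lt_trichotomy b 0 with hb | rfl | hb
      · rw [Real.sign_of_pos (mul_pos_of_neg_of_neg ha hb), Real.sign_of_neg hb]; ring
      · simp
      · rw [Real.sign_of_neg (mul_neg_of_neg_of_pos ha hb), Real.sign_of_pos hb]; ring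
    · simp
    · rw [abs_of_pos ha]
      rcases lt_trichotomy b 0 with hb | rfl | hb
      · rw [Real.sign_of_neg (mul_neg_of_pos_of_neg ha hb), Real.sign_of_neg hb]; ring
      · simp
      · rw [Real.sign_of_pos (mul_pos ha hb), Real.sign_of_pos hb]; ring
  rw [← mul_assoc, hs, mul_assoc]

/-- The integral of a form with compact support in the domain of a chart. -/
theorem formIntegral_eq_chartIntegral [T2Space M] [SecondCountableTopology M]
    (o : ManifoldOrientation n M) (he : e ∈ atlas E M) {η : ∀ q : M, NForm n q}
    (hη : ContinuousOn (coeff e η) e.target) {K : Set M} (hK : IsCompact K) (hKe : K ⊆ e.source)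
    (h0 : ∀ q ∉ K, η q = 0) : formIntegral o η = chartIntegral o e η := by
  have : LocallyCompactSpace M := Manifold.locallyCompact_of_finiteDimensional (𝓡 n)
  set ρ := chartPartition n M
  have hρs : ∀ i, tsupport (ρ i) ⊆ (chartAt E i).source :=
    (SmoothPartitionOfUnity.exists_isSubordinate_chartAt_source (𝓡 n) M).choose_spec
  have hfin : {i | (Function.support (ρ i) ∩ K).Nonempty}.Finite :=
    ρ.locallyFinite.finite_nonempty_inter_compact hK
  have hz : ∀ i ∉ hfin.toFinset, ∀ q, ρ i q • η q = 0 := by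
    intro i hi q
    by_cases hq : q ∈ K
    · have : ρ i q = 0 := by
        by_contra hne
        exact hi (hfin.mem_toFinset.2 ⟨q, hne, hq⟩)
      rw [this, zero_smul]
    · rw [h0 q hq, smul_zero]
  have e1 : formIntegral o η = ∑ i ∈ hfin.toFinset, chartIntegral o e fun q => ρ i q • η q := by
    rw [formIntegral, finsum_eq_sum_of_support_subset (s := hfin.toFinset)]
    · refine Finset.sum_congr rfl fun i _ => ?_
      refine chartIntegral_eq_chartIntegral o (chart_mem_atlas E i) he _ fun q hq => ?_
      rw [mem_inter_iff, not_and_or] at hq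
      rcases hq with hq | hq
      · have : ρ i q = 0 := by
          by_contra hne
          exact hq (hρs i (subset_tsupport _ hne))
        rw [this, zero_smul]
      · rw [h0 q fun hqK => hq (hKe hqK), smul_zero]
    · intro i hi
      by_contra hne
      refine hi ?_
      change chartIntegral o (chartAt E i) (fun q => ρ i q • η q) = 0
      rw [funext (hz i hne)]
      simp [chartIntegral, coeff]
  rw [e1]
  have hint : ∀ i, IntegrableOn (fun x => chartSign o.at_ e (e.symm x) *
      coeff e (fun q => ρ i q • η q) x) e.target := by
    intro i
    have hKc : IsCompact (e '' K) := hK.image_of_continuousOn (e.continuousOn.mono hKe)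
    have hKt : e '' K ⊆ e.target := by
      rintro _ ⟨q, hq, rfl⟩
      exact e.map_source (hKe hq)
    refine IntegrableOn.of_forall_sdiff_eq_zero
      (ContinuousOn.integrableOn_compact (μ := volume) hKc ?_) e.open_target.measurableSet
      fun x hx => ?_
    · refine ((contDiffOn_chartSign o he).continuousOn.mul ?_).mono hKt
      exact ((ρ i).contMDiff.continuous.comp_continuousOn e.continuousOn_symm).mul hη
    · rw [coeff_smul, coeff, h0 _ fun hq => hx.2 ⟨_, hq, e.right_inv hx.1⟩]
      simp
  unfold chartIntegral
  rw [← integral_finsetSum _ fun i _ => hint i]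
  refine setIntegral_congr_fun e.open_target.measurableSet fun x hx => ?_
  change ∑ i ∈ hfin.toFinset, chartSign o.at_ e (e.symm x) * (ρ i (e.symm x) * coeff e η x) =
    chartSign o.at_ e (e.symm x) * coeff e η x
  rw [← Finset.mul_sum, ← Finset.sum_mul]
  by_cases hq : e.symm x ∈ K
  · have hs := ρ.sum_eq_one (mem_univ (e.symm x))
    rw [finsum_eq_sum_of_support_subset (s := hfin.toFinset)] at hs
    · rw [hs, one_mul]
    · intro i hi
      exact hfin.mem_toFinset.2 ⟨_, hi, hq⟩
  · simp [coeff, h0 _ hq]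

end FormIntegral

/-! ### Coordinate vector fields and Riemannian metrics in charts -/

section RiemannianCharts

variable {n : ℕ} {M : Type*} [TopologicalSpace M] [ChartedSpace (EuclideanSpace ℝ (Fin n)) M]
  [IsManifold (𝓡 n) ∞ M]

local notation "E" => EuclideanSpace ℝ (Fin n)

/-- Identifies the coordinate fields with the local frame of a trivialization of the tangent bundle,
from which they inherit smoothness. -/
theorem localFrame_eq_coordVec {i q : M} (hq : q ∈ (chartAt E i).source) (j : Fin n) :
    (trivializationAt E (TangentSpace (𝓡 n) (M := M)) i).localFrame (stdBasis n) j q =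
      coordVec (chartAt E i) q j := by
  have hq' : q ∈ (trivializationAt E (TangentSpace (𝓡 n) (M := M)) i).baseSet := by simpa using hq
  rw [Bundle.Trivialization.localFrame_apply_of_mem_baseSet _ _ hq']
  have := TangentBundle.symmL_trivializationAt (I := 𝓡 n) hq
  rw [coordVec, chartFrame]
  have h2 := congrArg (fun f => f (stdBasis n j)) this
  simp only [extChartAt, mfld_simps, mfderivWithin_univ] at h2
  refine Eq.trans ?_ h2
  rw [Bundle.Trivialization.symmL_apply _ hq']
  simp [Bundle.Trivialization.basisAt]

theorem contMDiffOn_coordVec (i : M) (j : Fin n) :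
    ContMDiffOn (𝓡 n) ((𝓡 n).prod 𝓘(ℝ, EuclideanSpace ℝ (Fin n))) ∞
      (fun q : M => (⟨q, coordVec (chartAt E i) q j⟩ : TangentBundle (𝓡 n) M))
      (chartAt E i).source := by
  have h := (trivializationAt E (TangentSpace (𝓡 n) (M := M)) i).contMDiffOn_localFrame_baseSet
    (I := 𝓡 n) (n := ∞) (b := stdBasis n) j
  have hb : (trivializationAt E (TangentSpace (𝓡 n) (M := M)) i).baseSet = (chartAt E i).source := by
    simp
  rw [hb] at h
  refine h.congr fun q hq => ?_
  rw [localFrame_eq_coordVec hq]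

/-- The growth condition on smoothing kernels involves global vector fields, so the coordinate
fields are cut off away from `K`. -/
theorem exists_vField_eq_coordVec [T2Space M] [SecondCountableTopology M] (i : M) {K : Set M}
    (hK : IsCompact K) (hKi : K ⊆ (chartAt E i).source) (j : Fin n) :
    ∃ X : VField n M, ∀ᶠ q in 𝓝ˢ K, X q = coordVec (chartAt E i) q j := by
  have : LocallyCompactSpace M := Manifold.locallyCompact_of_finiteDimensional (𝓡 n)
  obtain ⟨L, hL, hKL, hLi⟩ := exists_compact_between hK (chartAt E i).open_source hKi
  obtain ⟨f, hf1, hf0, -⟩ := exists_contMDiffMap_one_nhds_of_subset_interior (n := (⊤ : ℕ∞)) (𝓡 n)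
    hK.isClosed hKL
  have hts : tsupport f ⊆ (chartAt E i).source := by
    refine (closure_minimal ?_ hL.isClosed).trans hLi
    intro q hq
    by_contra h
    exact hq (hf0 q h)
  have hs := ContMDiffOn.smul_section_of_tsupport (V := TangentSpace (𝓡 n) (M := M))
    (f.contMDiff.contMDiffOn) (chartAt E i).open_source hts (contMDiffOn_coordVec i j)
  refine ⟨⟨_, hs⟩, ?_⟩
  filter_upwards [hf1] with q hq
  change f q • coordVec (chartAt E i) q j = _
  rw [hq, one_smul]

theorem continuousOn_inner_coordVec (g : Metric n M) (i : M) (j k : Fin n) :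
    ContinuousOn (fun q => g.inner q (coordVec (chartAt E i) q j) (coordVec (chartAt E i) q k))
      (chartAt E i).source := by
  have h := ContMDiffOn.clm_bundle_apply₂ (F₁ := E) (F₂ := E) (F₃ := ℝ)
    (E₁ := TangentSpace (𝓡 n) (M := M)) (E₂ := TangentSpace (𝓡 n) (M := M))
    (E₃ := fun _ : M => ℝ) (b := id) (g.contMDiff.contMDiffOn) (contMDiffOn_coordVec i j)
    (contMDiffOn_coordVec i k)
  intro q hq
  have := h q hq
  simp only [Bundle.contMDiffWithinAt_totalSpace] at this
  exact this.2.continuousWithinAt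

theorem inner_chartFrame (g : Metric n M) (e : OpenPartialHomeomorph M (EuclideanSpace ℝ (Fin n)))
    (q : M) (v : E) :
    g.inner q (chartFrame e q v) (chartFrame e q v) =
      ∑ j, ∑ k, v j * (v k * g.inner q (coordVec e q j) (coordVec e q k)) := by
  have h : chartFrame e q v = ∑ j, v j • coordVec e q j := by
    conv_lhs => rw [← (stdBasis n).sum_repr v, map_sum]
    refine Finset.sum_congr rfl fun j _ => ?_
    rw [map_smul]
    rfl
  rw [h]
  simp only [map_sum, map_smul, _root_.sum_apply, _root_.smul_apply, smul_eq_mul, Finset.mul_sum]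
  rw [Finset.sum_comm]
  exact Finset.sum_congr rfl fun j _ => Finset.sum_congr rfl fun k _ => by ring

/-- On compact subsets of a chart domain a Riemannian metric is equivalent to the Euclidean one. -/
theorem exists_metric_bounds (g : Metric n M) (i : M) {K : Set M} (hK : IsCompact K)
    (hKi : K ⊆ (chartAt E i).source) :
    ∃ C > (0 : ℝ), ∀ q ∈ K,
      (∀ w : TangentSpace (𝓡 n) q, ‖chartDiff (chartAt E i) q w‖ ≤ C * √(g.inner q w w)) ∧
      ∀ j, √(g.inner q (coordVec (chartAt E i) q j) (coordVec (chartAt E i) q j)) ≤ C := by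
  set e := chartAt E i
  have he : e ∈ atlas E M := chart_mem_atlas E i
  have hcont : ContinuousOn (fun z : E × M => g.inner z.2 (chartFrame e z.2 z.1)
      (chartFrame e z.2 z.1)) (Metric.sphere 0 1 ×ˢ K) := by
    simp only [inner_chartFrame]
    refine continuousOn_finsetSum _ fun j _ => continuousOn_finsetSum _ fun k _ => ?_
    have hc : ∀ j, ContinuousOn (fun z : E × M => z.1 j) (Metric.sphere 0 1 ×ˢ K) := fun j =>
      ((EuclideanSpace.proj (𝕜 := ℝ) j).continuous.comp continuous_fst).continuousOn
    exact (hc j).mul ((hc k).mul ((continuousOn_inner_coordVec g i j k).comp continuousOn_snd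
      fun z hz => hKi hz.2))
  have hpos : ∀ z ∈ Metric.sphere (0 : E) 1 ×ˢ K, 0 < g.inner z.2 (chartFrame e z.2 z.1)
      (chartFrame e z.2 z.1) := by
    rintro ⟨v, q⟩ ⟨hv, hq⟩
    refine g.pos q _ fun h0 => ?_
    have := chartDiff_chartFrame he (hKi hq) v
    rw [h0, map_zero] at this
    rw [← this] at hv
    simp at hv
  obtain ⟨m, hm, hmb⟩ : ∃ m > (0 : ℝ), ∀ z ∈ Metric.sphere (0 : E) 1 ×ˢ K,
      m ≤ g.inner z.2 (chartFrame e z.2 z.1) (chartFrame e z.2 z.1) := by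
    -- The product is empty when `K` is empty or `n = 0`, and then any positive constant works;
    -- otherwise compactness gives a positive minimum.
    rcases (Metric.sphere (0 : E) 1 ×ˢ K).eq_empty_or_nonempty with hE | hE
    · exact ⟨1, one_pos, by simp [hE]⟩
    · obtain ⟨z, hz, hzm⟩ := ((isCompact_sphere (0 : E) 1).prod hK).exists_isMinOn hE hcont
      exact ⟨_, hpos z hz, fun z' hz' => hzm hz'⟩
  have hup : ∀ j, ∃ c : ℝ, ∀ q ∈ K, g.inner q (coordVec e q j) (coordVec e q j) ≤ c := fun j => by
    obtain ⟨c, hc⟩ := hK.exists_bound_of_continuousOn ((continuousOn_inner_coordVec g i j j).mono hKi)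
    exact ⟨c, fun q hq => (le_abs_self _).trans (hc q hq)⟩
  choose c hc using hup
  have hB : ∀ j, √(c j) ≤ ∑ k, √(c k) := fun j =>
    Finset.single_le_sum (f := fun k => √(c k)) (fun k _ => Real.sqrt_nonneg _) (Finset.mem_univ j)
  have hs0 : 0 ≤ ∑ k, √(c k) := Finset.sum_nonneg fun k _ => Real.sqrt_nonneg _
  have hm' : 0 < √m := Real.sqrt_pos.2 hm
  -- `(√m)⁻¹` serves the first estimate, by homogeneity from the unit sphere; the sum of the `√(c
  -- k)` serves the second.
  refine ⟨(√m)⁻¹ + ∑ k, √(c k), by positivity, fun q hq => ⟨fun w => ?_, fun j => ?_⟩⟩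
  · have key : ∀ v : E, ‖v‖ ≤ (√m)⁻¹ * √(g.inner q (chartFrame e q v) (chartFrame e q v)) := by
      intro v
      rcases eq_or_ne v 0 with rfl | hv
      · simp
      have hv' : 0 < ‖v‖ := norm_pos_iff.2 hv
      have h1 := hmb (‖v‖⁻¹ • v, q) ⟨by simp [norm_smul, hv'.ne'], hq⟩
      simp only [map_smul, smul_eq_mul, _root_.smul_apply] at h1
      rw [inv_mul_eq_div, le_div_iff₀ hm']
      refine Real.le_sqrt_of_sq_le ?_
      rw [mul_pow, Real.sq_sqrt hm.le]
      have : ‖v‖ ^ 2 * (‖v‖⁻¹ * (‖v‖⁻¹ * g.inner q (chartFrame e q v) (chartFrame e q v))) =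
          g.inner q (chartFrame e q v) (chartFrame e q v) := by
        field_simp
      rw [← this]
      gcongr
    have h2 := key (chartDiff e q w)
    rw [chartFrame_chartDiff he (hKi hq)] at h2
    refine h2.trans ?_
    gcongr
    linarith
  · refine (Real.sqrt_le_sqrt (hc j q hq)).trans ((hB j).trans ?_)
    have : 0 < (√m)⁻¹ := by positivity
    linarith

open scoped Bundle in
/-- Riemannian balls of small radius around the points of a compact subset of a chart domain are
contained in coordinate balls of comparable radius. -/
theorem exists_metricBall_subset [T2Space M] (g : Metric n M) (i : M) {K : Set M} (hK : IsCompact K)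
    (hKi : K ⊆ (chartAt E i).source) :
    ∃ r > (0 : ℝ), ∃ C > (0 : ℝ), ∀ p ∈ K, ∀ ρ ≤ r, ∀ q ∈ metricBall g p ρ,
      q ∈ (chartAt E i).source ∧ dist (chartAt E i p) (chartAt E i q) ≤ C * ρ := by
  set e := chartAt E i with he'
  have he : e ∈ atlas E M := chart_mem_atlas E i
  have hKc : IsCompact (e '' K) := hK.image_of_continuousOn (e.continuousOn.mono hKi)
  have hKt : e '' K ⊆ e.target := by
    rintro _ ⟨q, hq, rfl⟩
    exact e.map_source (hKi hq)
  obtain ⟨R, hR, hRt⟩ := hKc.exists_cthickening_subset_open e.open_target hKt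
  set K' := e.symm '' Metric.cthickening R (e '' K)
  have hK' : IsCompact K' :=
    hKc.cthickening.image_of_continuousOn (e.continuousOn_symm.mono hRt)
  have hK'i : K' ⊆ e.source := by
    rintro _ ⟨x, hx, rfl⟩
    exact e.map_target (hRt hx)
  obtain ⟨C, hC, hCb⟩ := exists_metric_bounds g i hK' hK'i
  -- As long as it stays in `K'`, a curve of `g`-length below `R / C` has coordinate length below
  -- `R`, so it cannot leave the coordinate `R`-neighbourhood.
  refine ⟨R / C, by positivity, C, hC, fun p hp ρ hρ q hq => ?_⟩
  letI : Bundle.RiemannianBundle (fun q : M => TangentSpace (𝓡 n) q) := ⟨g.toRiemannianMetric⟩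
  have hq' : Manifold.riemannianEDist (𝓡 n) p q < ENNReal.ofReal ρ := hq
  have hnorm : ∀ q (w : TangentSpace (𝓡 n) q), ‖w‖ₑ = ENNReal.ofReal √(g.inner q w w) := by
    intro q w
    rw [← ofReal_norm, norm_eq_sqrt_real_inner]
    rfl
  have hbd : ∀ q ∈ K', ∀ w : TangentSpace (𝓡 n) q,
      ‖chartDiff e q w‖ₑ ≤ ENNReal.ofReal C * ‖w‖ₑ := by
    intro q hq w
    rw [hnorm, ← ENNReal.ofReal_mul hC.le, ← ofReal_norm]
    exact ENNReal.ofReal_le_ofReal ((hCb q hq).1 w)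
  obtain ⟨γ, hγ0, hγ1, γ_smooth, hγ, -⟩ :=
    exists_lt_locally_constant_of_riemannianEDist_lt hq' zero_lt_one
  have hpi := hKi hp
  have hnb : ∀ q, q ∈ e.source → dist (e p) (e q) < R → K' ∈ 𝓝 q := by
    intro q hq hd
    have ho : IsOpen (e.source ∩ e ⁻¹' Metric.ball (e p) R) :=
      e.isOpen_inter_preimage Metric.isOpen_ball
    refine mem_of_superset (ho.mem_nhds ⟨hq, by rwa [mem_preimage, Metric.mem_ball']⟩) ?_
    rintro q' ⟨hq'1, hq'2⟩
    refine ⟨e q', ?_, e.left_inv hq'1⟩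
    exact Metric.mem_cthickening_of_dist_le _ (e p) _ _ ⟨p, hp, rfl⟩ (Metric.mem_ball.1 hq'2).le
  have key : ∀ t₁ ∈ Icc (0 : ℝ) 1, Icc 0 t₁ ⊆ γ ⁻¹' K' → dist (e p) (e (γ t₁)) < C * ρ := by
    rintro t₁ ⟨ht₁0, ht₁1⟩ ht₁
    have hρ0 : 0 < ρ := by
      by_contra h
      rw [ENNReal.ofReal_of_nonpos (not_lt.1 h)] at hγ
      exact not_lt_bot hγ
    rcases ht₁0.eq_or_lt with rfl | h't'
    · rw [hγ0, dist_self]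
      positivity
    let γ' : ℝ → E := e ∘ γ
    have hC1 : ContMDiffOn 𝓘(ℝ, ℝ) (𝓡 n) 1 γ' (Icc 0 t₁) :=
      (contMDiffOn_of_mem_maximalAtlas (IsManifold.subset_maximalAtlas he)).comp
        γ_smooth.contMDiffOn fun t ht => hK'i (ht₁ ht)
    have hlen : ‖γ' t₁ - γ' 0‖ₑ < ENNReal.ofReal (C * ρ) := by
      calc ‖γ' t₁ - γ' 0‖ₑ
          ≤ ∫⁻ t in Icc 0 t₁, ‖derivWithin γ' (Icc 0 t₁) t‖ₑ := by
            apply enorm_sub_le_lintegral_derivWithin_Icc_of_contDiffOn_Icc _ ht₁0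
            rwa [← contMDiffOn_iff_contDiffOn]
        _ ≤ ∫⁻ t in Icc 0 t₁, ENNReal.ofReal C *
              ‖mfderivWithin 𝓘(ℝ, ℝ) (𝓡 n) γ (Icc 0 t₁) t 1‖ₑ := by
            refine setLIntegral_mono' measurableSet_Icc fun t ht => ?_
            have h1 : mfderivWithin 𝓘(ℝ, ℝ) (𝓡 n) γ' (Icc 0 t₁) t =
                (mfderiv (𝓡 n) (𝓡 n) e (γ t)) ∘L
                  (mfderivWithin 𝓘(ℝ, ℝ) (𝓡 n) γ (Icc 0 t₁) t) := by
              apply mfderiv_comp_mfderivWithin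
              · exact (mdifferentiable_chart i).mdifferentiableAt (hK'i (ht₁ ht))
              · exact (γ_smooth.mdifferentiable one_ne_zero).mdifferentiableOn _ ht
              · rw [uniqueMDiffWithinAt_iff_uniqueDiffWithinAt]
                exact uniqueDiffOn_Icc h't' _ ht
            have h2 : derivWithin γ' (Icc 0 t₁) t =
                chartDiff e (γ t) (mfderivWithin 𝓘(ℝ, ℝ) (𝓡 n) γ (Icc 0 t₁) t 1) := by
              rw [← fderivWithin_derivWithin, ← mfderivWithin_eq_fderivWithin]
              exact congrArg (fun f => f 1) h1
            rw [h2]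
            exact hbd _ (ht₁ ht) _
        _ = ENNReal.ofReal C * pathELength (𝓡 n) γ 0 t₁ := by
            rw [lintegral_const_mul' _ _ ENNReal.ofReal_ne_top,
              pathELength_eq_lintegral_mfderivWithin_Icc]
        _ ≤ ENNReal.ofReal C * pathELength (𝓡 n) γ 0 1 := by
            gcongr
        _ < ENNReal.ofReal C * ENNReal.ofReal ρ :=
            (ENNReal.mul_lt_mul_iff_right (by simpa using hC) ENNReal.ofReal_ne_top).2 hγ
        _ = ENNReal.ofReal (C * ρ) := (ENNReal.ofReal_mul hC.le).symm
    rw [← ofReal_norm, ENNReal.ofReal_lt_ofReal_iff (by positivity)] at hlen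
    rw [dist_comm, dist_eq_norm]
    simpa [γ', hγ0] using hlen
  -- Continuous induction: the times in `K'` form a closed set, and by `key` the displacement is
  -- strictly below `R`, so `K'` is a neighbourhood of the current point.
  have hall : Icc (0 : ℝ) 1 ⊆ γ ⁻¹' K' := by
    have hcl : IsClosed (γ ⁻¹' K' ∩ Icc 0 1) :=
      (hK'.isClosed.preimage γ_smooth.continuous).inter isClosed_Icc
    refine hcl.Icc_subset_of_forall_mem_nhdsGT_of_Icc_subset ?_ ?_
    · rw [mem_preimage, hγ0]
      exact mem_of_mem_nhds (hnb p hpi (by simpa using hR))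
    · rintro t ⟨ht0, ht1⟩ ht
      refine γ_smooth.continuous.continuousWithinAt (hnb _ (hK'i (ht ⟨ht0, le_rfl⟩)) ?_)
      refine (key t ⟨ht0, ht1.le⟩ ht).trans_le ?_
      rwa [le_div_iff₀' hC] at hρ
  have h1 := key 1 ⟨zero_le_one, le_rfl⟩ hall
  rw [hγ1] at h1
  exact ⟨by simpa [hγ1] using hK'i (hall ⟨zero_le_one, le_rfl⟩), h1.le⟩

end RiemannianCharts

/-! ### Smoothing kernels in charts -/

section ChartKernels

variable {n : ℕ} {M : Type*} [TopologicalSpace M] [ChartedSpace (EuclideanSpace ℝ (Fin n)) M]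

local notation "E" => EuclideanSpace ℝ (Fin n)

theorem dirDerivs_append {V : Type*} [NormedAddCommGroup V] [NormedSpace ℝ V] (l l' : List V)
    (f : V → ℝ) : dirDerivs (l ++ l') f = dirDerivs l' (dirDerivs l f) := by
  induction l generalizing f with
  | nil => rfl
  | cons v l ih => exact ih _

/-- The coefficient of a kernel in a chart. -/
def kernelCoeff (e : OpenPartialHomeomorph M (EuclideanSpace ℝ (Fin n)))
    (Φ : ℝ → M → CompactForms n M) (ε : ℝ)
    (z : EuclideanSpace ℝ (Fin n) × EuclideanSpace ℝ (Fin n)) : ℝ :=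
  coeff e (Φ ε (e.symm z.1)).1 z.2

/-- The coefficient of a kernel in a chart, extended by zero in the second variable, with the sign
which makes its integrals those of the kernel. -/
def chartKernel (o : ManifoldOrientation n M)
    (e : OpenPartialHomeomorph M (EuclideanSpace ℝ (Fin n)))
    (Φ : ℝ → M → CompactForms n M) (ε : ℝ)
    (z : EuclideanSpace ℝ (Fin n) × EuclideanSpace ℝ (Fin n)) : ℝ :=
  chartSign o.at_ e (e.symm z.1) * e.target.indicator (coeff e (Φ ε (e.symm z.1)).1) z.2

theorem IsSmoothKernel.contDiffOn_kernelCoeff {Φ : ℝ → M → CompactForms n M}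
    (hΦ : IsSmoothKernel Φ) {e : OpenPartialHomeomorph M (EuclideanSpace ℝ (Fin n))}
    (he : e ∈ atlas E M) {ε : ℝ} (hε : ε ∈ Ioc (0 : ℝ) 1) :
    ContDiffOn ℝ ∞ (kernelCoeff e Φ ε) (e.target ×ˢ e.target) :=
  (hΦ.smooth e he e he).comp (f := fun z : E × E => (ε, z))
    (contDiffOn_const.prodMk contDiffOn_id) fun z hz => ⟨hε, hz⟩

variable [IsManifold (𝓡 n) ∞ M]

/-- In a chart, the operators `L'_X + L_X` for coordinate vector fields `X` are the derivatives along
the diagonal. -/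
theorem foldr_lieKernel_coordVec {Φ : ℝ → M → CompactForms n M} (hΦ : IsSmoothKernel Φ)
    {e : OpenPartialHomeomorph M (EuclideanSpace ℝ (Fin n))} (he : e ∈ atlas E M)
    {ε : ℝ} (hε : ε ∈ Ioc (0 : ℝ) 1) {V : Set M} (hV : IsOpen V) (hVe : V ⊆ e.source)
    {X : Fin n → VField n M} (hX : ∀ j, ∀ q ∈ V, X j q = coordVec e q j) (l : List (Fin n))
    {p q : M} (hp : p ∈ V) (hq : q ∈ V) :
    (l.map X).foldr (fun X Ψ => lieKernel' X Ψ + lieKernel X Ψ) (fun ε p => (Φ ε p).1) ε p q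
      (coordVec e q) = dirDerivs (l.reverse.map diag) (kernelCoeff e Φ ε) (e p, e q) := by
  -- `foldr` applies the last operator first and `dirDerivs` the head first, hence the reversal.
  -- Both points are generalized because the next derivative needs the identity in a neighbourhood
  -- of `(p, q)`.
  induction l generalizing p q with
  | nil =>
    change (Φ ε p).1 q (coordVec e q) = coeff e (Φ ε (e.symm (e p))).1 (e q)
    rw [e.left_inv (hVe hp)]
    exact congrArg (fun q => (Φ ε p).1 q (coordVec e q)) (e.left_inv (hVe hq)).symm
  | cons j l ih =>
    set Ψ := (l.map X).foldr (fun X Ψ => lieKernel' X Ψ + lieKernel X Ψ) (fun ε p => (Φ ε p).1)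
    set D := dirDerivs (l.reverse.map diag) (kernelCoeff e Φ ε)
    have hD : DifferentiableAt ℝ D (e p, e q) :=
      ((ContDiffOn.dirDerivs (e.open_target.prod e.open_target) _
        (hΦ.contDiffOn_kernelCoeff he hε)).contDiffAt
        ((e.open_target.prod e.open_target).mem_nhds
          ⟨e.map_source (hVe hp), e.map_source (hVe hq)⟩)).differentiableAt (by simp)
    have hnear : ∀ {p}, p ∈ V → ∀ᶠ x in 𝓝 (e p), e.symm x ∈ V ∧ e (e.symm x) = x := by
      intro p hp
      have h1 : ∀ᶠ x in 𝓝 (e p), e.symm x ∈ V :=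
        (e.continuousAt_symm (e.map_source (hVe hp))).eventually
          (by rw [e.left_inv (hVe hp)]; exact hV.mem_nhds hp)
      filter_upwards [h1, e.open_target.mem_nhds (e.map_source (hVe hp))] with x hx hx'
      exact ⟨hx, e.right_inv hx'⟩
    have h1 : (fun x => Ψ ε (e.symm x) q (coordVec e q)) =ᶠ[𝓝 (e p)] fun x => D (x, e q) := by
      filter_upwards [hnear hp] with x hx
      rw [ih hx.1 hq, hx.2]
    have h2 : coeff e (Ψ ε p) =ᶠ[𝓝 (e q)] fun y => D (e p, y) := by
      filter_upwards [hnear hq] with y hy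
      rw [coeff, ih hp hy.1, hy.2]
    have hd1 : HasFDerivAt (fun x => D (x, e q)) _ (e p) :=
      hD.hasFDerivAt.comp (f := fun x => (x, e q)) (e p)
        ((hasFDerivAt_id (e p)).prodMk (hasFDerivAt_const (e q) (e p)))
    have hd2 : HasFDerivAt (fun y => D (e p, y)) _ (e q) :=
      hD.hasFDerivAt.comp (f := fun y => (e p, y)) (e q)
        ((hasFDerivAt_const (e p) (e q)).prodMk (hasFDerivAt_id (e q)))
    have e1 := lieKernel'_coordVec he (hVe hp) (hVe hq) (X j) Ψ ε (v := stdBasis n j) (hX j p hp)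
      (hd1.congr_of_eventuallyEq h1).differentiableAt
    have e2 := lieForm_coordVec he (hVe hq) (X j) (Ψ ε p) (v := stdBasis n j)
      (eventually_of_mem (hV.mem_nhds hq) (hX j)) (hd2.congr_of_eventuallyEq h2).differentiableAt
    have e3 : (((j :: l).map X).foldr (fun X Ψ => lieKernel' X Ψ + lieKernel X Ψ)
        (fun ε p => (Φ ε p).1) ε p q) (coordVec e q) =
        lieKernel' (X j) Ψ ε p q (coordVec e q) + lieForm (X j) (Ψ ε p) q (coordVec e q) := rfl
    rw [e3, e1, e2, List.reverse_cons, List.map_append, dirDerivs_append]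
    change _ = dirDeriv (diag j) D (e p, e q)
    rw [diag_eq, dirDeriv_add_vec]
    simp only [dirDeriv]
    rw [h1.fderiv_eq, h2.fderiv_eq, hd1.fderiv, hd2.fderiv]
    simp

/-- In the chart `chartAt i` a smoothing kernel is a kernel family over every open set contained in
a compact subset of the range of the chart, and its supports stay in a compact subset. -/
theorem IsSmoothingKernel.isKernelFamily [T2Space M] [SecondCountableTopology M]
    {o : ManifoldOrientation n M} {Φ : ℝ → M → CompactForms n M} (hΦ : IsSmoothingKernel o Φ) (i : M)
    {Ω K : Set E} (hΩ : IsOpen Ω) (hK : IsCompact K) (hΩK : Ω ⊆ K) (hKi : K ⊆ (chartAt E i).target) :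
    IsKernelFamily Ω (chartKernel o (chartAt E i) Φ) 1 ∧
    ∃ K' ⊆ (chartAt E i).target, IsCompact K' ∧ ∀ᶠ ε in 𝓝[>] (0 : ℝ), ∀ x ∈ Ω,
      ∀ q ∉ (chartAt E i).symm '' K', (Φ ε ((chartAt E i).symm x)).1 q = 0 := by
  set e := chartAt E i with he'
  have he : e ∈ atlas E M := chart_mem_atlas E i
  obtain ⟨R, hR, hRt⟩ := hK.exists_cthickening_subset_open e.open_target hKi
  -- `K2` will contain the supports for small `ε`; `V` is a larger neighbourhood on which the
  -- cut-off fields must still be the coordinate fields.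
  set K2 := Metric.cthickening (R / 2) K
  have hK2t : K2 ⊆ e.target := (Metric.cthickening_mono (by linarith) _).trans hRt
  have hK2c : IsCompact K2 := hK.cthickening
  set V : Set M := e.source ∩ e ⁻¹' Metric.thickening R K
  have hV : IsOpen V := e.isOpen_inter_preimage Metric.isOpen_thickening
  set KM : Set M := e.symm '' Metric.cthickening R K
  have hKM : IsCompact KM := hK.cthickening.image_of_continuousOn (e.continuousOn_symm.mono hRt)
  have hKMe : KM ⊆ e.source := by
    rintro _ ⟨x, hx, rfl⟩
    exact e.map_target (hRt hx)
  have hVK : V ⊆ KM := fun q hq =>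
    ⟨e q, Metric.thickening_subset_cthickening _ _ hq.2, e.left_inv hq.1⟩
  set K1 : Set M := e.symm '' K
  have hK1 : IsCompact K1 := hK.image_of_continuousOn (e.continuousOn_symm.mono hKi)
  have hK1e : K1 ⊆ e.source := by
    rintro _ ⟨x, hx, rfl⟩
    exact e.map_target (hKi hx)
  have hsymmV : ∀ {x}, x ∈ K2 → e.symm x ∈ V := fun {x} hx =>
    ⟨e.map_target (hK2t hx), by
      rw [mem_preimage, e.right_inv (hK2t hx)]
      exact Metric.cthickening_subset_thickening' hR (by linarith) _ hx⟩
  obtain ⟨g, hg1, hg2⟩ := hΦ.exists_metric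
  obtain ⟨ε₁, hε₁, C₁, hC₁, hsupp⟩ := hg1 K1 hK1
  obtain ⟨r, hr, C₂, hC₂, hball⟩ := exists_metricBall_subset g i hK1 hK1e
  -- For `ε ≤ r / C₁` the metric radius `ε * C₁` is at most `r`, and the comparison of balls turns
  -- it into the coordinate radius `C₂ * C₁ * ε`.
  have hdist : ∀ᶠ ε in 𝓝[>] (0 : ℝ), ∀ x ∈ Ω, ∀ q, (Φ ε (e.symm x)).1 q ≠ 0 →
      q ∈ e.source ∧ dist x (e q) ≤ C₂ * C₁ * ε := by
    filter_upwards [Ioc_mem_nhdsGT (show (0 : ℝ) < min (min 1 ε₁) (r / C₁) by positivity)]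
      with ε hε x hx q hq
    have hx' := hΩK hx
    have h1 := hsupp (e.symm x) ⟨x, hx', rfl⟩ ε
      ⟨hε.1, hε.2.trans ((min_le_left _ _).trans (min_le_left _ _))⟩
      (hε.2.trans ((min_le_left _ _).trans (min_le_right _ _))) (subset_closure hq)
    have h3 : ε ≤ r / C₁ := hε.2.trans (min_le_right _ _)
    rw [le_div_iff₀ hC₁] at h3
    have h2 := hball (e.symm x) ⟨x, hx', rfl⟩ (ε * C₁) h3 q h1
    rw [e.right_inv (hKi hx')] at h2
    exact ⟨h2.1, h2.2.trans_eq (by ring)⟩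
  have hsmall : ∀ᶠ ε in 𝓝[>] (0 : ℝ), ε ∈ Ioc (0 : ℝ) 1 ∧ C₂ * C₁ * ε ≤ R / 2 := by
    filter_upwards [Ioc_mem_nhdsGT (show (0 : ℝ) < min 1 (R / 2 / (C₂ * C₁)) by positivity)]
      with ε hε
    have h3 : ε ≤ R / 2 / (C₂ * C₁) := hε.2.trans (min_le_right _ _)
    rw [le_div_iff₀' (by positivity)] at h3
    exact ⟨⟨hε.1, hε.2.trans (min_le_left _ _)⟩, h3⟩
  have hK' : ∀ᶠ ε in 𝓝[>] (0 : ℝ), ∀ x ∈ Ω, ∀ q ∉ e.symm '' K2, (Φ ε (e.symm x)).1 q = 0 := by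
    filter_upwards [hdist, hsmall] with ε hd hs x hx q hq
    by_contra hne
    obtain ⟨h1, h2⟩ := hd x hx q hne
    refine hq ⟨e q, ?_, e.left_inv h1⟩
    exact Metric.mem_cthickening_of_dist_le _ x _ _ (hΩK hx) (by rw [dist_comm]; linarith)
  have hz : ∀ᶠ ε in 𝓝[>] (0 : ℝ), ∀ x ∈ Ω, ∀ y ∉ K2, chartKernel o e Φ ε (x, y) = 0 := by
    filter_upwards [hK'] with ε hε x hx y hy
    rw [chartKernel]
    by_cases hyt : y ∈ e.target
    · simp only [indicator_of_mem hyt, coeff]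
      rw [hε x hx _ ?_]
      · simp
      · rintro ⟨y', hy', hyy⟩
        exact hy (e.symm.injOn (hK2t hy') hyt hyy ▸ hy')
    · simp [indicator_of_notMem hyt]
  -- Near `(x, y)` the sign is constant and the extension by zero is invisible, so `chartKernel` has
  -- the derivatives of `kernelCoeff` up to a constant factor.
  have hloc : ∀ ε, ∀ x ∈ Ω, ∀ y ∈ e.target, chartKernel o e Φ ε =ᶠ[𝓝 (x, y)]
      fun z => chartSign o.at_ e (e.symm x) * kernelCoeff e Φ ε z := by
    intro ε x hx y hy
    have h1 := (continuousAt_fst (p := (x, y))).eventually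
      (eventually_chartSign_eq o he (hKi (hΩK hx)))
    have h2 := (continuousAt_snd (p := (x, y))).eventually (e.open_target.mem_nhds hy)
    filter_upwards [h1, h2] with z hz1 hz2
    rw [chartKernel, indicator_of_mem hz2, hz1]
    rfl
  have hloc0 : ∀ᶠ ε in 𝓝[>] (0 : ℝ), ∀ x ∈ Ω, ∀ y ∉ K2, chartKernel o e Φ ε =ᶠ[𝓝 (x, y)]
      fun _ => 0 := by
    filter_upwards [hz] with ε hε x hx y hy
    filter_upwards [(hΩ.prod hK2c.isClosed.isOpen_compl).mem_nhds ⟨hx, hy⟩] with z hz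
    exact hε z.1 hz.1 z.2 hz.2
  refine ⟨⟨?_, fun l => ?_, ⟨C₂ * C₁, by positivity, ?_⟩, ?_⟩, K2, hK2t, hK2c, hK'⟩
  · filter_upwards [hsmall, hloc0] with ε hε h0
    rintro ⟨x, y⟩ ⟨hx, -⟩
    by_cases hy : y ∈ K2
    · refine ContDiffAt.contDiffWithinAt (ContDiffAt.congr_of_eventuallyEq ?_
        (hloc ε x hx y (hK2t hy)))
      exact contDiffAt_const.mul ((hΦ.smooth.contDiffOn_kernelCoeff he hε.1).contDiffAt
        ((e.open_target.prod e.open_target).mem_nhds ⟨hKi (hΩK hx), hK2t hy⟩))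
    · exact (contDiffAt_const.congr_of_eventuallyEq (h0 x hx y hy)).contDiffWithinAt
  · choose X hX using fun j => exists_vField_eq_coordVec i hKM hKMe j
    have hXV : ∀ j, ∀ q ∈ V, X j q = coordVec e q j := fun j q hq =>
      (hX j).self_of_nhdsSet q (hVK hq)
    -- The growth condition with `θ` empty and `ζ` the coordinate fields, reversed to match
    -- `dirDerivs`. The form is evaluated on `n` coordinate vectors of `g`-norm at most `C₄`, hence
    -- the factor `C₄ ^ n` below.
    obtain ⟨ε₂, hε₂, C₃, hC₃, hbd⟩ := hg2 K1 hK1 [] (l.reverse.map X)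
    obtain ⟨C₄, hC₄, hC₄b⟩ := exists_metric_bounds g i hKM hKMe
    refine ⟨C₃ * C₄ ^ n, ?_⟩
    filter_upwards [hsmall, hloc0, Ioc_mem_nhdsGT hε₂] with ε hε h0 hε2 x hx y
    by_cases hy : y ∈ K2
    · rw [(dirDerivs_congr _ (hloc ε x hx y (hK2t hy))).self_of_nhds, dirDerivs_const_mul, abs_mul]
      have h1 := foldr_lieKernel_coordVec hΦ.smooth he hε.1 hV inter_subset_left hXV l.reverse
        (hsymmV (Metric.self_subset_cthickening _ (hΩK hx))) (hsymmV hy)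
      rw [List.reverse_reverse, e.right_inv (hKi (hΩK hx)), e.right_inv (hK2t hy)] at h1
      have h2 := hbd (e.symm x) ⟨x, hΩK hx, rfl⟩ (e.symm y) ε hε.1 hε2.2 (coordVec e (e.symm y))
      simp only [List.foldr_nil, List.length_nil, add_zero] at h2
      rw [h1] at h2
      have h3 : ∏ j, √(g.inner (e.symm y) (coordVec e (e.symm y) j) (coordVec e (e.symm y) j)) ≤
          C₄ ^ n := by
        refine (Finset.prod_le_prod (fun j _ => Real.sqrt_nonneg _) fun j _ =>
          (hC₄b _ (hVK (hsymmV hy))).2 j).trans_eq ?_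
        simp
      have hεn : 0 < (ε ^ n)⁻¹ := inv_pos.2 (pow_pos hε.1.1 n)
      calc _ ≤ 1 * (C₃ * (ε ^ n)⁻¹ * C₄ ^ n) := by
            refine mul_le_mul (abs_chartSign_le _ _ _) (h2.trans ?_) (abs_nonneg _) zero_le_one
            gcongr
        _ = _ := by ring
    · rw [dirDerivs_eq_zero _ (h0 x hx y hy), abs_zero]
      have hεn : 0 < (ε ^ n)⁻¹ := inv_pos.2 (pow_pos hε.1.1 n)
      positivity
  · filter_upwards [hdist] with ε hd x hx y hxy
    by_contra hne
    have hyt : y ∈ e.target := by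
      by_contra hyt
      exact hne (by simp [chartKernel, indicator_of_notMem hyt])
    have h1 : (Φ ε (e.symm x)).1 (e.symm y) ≠ 0 := by
      intro h0
      exact hne (by simp [chartKernel, indicator_of_mem hyt, coeff, h0])
    have := (hd x hx _ h1).2
    rw [e.right_inv hyt] at this
    linarith
  · filter_upwards [hdist, hsmall, hK'] with ε hd hs hK' x hx
    have hball : Metric.ball x R ⊆ e.target :=
      ((Metric.ball_subset_thickening (hΩK hx) R).trans
        (Metric.thickening_subset_cthickening _ _)).trans hRt
    have h1 := hΦ.integral_eq_one ε hs.1 (e.symm x)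
    rw [formIntegral_eq_chartIntegral o he (((Φ ε (e.symm x)).2.1 e he).continuousOn)
      (hK2c.image_of_continuousOn (e.continuousOn_symm.mono hK2t)) ?_ (hK' x hx)] at h1
    · rw [← h1, chartIntegral, ← integral_indicator e.open_target.measurableSet]
      refine integral_congr_ae (Eventually.of_forall fun y => ?_)
      simp only [chartKernel]
      by_cases hyt : y ∈ e.target
      · rw [indicator_of_mem hyt, indicator_of_mem hyt]
        by_cases h0 : (Φ ε (e.symm x)).1 (e.symm y) = 0
        · simp [coeff, h0]
        · have h2 := (hd x hx _ h0).2
          rw [e.right_inv hyt] at h2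
          -- The kernel is nonzero only within `R / 2` of `x`, inside a ball in the chart range,
          -- where the sign at `y` is the sign at `x` built into `chartKernel`.
          rw [chartSign_eq_of_ball_subset o he hball (y := y)]
          rw [Metric.mem_ball']
          linarith
      · rw [indicator_of_notMem hyt, indicator_of_notMem hyt, mul_zero]
    · rintro _ ⟨y, hy, rfl⟩
      exact e.map_target (hK2t hy)

end ChartKernels

/-! ### Sections supported in a chart domain -/

section ChartSections

variable {n : ℕ} {M : Type*} [TopologicalSpace M] [ChartedSpace (EuclideanSpace ℝ (Fin n)) M]
  {a b : ℕ}

local notation "E" => EuclideanSpace ℝ (Fin n)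

variable {e e' : OpenPartialHomeomorph M (EuclideanSpace ℝ (Fin n))}

/-- Continuity of tensor distributions on sections with supports in a fixed compact set. -/
theorem tendsto_apply_of_support (T : TestSections n M a b →L[ℝ] ℝ) {K : Set M} (hK : IsCompact K)
    {ι : Type*} {l : Filter ι} (ξ : ι → TestSections n M a b) (h0 : ∀ t, ∀ q ∉ K, (ξ t).1 q = 0)
    (h : ∀ e ∈ atlas E M, ∀ J I m, ∀ L ⊆ e.target, IsCompact L → ∀ δ > (0 : ℝ),
      ∀ᶠ t in l, ∀ x ∈ L, ‖iteratedFDeriv ℝ m (tensorCoeff e (ξ t).1 J I) x‖ ≤ δ) :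
    Tendsto (fun t => T (ξ t)) l (𝓝 0) := by
  let S := {ξ : TestSections n M a b // ∀ q ∉ K, ξ.1 q = 0}
  let τ : TopologicalSpace S := TopologicalSpace.induced Subtype.val (smoothTopology n M a b)
  -- Every topology in the infimum lies above the coinduced one, hence so does the infimum; thus `T`
  -- is continuous on the sections supported in `K`.
  have hle : TopologicalSpace.coinduced (fun ξ : S => ξ.1) τ ≤ lfTopology n M a b :=
    le_sInf fun t ht => ht.1 K hK
  have hc : @Continuous _ _ τ _ fun ξ : S => T ξ.1 :=
    @Continuous.comp _ _ _ τ _ _ _ _ T.continuous (continuous_iff_coinduced_le.2 hle)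
  let z : S := ⟨0, fun _ _ => rfl⟩
  have h1 : Tendsto (fun t => (⟨ξ t, h0 t⟩ : S)) l (@nhds _ τ z) := by
    rw [@nhds_induced _ _ (smoothTopology n M a b), tendsto_comap_iff]
    simp only [smoothTopology, nhds_iInf, tendsto_iInf, nhds_induced, tendsto_comap_iff,
      UniformOnFun.tendsto_iff_tendstoUniformlyOn]
    intro e he J I m L hL
    have hz : tensorCoeff e (0 : TestSections n M a b).1 J I = fun _ => 0 := rfl
    rw [Metric.tendstoUniformlyOn_iff]
    intro δ hδ
    filter_upwards [h e he J I m L hL.2 hL.1 (δ / 2) (half_pos hδ)] with t ht x hx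
    change dist (iteratedFDeriv ℝ m (tensorCoeff e (0 : TestSections n M a b).1 J I) x)
      (iteratedFDeriv ℝ m (tensorCoeff e (ξ t).1 J I) x) < δ
    rw [hz, show iteratedFDeriv ℝ m (fun _ : E => (0 : ℝ)) x = 0 by simp, dist_zero_left]
    linarith [ht x hx]
  have h2 := (@Continuous.tendsto _ _ τ _ _ hc z).comp h1
  rwa [show T z.1 = 0 from map_zero T] at h2

open Classical in
/-- The section `f(x) ∂_{J} ⊗ dx^{I} ⊗ dx¹ ∧ ⋯ ∧ dxⁿ` on the domain of a chart, extended by zero. -/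
def coordSection (e : OpenPartialHomeomorph M (EuclideanSpace ℝ (Fin n))) (J : Fin a → Fin n)
    (I : Fin b → Fin n) (f : EuclideanSpace ℝ (Fin n) → ℝ) (q : M) : FormTensorAt n a b q :=
  if q ∈ e.source then f (e q) • tensorWith (chartVolume e q)
    (elementary (fun k => coordVec e q (J k)) fun l => coordCovec e q (I l)) else 0

/-- The coefficients of the coordinate section of one chart in another chart. -/
def transitionCoeff (e e' : OpenPartialHomeomorph M (EuclideanSpace ℝ (Fin n)))
    (J J' : Fin a → Fin n) (I I' : Fin b → Fin n) (x : EuclideanSpace ℝ (Fin n)) : ℝ :=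
  ((∏ k, coordCovec e' (e'.symm x) (J' k) (coordVec e (e'.symm x) (J k))) *
    ∏ l, coordCovec e (e'.symm x) (I l) (coordVec e' (e'.symm x) (I' l))) *
    chartVolume e (e'.symm x) (coordVec e' (e'.symm x))

theorem tensorCoeff_coordSection (J J' : Fin a → Fin n) (I I' : Fin b → Fin n) (f : E → ℝ) {x : E}
    (hx : e'.symm x ∈ e.source) :
    tensorCoeff e' (coordSection e J I f) J' I' x =
      f (e (e'.symm x)) * transitionCoeff e e' J J' I I' x := by
  simp only [tensorCoeff, coordSection, if_pos hx, _root_.smul_apply, AlternatingMap.smul_apply,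
    tensorWith_apply, elementary_apply, smul_eq_mul, transitionCoeff]

variable [IsManifold (𝓡 n) ∞ M]

/-- The factors are entries of the Jacobians of the transition map and of its inverse, and a
Jacobian determinant. -/
theorem contDiffOn_transitionCoeff (he : e ∈ atlas E M) (he' : e' ∈ atlas E M)
    (J J' : Fin a → Fin n) (I I' : Fin b → Fin n) :
    ContDiffOn ℝ ∞ (transitionCoeff e e' J J' I I') (e'.target ∩ e'.symm ⁻¹' e.source) := by
  have hA : IsOpen (e'.target ∩ e'.symm ⁻¹' e.source) := isOpen_transition e' e
  have hA' : IsOpen (e.target ∩ e.symm ⁻¹' e'.source) := isOpen_transition e e'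
  have hτ := contDiffOn_transition he' he
  have hmaps : MapsTo (fun x => e (e'.symm x)) (e'.target ∩ e'.symm ⁻¹' e.source)
      (e.target ∩ e.symm ⁻¹' e'.source) := fun x hx =>
    ⟨e.map_source hx.2, by rw [mem_preimage, e.left_inv hx.2]; exact e'.map_target hx.1⟩
  have h1 : ContDiffOn ℝ ∞ (fderiv ℝ fun x => e (e'.symm x)) (e'.target ∩ e'.symm ⁻¹' e.source) :=
    hτ.fderiv_of_isOpen hA (m := ∞) le_rfl
  have h2 : ContDiffOn ℝ ∞ (fun x => fderiv ℝ (fun x => e' (e.symm x)) (e (e'.symm x)))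
      (e'.target ∩ e'.symm ⁻¹' e.source) :=
    ((contDiffOn_transition he he').fderiv_of_isOpen hA' (m := ∞) le_rfl).comp hτ hmaps
  have hdet : ContDiffOn ℝ ∞ (fun x => (fderiv ℝ (fun x => e (e'.symm x)) x).det)
      (e'.target ∩ e'.symm ⁻¹' e.source) := by
    simp only [det_eq_stdDet]
    refine (stdDet n).contDiff.comp_contDiffOn (contDiffOn_pi.2 fun j => ?_)
    exact h1.clm_apply contDiffOn_const
  have hc : ∀ j, ContDiff ℝ ∞ fun v : E => (stdBasis n).coord j v := fun j =>
    ((stdBasis n).coord j).toContinuousLinearMap.contDiff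
  refine ContDiffOn.congr (f := fun x =>
    ((∏ k, (stdBasis n).coord (J' k)
        (fderiv ℝ (fun x => e' (e.symm x)) (e (e'.symm x)) (stdBasis n (J k)))) *
      ∏ l, (stdBasis n).coord (I l) (fderiv ℝ (fun x => e (e'.symm x)) x (stdBasis n (I' l)))) *
      (fderiv ℝ (fun x => e (e'.symm x)) x).det) ?_ fun x hx => ?_
  · refine ((contDiffOn_prod fun k _ => ?_).mul (contDiffOn_prod fun l _ => ?_)).mul hdet
    · exact (hc _).comp_contDiffOn (h2.clm_apply contDiffOn_const)
    · exact (hc _).comp_contDiffOn (h1.clm_apply contDiffOn_const)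
  · have hq' := e'.map_target hx.1
    have hx' := e'.right_inv hx.1
    simp only [transitionCoeff]
    congr 1
    · congr 1
      · refine Finset.prod_congr rfl fun k _ => ?_
        rw [← chartDiff_chartFrame' he he' hx.2 hq']
        rfl
      · refine Finset.prod_congr rfl fun l _ => ?_
        conv_rhs => rw [← hx']
        rw [← chartDiff_chartFrame' he' he hq' hx.2]
        rfl
    · rw [nform_coordVec he' he hq' hx.2, chartVolume_coordVec he hx.2, mul_one, hx']

theorem coordSection_eq_zero {K : Set E} (hK : K ⊆ e.target) (J : Fin a → Fin n)
    (I : Fin b → Fin n) {f : E → ℝ} (hf : ∀ y ∉ K, f y = 0) {q : M} (hq : q ∉ e.symm '' K) :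
    coordSection e J I f q = 0 := by
  rw [coordSection]
  split_ifs with h
  · rw [hf _ fun h' => hq ⟨_, h', e.left_inv h⟩, zero_smul]
  · rfl

theorem isCompact_symm_image {K : Set E} (hK : IsCompact K) (hKe : K ⊆ e.target) :
    IsCompact (e.symm '' K) :=
  hK.image_of_continuousOn (e.continuousOn_symm.mono hKe)

theorem symm_image_subset {K : Set E} (hKe : K ⊆ e.target) : e.symm '' K ⊆ e.source := by
  rintro _ ⟨x, hx, rfl⟩
  exact e.map_target (hKe hx)

/-- `e.symm '' K` is compact, hence closed in the Hausdorff space `M`, so the section vanishes near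
every point outside it; inside, the transition formula gives smoothness. -/
theorem coordSection_mem [T2Space M] (he : e ∈ atlas E M) {K : Set E} (hK : IsCompact K)
    (hKe : K ⊆ e.target) (J : Fin a → Fin n) (I : Fin b → Fin n) (f : testSpace K) :
    coordSection e J I f.1 ∈ TestSections n M a b := by
  refine ⟨fun e' he' J' I' => ?_, _, isCompact_symm_image hK hKe, fun q hq =>
    coordSection_eq_zero hKe J I f.2.2 hq⟩
  intro x hx
  refine ContDiffAt.contDiffWithinAt ?_
  by_cases hq : e'.symm x ∈ e.symm '' K
  · have hA := isOpen_transition e' e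
    have hxA : x ∈ e'.target ∩ e'.symm ⁻¹' e.source := ⟨hx, symm_image_subset hKe hq⟩
    have h1 : ContDiffOn ℝ ∞ (fun x => f.1 (e (e'.symm x)) * transitionCoeff e e' J J' I I' x)
        (e'.target ∩ e'.symm ⁻¹' e.source) :=
      (f.2.1.comp_contDiffOn (contDiffOn_transition he' he)).mul
        (contDiffOn_transitionCoeff he he' J J' I I')
    refine (h1.contDiffAt (hA.mem_nhds hxA)).congr_of_eventuallyEq ?_
    filter_upwards [hA.mem_nhds hxA] with y hy
    exact tensorCoeff_coordSection J J' I I' f.1 hy.2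
  · refine (contDiffAt_const (c := (0 : ℝ))).congr_of_eventuallyEq ?_
    filter_upwards [(e'.continuousAt_symm hx).eventually
      ((isCompact_symm_image hK hKe).isClosed.isOpen_compl.mem_nhds hq)] with y hy
    rw [tensorCoeff, coordSection_eq_zero hKe J I f.2.2 hy]
    rfl

/-- The components of a tensor distribution in a chart, as functionals on test functions. -/
def componentFunctional [T2Space M] (T : TestSections n M a b →L[ℝ] ℝ) (he : e ∈ atlas E M)
    {K : Set (EuclideanSpace ℝ (Fin n))} (hK : IsCompact K) (hKe : K ⊆ e.target)
    (J : Fin a → Fin n) (I : Fin b → Fin n) : testSpace K →ₗ[ℝ] ℝ where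
  toFun f := T ⟨coordSection e J I f.1, coordSection_mem he hK hKe J I f⟩
  map_add' f g := by
    rw [← map_add]
    congr 1
    ext q : 2
    simp only [Submodule.coe_add, Pi.add_apply, coordSection]
    split_ifs
    · rw [add_smul]
    · rw [add_zero]
  map_smul' c f := by
    rw [RingHom.id_apply, ← map_smul]
    congr 1
    ext q : 2
    simp only [Submodule.coe_smul, Pi.smul_apply, coordSection]
    split_ifs
    · rw [smul_assoc]
    · rw [smul_zero]

end ChartSections

/-! ### Components of tensor distributions -/

section Components

variable {n : ℕ} {M : Type*} [TopologicalSpace M] [ChartedSpace (EuclideanSpace ℝ (Fin n)) M]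
  {a b : ℕ}

local notation "E" => EuclideanSpace ℝ (Fin n)

variable {e e' : OpenPartialHomeomorph M (EuclideanSpace ℝ (Fin n))}

theorem NullFamily.eventually_norm_iteratedFDeriv_le {ι : Type*} {l : Filter ι} {f : ι → E → ℝ}
    (h : NullFamily l f) (hf : ∀ t, ContDiff ℝ ∞ (f t)) (m : ℕ) {δ : ℝ} (hδ : 0 < δ) :
    ∀ᶠ t in l, ∀ y, ‖iteratedFDeriv ℝ m (f t) y‖ ≤ δ := by
  obtain ⟨C, hC, hb⟩ := exists_norm_iteratedFDeriv_le (stdBasis n) m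
  have h1 : ∀ᶠ t in l, ∀ j : Fin m → Fin n, ∀ y,
      |dirDerivs ((List.ofFn j).map (stdBasis n)) (f t) y| ≤ δ / (C + 1) :=
    eventually_all.2 fun j => h _ _ (by positivity)
  filter_upwards [h1] with t ht y
  refine (hb (f t) (hf t) y (δ / (C + 1)) fun j => ?_).trans ?_
  · have := ht j y
    rwa [List.map_ofFn] at this
  · rw [mul_div_assoc', div_le_iff₀ (by positivity)]
    nlinarith

/-- The bound is taken at least `1`, so that its positive powers dominate it in the chain rule
estimate. -/
theorem exists_norm_iteratedFDerivWithin_le {F : Type*} [NormedAddCommGroup F] [NormedSpace ℝ F]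
    {h : E → F} {A L : Set E} (hA : IsOpen A) (hh : ContDiffOn ℝ ∞ h A) (hL : IsCompact L)
    (hLA : L ⊆ A) (m : ℕ) :
    ∃ C ≥ (1 : ℝ), ∀ i ≤ m, ∀ x ∈ L, ‖iteratedFDerivWithin ℝ i h A x‖ ≤ C := by
  have h1 : ∀ i : ℕ, ∃ c : ℝ, ∀ x ∈ L, ‖iteratedFDerivWithin ℝ i h A x‖ ≤ c := fun i =>
    hL.exists_bound_of_continuousOn
      ((hh.continuousOn_iteratedFDerivWithin (by exact_mod_cast le_top) hA.uniqueDiffOn).mono hLA)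
  choose c hc using h1
  refine ⟨1 + ∑ i ∈ Finset.range (m + 1), |c i|, ?_, fun i hi x hx => ?_⟩
  · have : 0 ≤ ∑ i ∈ Finset.range (m + 1), |c i| := Finset.sum_nonneg fun _ _ => abs_nonneg _
    linarith
  · have := Finset.single_le_sum (f := fun i => |c i|) (fun _ _ => abs_nonneg _)
      (Finset.mem_range.2 (Nat.lt_succ_of_le hi))
    linarith [hc i x hx, le_abs_self (c i)]

/-- Leibniz rule and the bound for iterated derivatives of a composition; `Q` depends on `τ` and `G`
but not on `f`. -/
theorem exists_norm_iteratedFDerivWithin_comp_mul_le {τ : E → E} {G : E → ℝ} {A L : Set E}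
    (hA : IsOpen A) (hτ : ContDiffOn ℝ ∞ τ A) (hG : ContDiffOn ℝ ∞ G A) (hL : IsCompact L)
    (hLA : L ⊆ A) (m : ℕ) :
    ∃ Q ≥ (0 : ℝ), ∀ f : E → ℝ, ContDiff ℝ ∞ f → ∀ η : ℝ, 0 ≤ η →
      (∀ i ≤ m, ∀ y, ‖iteratedFDeriv ℝ i f y‖ ≤ η) →
      ∀ x ∈ L, ‖iteratedFDerivWithin ℝ m (fun x => f (τ x) * G x) A x‖ ≤ Q * η := by
  obtain ⟨D, hD1, hD⟩ := exists_norm_iteratedFDerivWithin_le hA hτ hL hLA m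
  obtain ⟨B, hB1, hB⟩ := exists_norm_iteratedFDerivWithin_le hA hG hL hLA m
  refine ⟨∑ i ∈ Finset.range (m + 1), (m.choose i : ℝ) * (i.factorial * D ^ i) * B,
    Finset.sum_nonneg fun i _ => by positivity, fun f hf η hη hfη x hx => ?_⟩
  refine (norm_iteratedFDerivWithin_mul_le (hf.comp_contDiffOn hτ) hG hA.uniqueDiffOn (hLA hx)
    (by exact_mod_cast le_top)).trans ?_
  rw [Finset.sum_mul]
  refine Finset.sum_le_sum fun i hi => ?_
  have him : i ≤ m := Nat.lt_succ_iff.1 (Finset.mem_range.1 hi)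
  have h1 : ‖iteratedFDerivWithin ℝ i (f ∘ τ) A x‖ ≤ i.factorial * η * D ^ i := by
    refine norm_iteratedFDerivWithin_comp_le (t := univ) (N := ∞) hf.contDiffOn hτ
      (by exact_mod_cast le_top) uniqueDiffOn_univ hA.uniqueDiffOn (mapsTo_univ _ _) (hLA hx)
      (fun j hj => ?_) fun j hj1 hj => ?_
    · rw [iteratedFDerivWithin_univ]
      exact hfη j (hj.trans him) _
    · exact (hD j (hj.trans him) x hx).trans (le_self_pow₀ hD1 (by omega))
  have h2 := hB (m - i) (Nat.sub_le _ _) x hx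
  calc (m.choose i : ℝ) * ‖iteratedFDerivWithin ℝ i (fun x => f (τ x)) A x‖ *
        ‖iteratedFDerivWithin ℝ (m - i) G A x‖
      ≤ (m.choose i : ℝ) * (i.factorial * η * D ^ i) * B := by gcongr; exact h1
    _ = _ := by ring

variable [IsManifold (𝓡 n) ∞ M] [T2Space M]

/-- The topology on test sections tests every chart, whereas null families are measured in `e`;
`exists_norm_iteratedFDerivWithin_comp_mul_le` transfers the bounds. -/
theorem isTestContinuous_componentFunctional (T : TestSections n M a b →L[ℝ] ℝ)
    (he : e ∈ atlas E M) {K : Set E} (hK : IsCompact K) (hKe : K ⊆ e.target)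
    (J : Fin a → Fin n) (I : Fin b → Fin n) :
    IsTestContinuous (componentFunctional T he hK hKe J I) := by
  intro ι l f hf
  refine tendsto_apply_of_support T (isCompact_symm_image hK hKe) _
    (fun t q hq => coordSection_eq_zero hKe J I (f t).2.2 hq) ?_
  intro e' he' J' I' m L hLe hL δ hδ
  set A := e'.target ∩ e'.symm ⁻¹' e.source
  have hA : IsOpen A := isOpen_transition e' e
  have hKM := isCompact_symm_image hK hKe
  -- `L₁` is compact in the overlap of the charts, so the constants are uniform on it. At the other
  -- points of `L` the section vanishes locally.
  set L₁ := L ∩ e'.symm ⁻¹' (e.symm '' K)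
  have hL₁ : IsCompact L₁ := hL.of_isClosed_subset
    ((e'.continuousOn_symm.mono hLe).preimage_isClosed_of_isClosed hL.isClosed hKM.isClosed)
    inter_subset_left
  have hL₁A : L₁ ⊆ A := fun x hx => ⟨hLe hx.1, symm_image_subset hKe hx.2⟩
  obtain ⟨Q, hQ, hb⟩ := exists_norm_iteratedFDerivWithin_comp_mul_le hA
    (contDiffOn_transition he' he) (contDiffOn_transitionCoeff he he' J J' I I') hL₁ hL₁A m
  have h1 : ∀ᶠ t in l, ∀ i ∈ Finset.range (m + 1), ∀ y,
      ‖iteratedFDeriv ℝ i (f t).1 y‖ ≤ δ / (Q + 1) :=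
    (Filter.eventually_all_finset _).2 fun i _ =>
      hf.eventually_norm_iteratedFDeriv_le (fun t => (f t).2.1) i (by positivity)
  filter_upwards [h1] with t ht x hx
  by_cases hxK : e'.symm x ∈ e.symm '' K
  · have hxA := hL₁A ⟨hx, hxK⟩
    have h2 : tensorCoeff e' (coordSection e J I (f t).1) J' I' =ᶠ[𝓝 x]
        fun x => (f t).1 (e (e'.symm x)) * transitionCoeff e e' J J' I I' x := by
      filter_upwards [hA.mem_nhds hxA] with y hy
      exact tensorCoeff_coordSection J J' I I' _ hy.2
    rw [(h2.iteratedFDeriv ℝ m).self_of_nhds, ← iteratedFDerivWithin_of_isOpen m hA hxA]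
    refine (hb (f t).1 (f t).2.1 (δ / (Q + 1)) (by positivity) (fun i hi y =>
      ht i (Finset.mem_range.2 (Nat.lt_succ_of_le hi)) y) x ⟨hx, hxK⟩).trans ?_
    rw [mul_div_assoc', div_le_iff₀ (by positivity)]
    nlinarith
  · have h2 : tensorCoeff e' (coordSection e J I (f t).1) J' I' =ᶠ[𝓝 x] fun _ => 0 := by
      filter_upwards [(e'.continuousAt_symm (hLe hx)).eventually
        (hKM.isClosed.isOpen_compl.mem_nhds hxK)] with y hy
      rw [tensorCoeff, coordSection_eq_zero hKe J I (f t).2.2 hy]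
      rfl
    rw [(h2.iteratedFDeriv ℝ m).self_of_nhds, show iteratedFDeriv ℝ m (fun _ : E => (0 : ℝ)) x = 0
      by simp, norm_zero]
    exact hδ.le

/-- The scalar tensor obtained from `u ∈ T^a_b ⊗ Λⁿ` by evaluating the form on the coordinate frame. -/
def scalarPart (e : OpenPartialHomeomorph M (EuclideanSpace ℝ (Fin n))) {q : M}
    (u : FormTensorAt n a b q) : TensorAt n a b q :=
  (LinearMap.compMultilinearMapₗ ℝ
    ({ toFun := fun η => η (coordVec e q)
       map_add' := fun _ _ => rfl
       map_smul' := fun _ _ => rfl } : NForm n q →ₗ[ℝ] ℝ)).compMultilinearMap u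

theorem scalarPart_apply {q : M} (u : FormTensorAt n a b q)
    (β : Fin a → Module.Dual ℝ (TangentSpace (𝓡 n) q)) (v : Fin b → TangentSpace (𝓡 n) q) :
    scalarPart e u β v = u β v (coordVec e q) := rfl

theorem tensorWith_scalarPart (he : e ∈ atlas E M) {q : M} (hq : q ∈ e.source)
    (u : FormTensorAt n a b q) : tensorWith (chartVolume e q) (scalarPart e u) = u := by
  ext β v : 2
  rw [tensorWith_apply, scalarPart_apply]
  exact (nform_eq_smul_chartVolume he hq _).symm

/-- Expansion of a section in coordinate sections. -/
theorem sum_coordSection (he : e ∈ atlas E M) (ξ : ∀ q : M, FormTensorAt n a b q)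
    (h0 : ∀ q ∉ e.source, ξ q = 0) (q : M) :
    ξ q = ∑ J : Fin a → Fin n, ∑ I : Fin b → Fin n,
      coordSection e J I (e.target.indicator (tensorCoeff e ξ J I)) q := by
  by_cases hq : q ∈ e.source
  · conv_lhs => rw [← tensorWith_scalarPart he hq (ξ q), sum_elementary (chartBasis he hq)
      (scalarPart e (ξ q))]
    simp only [map_sum, map_smul]
    refine Finset.sum_congr rfl fun J _ => Finset.sum_congr rfl fun I _ => ?_
    rw [coordSection, if_pos hq, indicator_of_mem (e.map_source hq), tensorCoeff, e.left_inv hq]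
    rfl
  · rw [h0 q hq]
    symm
    refine Finset.sum_eq_zero fun J _ => Finset.sum_eq_zero fun I _ => ?_
    rw [coordSection, if_neg hq]

/-- The coefficients of a section supported in a chart domain, as test functions. -/
def coeffTest {K : Set (EuclideanSpace ℝ (Fin n))} (he : e ∈ atlas E M) (hK : IsCompact K)
    (hKe : K ⊆ e.target) (ξ : TestSections n M a b) (h0 : ∀ q ∉ e.symm '' K, ξ.1 q = 0)
    (J : Fin a → Fin n) (I : Fin b → Fin n) : testSpace K :=
  ⟨e.target.indicator (tensorCoeff e ξ.1 J I), by
    have h1 : ∀ x ∈ e.target, x ∉ K → tensorCoeff e ξ.1 J I x = 0 := fun x hx hxK => by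
      rw [tensorCoeff, h0 _ ?_]
      · rfl
      · rintro ⟨y, hy, hyx⟩
        exact hxK (e.symm.injOn (hKe hy) hx hyx ▸ hy)
    refine ⟨contDiff_indicator e.open_target hK.isClosed hKe (ξ.2.1 e he J I) h1, fun y hy => ?_⟩
    by_cases hyt : y ∈ e.target
    · rw [indicator_of_mem hyt, h1 y hyt hy]
    · rw [indicator_of_notMem hyt]⟩

/-- A distribution is determined by its components. -/
theorem apply_eq_sum_componentFunctional (T : TestSections n M a b →L[ℝ] ℝ) (he : e ∈ atlas E M)
    {K : Set E} (hK : IsCompact K) (hKe : K ⊆ e.target) (ξ : TestSections n M a b)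
    (h0 : ∀ q ∉ e.symm '' K, ξ.1 q = 0) :
    T ξ = ∑ J : Fin a → Fin n, ∑ I : Fin b → Fin n,
      componentFunctional T he hK hKe J I (coeffTest he hK hKe ξ h0 J I) := by
  have h1 : ξ = ∑ J : Fin a → Fin n, ∑ I : Fin b → Fin n,
      (⟨_, coordSection_mem he hK hKe J I (coeffTest he hK hKe ξ h0 J I)⟩ :
        TestSections n M a b) := by
    ext q : 2
    simp only [AddSubmonoidClass.coe_finsetSum, Finset.sum_apply]
    exact sum_coordSection he ξ.1 (fun q hq => h0 q fun h => hq (symm_image_subset hKe h)) q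
  conv_lhs => rw [h1]
  simp only [map_sum]
  rfl

/-- The product of a smooth function and a test section. -/
def smulSection (ρ : C^∞⟮𝓡 n, M; 𝓘(ℝ, ℝ), ℝ⟯) (ξ : TestSections n M a b) : TestSections n M a b :=
  ⟨fun q => ρ q • ξ.1 q, fun e he J I =>
    ((ρ.contMDiff.comp_contMDiffOn (contMDiffOn_symm_of_mem_maximalAtlas
      (IsManifold.subset_maximalAtlas (I := 𝓡 n) (n := ∞) he))).contDiffOn).mul (ξ.2.1 e he J I), by
    obtain ⟨K, hK, h0⟩ := ξ.2.2
    exact ⟨K, hK, fun q hq => by simp only [h0 q hq, smul_zero]⟩⟩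

theorem tensorCoeff_smulSection (ρ : C^∞⟮𝓡 n, M; 𝓘(ℝ, ℝ), ℝ⟯) (ξ : TestSections n M a b)
    (J : Fin a → Fin n) (I : Fin b → Fin n) (x : E) :
    tensorCoeff e (smulSection ρ ξ).1 J I x = ρ (e.symm x) * tensorCoeff e ξ.1 J I x := rfl

/-- Decomposition of a section with a partition of unity. -/
theorem sum_smulSection {κ : Type*} (ρ : SmoothPartitionOfUnity κ (𝓡 n) M univ)
    (s : Finset κ) (ξ : TestSections n M a b)
    (hs : ∀ i ∉ s, ∀ q, ξ.1 q ≠ 0 → ρ i q = 0) : ∑ i ∈ s, smulSection (ρ i) ξ = ξ := by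
  ext q : 2
  simp only [AddSubmonoidClass.coe_finsetSum, Finset.sum_apply]
  change ∑ i ∈ s, ρ i q • ξ.1 q = ξ.1 q
  rw [← Finset.sum_smul]
  by_cases hq : ξ.1 q = 0
  · rw [hq, smul_zero]
  · have h := ρ.sum_eq_one (mem_univ q)
    rw [finsum_eq_sum_of_support_subset (s := s)] at h
    · rw [h, one_smul]
    · intro i hi
      by_contra his
      exact hi (hs i his q hq)

end Components

/-! ### Smoothness of the regularization -/

section Smoothness

/-- Expresses independence of the basis: components in any coordinate frame are values of `L`,
although `embed` is built with `tangentBasis`. -/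
theorem ofFunctional_apply {a b : ℕ} {V ι : Type*} [AddCommGroup V] [Module ℝ V] [Fintype ι]
    [DecidableEq ι] (B : Module.Basis ι ℝ V) (L : MixedTensor b a V ℝ →ₗ[ℝ] ℝ)
    (β : Fin a → Module.Dual ℝ V) (v : Fin b → V) :
    ofFunctional B L β v = L (elementary v β) := by
  conv_rhs => rw [sum_elementary B (elementary v β)]
  simp only [map_sum, map_smul, elementary_apply, ofFunctional, _root_.sum_apply, _root_.smul_apply,
    smul_eq_mul]
  rw [Finset.sum_comm]
  refine Finset.sum_congr rfl fun J _ => Finset.sum_congr rfl fun I _ => ?_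
  ring

variable {n : ℕ} {M : Type*} [TopologicalSpace M] [ChartedSpace (EuclideanSpace ℝ (Fin n)) M]
  {a b : ℕ}

local notation "E" => EuclideanSpace ℝ (Fin n)

variable {e e' : OpenPartialHomeomorph M (EuclideanSpace ℝ (Fin n))}

/-- The matrix coefficients of the action of a transport operator on tensors. -/
def transportCoeff (A : TransportOperator n M)
    (e e' : OpenPartialHomeomorph M (EuclideanSpace ℝ (Fin n))) (J J' : Fin a → Fin n)
    (I I' : Fin b → Fin n) (z : EuclideanSpace ℝ (Fin n) × EuclideanSpace ℝ (Fin n)) : ℝ :=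
  (∏ k, coordCovec e' (e'.symm z.2) (J' k)
    (A.map (e.symm z.1) (e'.symm z.2) (coordVec e (e.symm z.1) (J k)))) *
  ∏ l, coordCovec e (e.symm z.1) (I l)
    (A.map (e'.symm z.2) (e.symm z.1) (coordVec e' (e'.symm z.2) (I' l)))

theorem contDiffOn_transportCoeff (A : TransportOperator n M) (he : e ∈ atlas E M)
    (he' : e' ∈ atlas E M) (J J' : Fin a → Fin n) (I I' : Fin b → Fin n) :
    ContDiffOn ℝ ∞ (transportCoeff A e e' J J' I I') (e.target ×ˢ e'.target) := by
  refine (contDiffOn_prod fun k _ => A.smooth e he e' he' _ _).mul (contDiffOn_prod fun l _ => ?_)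
  exact (A.smooth e' he' e he (I' l) (I l)).comp (f := Prod.swap)
    (contDiff_snd.prodMk contDiff_fst).contDiffOn fun z hz => ⟨hz.2, hz.1⟩

variable [IsManifold (𝓡 n) ∞ M]

/-- Expanding `v` in the coordinate frame at `x` separates its components from smooth functions of
`(x, y)`. -/
theorem tensorCoeff_transportedSection (A : TransportOperator n M) (he : e ∈ atlas E M) {x : E}
    (hx : x ∈ e.target) (η : CompactForms n M) (v : TensorAt n a b (e.symm x)) (J' : Fin a → Fin n)
    (I' : Fin b → Fin n) (y : E) :
    tensorCoeff e' (transportedSection A (e.symm x) η v).1 J' I' y =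
      (∑ J : Fin a → Fin n, ∑ I : Fin b → Fin n,
        v (fun k => coordCovec e (e.symm x) (J k)) (fun l => coordVec e (e.symm x) (I l)) *
          transportCoeff A e e' J J' I I' (x, y)) * coeff e' η.1 y := by
  have h1 : tensorCoeff e' (transportedSection A (e.symm x) η v).1 J' I' y =
      v (fun k => (coordCovec e' (e'.symm y) (J' k)).comp (A.map (e.symm x) (e'.symm y)))
        (fun l => A.map (e'.symm y) (e.symm x) (coordVec e' (e'.symm y) (I' l))) *
        coeff e' η.1 y := rfl
  rw [h1]
  congr 1
  conv_lhs => rw [sum_elementary (chartBasis he (e.map_target hx)) v]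
  simp only [_root_.sum_apply, _root_.smul_apply, elementary_apply, smul_eq_mul]
  rfl

theorem transportedSection_eq_zero (A : TransportOperator n M) (p : M) {η : CompactForms n M}
    (v : TensorAt n a b p) {q : M} (hq : η.1 q = 0) : (transportedSection A p η v).1 q = 0 := by
  change tensorWith (η.1 q) _ = 0
  rw [hq]
  ext
  simp [tensorWith_apply]

variable [T2Space M]

/-- A distribution applied to a family of sections with support in a fixed compact subset of a chart
domain depends smoothly on the parameter if the family does. -/
theorem contDiffOn_apply_of_chart (T : TestSections n M a b →L[ℝ] ℝ) (he : e ∈ atlas E M)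
    {K Ω : Set E} (hK : IsCompact K) (hKe : K ⊆ e.target) (hΩ : IsOpen Ω)
    (ξ : E → TestSections n M a b) (h0 : ∀ x ∈ Ω, ∀ q ∉ e.symm '' K, (ξ x).1 q = 0)
    (hξ : ∀ J I, ContDiffOn ℝ ∞ (fun z : E × E => tensorCoeff e (ξ z.1).1 J I z.2)
      (Ω ×ˢ e.target)) :
    ContDiffOn ℝ ∞ (fun x => T (ξ x)) Ω := by
  intro x₀ hx₀
  refine ContDiffAt.contDiffWithinAt ?_
  obtain ⟨r, hr, hrΩ⟩ := Metric.nhds_basis_closedBall.mem_iff.1 (hΩ.mem_nhds hx₀)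
  -- Multiplication by `χ` makes the family smooth in a global parameter and leaves it unchanged
  -- near `x₀`.
  let χ : ContDiffBump x₀ := ⟨r / 2, r, half_pos hr, half_lt_self hr⟩
  have hχ0 : ∀ x ∉ Metric.closedBall x₀ r, χ x = 0 := fun x hx =>
    χ.zero_of_le_dist (by rw [Metric.mem_closedBall, not_le] at hx; exact hx.le)
  have hcz : ∀ x ∈ Ω, ∀ J I, ∀ y ∈ e.target, y ∉ K → tensorCoeff e (ξ x).1 J I y = 0 := by
    intro x hx J I y hy hyK
    rw [tensorCoeff, h0 x hx _ ?_]
    · rfl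
    · rintro ⟨y', hy', hyy⟩
      exact hyK (e.symm.injOn (hKe hy') hy hyy ▸ hy')
  let F : (Fin a → Fin n) → (Fin b → Fin n) → E × E → ℝ := fun J I =>
    (Ω ×ˢ e.target).indicator fun z => χ z.1 * tensorCoeff e (ξ z.1).1 J I z.2
  have hF : ∀ J I, ContDiff ℝ ∞ (F J I) := fun J I => by
    refine contDiff_indicator (hΩ.prod e.open_target)
      (Metric.isClosed_closedBall.prod hK.isClosed) (Set.prod_mono hrΩ hKe)
      ((χ.contDiff.comp contDiff_fst).contDiffOn.mul (hξ J I)) fun z hz hzK => ?_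
    by_cases h1 : z.1 ∈ Metric.closedBall x₀ r
    · simp only [hcz z.1 hz.1 J I z.2 hz.2 fun h2 => hzK ⟨h1, h2⟩, mul_zero]
    · simp only [hχ0 _ h1, zero_mul]
  have hF0 : ∀ J I x, ∀ y ∉ K, F J I (x, y) = 0 := fun J I x y hy => by
    simp only [F]
    by_cases hz : (x, y) ∈ Ω ×ˢ e.target
    · rw [indicator_of_mem hz]
      simp only [hcz x hz.1 J I y hz.2 hy, mul_zero]
    · rw [indicator_of_notMem hz]
  have key : (fun x => T (ξ x)) =ᶠ[𝓝 x₀] fun x => ∑ J : Fin a → Fin n, ∑ I : Fin b → Fin n,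
      componentFunctional T he hK hKe J I (slice (F J I) (hF J I) (hF0 J I) x) := by
    filter_upwards [hΩ.mem_nhds hx₀, χ.eventuallyEq_one] with x hx hx1
    rw [apply_eq_sum_componentFunctional T he hK hKe (ξ x) (h0 x hx)]
    refine Finset.sum_congr rfl fun J _ => Finset.sum_congr rfl fun I _ => congrArg _ ?_
    ext y
    change e.target.indicator _ y = F J I (x, y)
    by_cases hy : y ∈ e.target
    · have hz : (x, y) ∈ Ω ×ˢ e.target := ⟨hx, hy⟩
      simp only [F]
      rw [indicator_of_mem hy, indicator_of_mem hz]
      simp [hx1]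
    · have hz : (x, y) ∉ Ω ×ˢ e.target := fun h => hy h.2
      simp only [F]
      rw [indicator_of_notMem hy, indicator_of_notMem hz]
  refine ContDiffAt.congr_of_eventuallyEq ?_ key
  exact (ContDiff.sum fun J _ => ContDiff.sum fun I _ =>
    (isTestContinuous_componentFunctional T he hK hKe J I).contDiff_slice hK (hF J I)
      (hF0 J I)).contDiffAt

/-- A distribution applied to a family of sections with support in a fixed compact set depends
smoothly on the parameter if the family does. -/
theorem contDiffOn_apply [SecondCountableTopology M] (T : TestSections n M a b →L[ℝ] ℝ) {L : Set M}
    (hL : IsCompact L) {Ω : Set E} (hΩ : IsOpen Ω) (ξ : E → TestSections n M a b)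
    (h0 : ∀ x ∈ Ω, ∀ q ∉ L, (ξ x).1 q = 0)
    (hξ : ∀ e ∈ atlas E M, ∀ J I, ContDiffOn ℝ ∞
      (fun z : E × E => tensorCoeff e (ξ z.1).1 J I z.2) (Ω ×ˢ e.target)) :
    ContDiffOn ℝ ∞ (fun x => T (ξ x)) Ω := by
  have : LocallyCompactSpace M := Manifold.locallyCompact_of_finiteDimensional (𝓡 n)
  set ρ := chartPartition n M
  have hρs : ∀ i, tsupport (ρ i) ⊆ (chartAt E i).source :=
    (SmoothPartitionOfUnity.exists_isSubordinate_chartAt_source (𝓡 n) M).choose_spec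
  have hfin : {i | (Function.support (ρ i) ∩ L).Nonempty}.Finite :=
    ρ.locallyFinite.finite_nonempty_inter_compact hL
  have hsum : ∀ x ∈ Ω, T (ξ x) = ∑ i ∈ hfin.toFinset, T (smulSection (ρ i) (ξ x)) := by
    intro x hx
    rw [← map_sum, sum_smulSection ρ]
    intro i hi q hq
    by_contra hne
    exact hi (hfin.mem_toFinset.2 ⟨q, hne, by_contra fun hqL => hq (h0 x hx q hqL)⟩)
  refine ContDiffOn.congr (ContDiffOn.sum fun i _ => ?_) hsum
  set e := chartAt E i
  have he : e ∈ atlas E M := chart_mem_atlas E i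
  have hLi : IsCompact (L ∩ tsupport (ρ i)) := hL.inter_right (isClosed_tsupport _)
  have hLe : L ∩ tsupport (ρ i) ⊆ e.source := inter_subset_right.trans (hρs i)
  have hKt : e '' (L ∩ tsupport (ρ i)) ⊆ e.target := by
    rintro _ ⟨q, hq, rfl⟩
    exact e.map_source (hLe hq)
  refine contDiffOn_apply_of_chart T he (hLi.image_of_continuousOn (e.continuousOn.mono hLe)) hKt hΩ
    _ (fun x hx q hq => ?_) fun J I => ?_
  · change ρ i q • (ξ x).1 q = 0
    by_cases hqL : q ∈ L
    · have : q ∉ tsupport (ρ i) := fun h => hq ⟨e q, ⟨q, ⟨hqL, h⟩, rfl⟩, e.left_inv (hLe ⟨hqL, h⟩)⟩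
      rw [image_eq_zero_of_notMem_tsupport this, zero_smul]
    · rw [h0 x hx q hqL, smul_zero]
  · simp only [tensorCoeff_smulSection]
    refine ContDiffOn.mul ?_ (hξ e he J I)
    exact ((((ρ i).contMDiff.comp_contMDiffOn (contMDiffOn_symm_of_mem_maximalAtlas
      (IsManifold.subset_maximalAtlas (I := 𝓡 n) (n := ∞) he))).contDiffOn).comp
      contDiff_snd.contDiffOn fun z hz => hz.2)

/-- By `ofFunctional_apply` each component is `T` applied to a transported coordinate tensor times
the kernel. The support condition in `IsSmoothKernel` confines these sections to one compact set
near each point, and `contDiffOn_apply` concludes. -/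
theorem IsSmoothKernel.isSmoothTensor_regularization [SecondCountableTopology M]
    {Φ : ℝ → M → CompactForms n M} (hΦ : IsSmoothKernel Φ) (A : TransportOperator n M) {r s : ℕ}
    (T : TensorDistribution n M r s) {ε : ℝ} (hε : ε ∈ Ioc (0 : ℝ) 1) :
    IsSmoothTensor (regularization A T Φ ε) := by
  intro e he J₀ I₀ x₀ hx₀
  refine ContDiffAt.contDiffWithinAt ?_
  obtain ⟨L, hL, hsupp⟩ := hΦ.support ε hε (e.symm x₀)
  have h1 : Tendsto (fun x => (ε, e.symm x)) (𝓝 x₀) (𝓝[Ioc (0 : ℝ) 1 ×ˢ univ] (ε, e.symm x₀)) :=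
    tendsto_nhdsWithin_iff.2 ⟨tendsto_const_nhds.prodMk_nhds (e.continuousAt_symm hx₀),
      Eventually.of_forall fun x => ⟨hε, mem_univ _⟩⟩
  obtain ⟨Ω, hΩs, hΩ, hxΩ⟩ := mem_nhds_iff.1
    ((h1.eventually hsupp).and (e.open_target.mem_nhds hx₀))
  have h2 : ∀ x, regularization A T Φ ε (e.symm x) (fun k => coordCovec e (e.symm x) (J₀ k))
      (fun l => coordVec e (e.symm x) (I₀ l)) =
      T (transportedSection A (e.symm x) (Φ ε (e.symm x)) (elementary
        (fun l => coordVec e (e.symm x) (I₀ l)) fun k => coordCovec e (e.symm x) (J₀ k))) :=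
    fun x => ofFunctional_apply _ _ _ _
  simp only [h2]
  refine (contDiffOn_apply T hL hΩ _ (fun x hx q hq => ?_) fun e' he' J' I' => ?_).contDiffAt
    (hΩ.mem_nhds hxΩ)
  · refine transportedSection_eq_zero A _ _ ?_
    by_contra hne
    exact hq ((hΩs hx).1 (subset_closure hne))
  -- In its own frame the elementary tensor has Kronecker deltas as components, so the dependence on
  -- the point sits in `transportCoeff` and in the kernel.
  · refine ContDiffOn.congr (f := fun z : E × E => (∑ J : Fin s → Fin n, ∑ I : Fin r → Fin n,
        ((∏ k, if I₀ k = J k then (1 : ℝ) else 0) * ∏ l, if I l = J₀ l then (1 : ℝ) else 0) *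
          transportCoeff A e e' J J' I I' z) * coeff e' (Φ ε (e.symm z.1)).1 z.2) ?_ fun z hz => ?_
    · have hsub : Ω ×ˢ e'.target ⊆ e.target ×ˢ e'.target :=
        Set.prod_mono (fun x hx => (hΩs hx).2) le_rfl
      refine ContDiffOn.mul (ContDiffOn.sum fun J _ => ContDiffOn.sum fun I _ =>
        contDiffOn_const.mul ((contDiffOn_transportCoeff A he he' J J' I I').mono hsub)) ?_
      exact (hΦ.smooth e he e' he').comp (f := fun z : E × E => (ε, z))
        (contDiffOn_const.prodMk contDiffOn_id) fun z hz => ⟨hε, hsub hz⟩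
    · have hzt : z.1 ∈ e.target := (hΩs hz.1).2
      rw [tensorCoeff_transportedSection A he hzt]
      simp only [elementary_apply, coordCovec_coordVec he (e.map_target hzt)]

end Smoothness

/-! ### Convergence of the regularization -/

section Convergence

variable {n : ℕ} {M : Type*} [TopologicalSpace M] [ChartedSpace (EuclideanSpace ℝ (Fin n)) M]
  [IsManifold (𝓡 n) ∞ M] {a b : ℕ}

local notation "E" => EuclideanSpace ℝ (Fin n)

variable {e e' : OpenPartialHomeomorph M (EuclideanSpace ℝ (Fin n))}

theorem christoffel_zero_left (cov : Connection n M)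
    (e : OpenPartialHomeomorph M (EuclideanSpace ℝ (Fin n))) (q : M) (w : E) :
    christoffel cov e q 0 w = 0 := by
  simp [christoffel]

/-- An associated transport operator is the identity on the diagonal. -/
theorem TransportOperator.IsAssociated.map_self {A : TransportOperator n M} {cov : Connection n M}
    (hA : A.IsAssociated cov) (p : M) (w : TangentSpace (𝓡 n) p) : A.map p p w = w := by
  obtain ⟨U, -, hpU, -, h⟩ := hA p
  have hv : ∀ (e : OpenPartialHomeomorph M E) (t : ℝ), velocity e (fun _ => p) t = 0 := fun e t => by
    simp [velocity]
  -- The constant curve is a geodesic in `U` and a constant vector is parallel along it, as the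
  -- Christoffel terms vanish with the velocity.
  refine h (fun _ => p) ⟨contMDiffOn_const, fun t _ e _ _ => ?_⟩ (fun _ _ => hpU) (fun _ => w)
    fun t _ e _ _ => ?_
  · simp only [funext (hv e), christoffel_zero_left, neg_zero]
    simp
  · simp only [hv, christoffel_zero_left, neg_zero]
    exact hasDerivWithinAt_const _ _ _

theorem transportCoeff_self {A : TransportOperator n M} {cov : Connection n M}
    (hA : A.IsAssociated cov) (he : e ∈ atlas E M) (J J' : Fin a → Fin n) (I I' : Fin b → Fin n)
    {x : E} (hx : x ∈ e.target) :
    transportCoeff A e e J J' I I' (x, x) = if J = J' ∧ I = I' then 1 else 0 := by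
  simp only [transportCoeff, hA.map_self, coordCovec_coordVec he (e.map_target hx)]
  by_cases hJ : J = J'
  · by_cases hI : I = I'
    · simp [hI, hJ]
    · obtain ⟨l, hl⟩ := Function.ne_iff.1 hI
      rw [if_neg (fun h => hI h.2), Finset.prod_eq_zero (i := l)
        (f := fun l => if I' l = I l then (1 : ℝ) else 0) (Finset.mem_univ _)
        (if_neg (Ne.symm hl)), mul_zero]
  · obtain ⟨k, hk⟩ := Function.ne_iff.1 hJ
    rw [if_neg (fun h => hJ h.1), Finset.prod_eq_zero (i := k)
      (f := fun k => if J k = J' k then (1 : ℝ) else 0) (Finset.mem_univ _) (if_neg hk), zero_mul]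

/-- Evaluation of the form on the frame commutes with the contraction, so `contract_embed` applies
to the scalar part. -/
theorem coeff_contract_embed {r s : ℕ} (A : TransportOperator n M) (T : TensorDistribution n M r s)
    (Φ : ℝ → M → CompactForms n M) (ε : ℝ) (ζ : ∀ q : M, FormTensorAt n s r q) (x : E) :
    coeff e (fun q => contract (tangentBasis q) (regularization A T Φ ε q) (ζ q)) x =
      T (transportedSection A (e.symm x) (Φ ε (e.symm x)) (scalarPart e (ζ (e.symm x)))) := by
  rw [← contract_embed]
  let φ : NForm n (e.symm x) →ₗ[ℝ] ℝ :=
    { toFun := fun η => η (coordVec e (e.symm x))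
      map_add' := fun _ _ => rfl
      map_smul' := fun _ _ => rfl }
  change φ (contract _ _ _) = _
  simp only [contract, map_sum, map_smul]
  rfl

theorem exists_contDiff_cutoff {K U : Set E} (hK : IsCompact K) (hU : IsOpen U) (hKU : K ⊆ U) :
    ∃ (χ : E → ℝ) (L : Set E), ContDiff ℝ ∞ χ ∧ IsCompact L ∧ L ⊆ U ∧ (∀ x ∈ K, χ x = 1) ∧
      ∀ x ∉ L, χ x = 0 := by
  obtain ⟨L, hL, hKL, hLU⟩ := exists_compact_between hK hU hKU
  obtain ⟨f, hf1, hf0, -⟩ := exists_contMDiffMap_one_nhds_of_subset_interior (n := (⊤ : ℕ∞))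
    𝓘(ℝ, E) hK.isClosed hKL
  exact ⟨f, L, f.contMDiff.contDiff, hL, hLU, fun x hx => hf1.self_of_nhdsSet x hx, hf0⟩

variable [T2Space M] [SecondCountableTopology M]

/-- Convergence of the regularizations on sections supported in a chart domain. -/
theorem IsSmoothingKernel.tendsto_chartIntegral {o : ManifoldOrientation n M}
    {Φ : ℝ → M → CompactForms n M} (hΦ : IsSmoothingKernel o Φ) {A : TransportOperator n M}
    {cov : Connection n M} (hA : A.IsAssociated cov) {r s : ℕ} (T : TensorDistribution n M r s)
    (i : M) {K : Set E} (hK : IsCompact K) (hKi : K ⊆ (chartAt E i).target)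
    (ζ : TestSections n M s r) (hζ : ∀ q ∉ (chartAt E i).symm '' K, ζ.1 q = 0) :
    Tendsto (fun ε => chartIntegral o (chartAt E i)
      fun q => contract (tangentBasis q) (regularization A T Φ ε q) (ζ.1 q)) (𝓝[>] 0) (𝓝 (T ζ)) := by
  set e := chartAt E i
  have he : e ∈ atlas E M := chart_mem_atlas E i
  obtain ⟨K₂, hK₂, hKK₂, hK₂e⟩ := exists_compact_between hK e.open_target hKi
  set Ω := interior K₂
  have hΩ : IsOpen Ω := isOpen_interior
  obtain ⟨hφ, K', hK'e, hK', hsupp⟩ := hΦ.isKernelFamily i hΩ hK₂ interior_subset hK₂e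
  set φ := chartKernel o e Φ
  -- `χ` is one on `K'`, which carries the kernels, and on `K`, which carries `ζ`. It gives the
  -- coefficients compact support in `y` without affecting the regularizations or the limit.
  obtain ⟨χ, L, hχ, hL, hLe, hχ1, hχ0⟩ := exists_contDiff_cutoff (hK'.union hK) e.open_target
    (union_subset hK'e hKi)
  have hKL : K ⊆ L := fun x hx => by
    by_contra h
    exact one_ne_zero ((hχ1 x (Or.inr hx)).symm.trans (hχ0 x h))
  have hK'L : K' ⊆ L := fun x hx => by
    by_contra h
    exact one_ne_zero ((hχ1 x (Or.inl hx)).symm.trans (hχ0 x h))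
  have hζL : ∀ q ∉ e.symm '' L, ζ.1 q = 0 := fun q hq => hζ q fun h => hq (image_mono hKL h)
  have hc0 : ∀ J I, ∀ x ∈ e.target, x ∉ K → tensorCoeff e ζ.1 J I x = 0 := by
    intro J I x hx hxK
    rw [tensorCoeff, hζ _ ?_]
    · rfl
    · rintro ⟨y, hy, hyx⟩
      exact hxK (e.symm.injOn (hKi hy) hx hyx ▸ hy)
  -- The components at `y` of `A(x, y)` applied to the scalar part of `ζ` at `x`.
  set a₀ : (Fin s → Fin n) → (Fin r → Fin n) → E × E → ℝ := fun J' I' z =>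
    ∑ J : Fin s → Fin n, ∑ I : Fin r → Fin n,
      tensorCoeff e ζ.1 J I z.1 * transportCoeff A e e J J' I I' z with ha₀
  set a : (Fin s → Fin n) → (Fin r → Fin n) → E × E → ℝ := fun J I =>
    (e.target ×ˢ e.target).indicator fun z => χ z.2 * a₀ J I z with ha
  have ha₀s : ∀ J I, ContDiffOn ℝ ∞ (a₀ J I) (e.target ×ˢ e.target) := fun J' I' =>
    ContDiffOn.sum fun J _ => ContDiffOn.sum fun I _ =>
      ((ζ.2.1 e he J I).comp contDiff_fst.contDiffOn fun z hz => hz.1).mul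
        (contDiffOn_transportCoeff A he he J J' I I')
  have ha₀0 : ∀ J I, ∀ z ∈ e.target ×ˢ e.target, z.1 ∉ K → a₀ J I z = 0 := fun J' I' z hz hzK =>
    Finset.sum_eq_zero fun J _ => Finset.sum_eq_zero fun I _ => by
      rw [hc0 J I z.1 hz.1 hzK, zero_mul]
  have has : ∀ J I, ContDiff ℝ ∞ (a J I) := fun J I => by
    refine contDiff_indicator (e.open_target.prod e.open_target) (hK.isClosed.prod hL.isClosed)
      (Set.prod_mono hKi hLe) ((hχ.comp contDiff_snd).contDiffOn.mul (ha₀s J I)) fun z hz hzK => ?_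
    by_cases h1 : z.1 ∈ K
    · simp only [hχ0 z.2 fun h2 => hzK ⟨h1, h2⟩, zero_mul]
    · simp only [ha₀0 J I z hz h1, mul_zero]
  have ha0 : ∀ J I, ∀ x ∉ K, ∀ y, a J I (x, y) = 0 := fun J I x hx y => by
    by_cases hz : (x, y) ∈ e.target ×ˢ e.target
    · simp only [ha, indicator_of_mem hz, ha₀0 J I _ hz hx, mul_zero]
    · simp only [ha, indicator_of_notMem hz]
  have ha0' : ∀ J I, ∀ x, ∀ y ∉ L, a J I (x, y) = 0 := fun J I x y hy => by
    by_cases hz : (x, y) ∈ e.target ×ˢ e.target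
    · simp only [ha, indicator_of_mem hz, hχ0 y hy, zero_mul]
    · simp only [ha, indicator_of_notMem hz]
  set S := componentFunctional T he hL hLe
  have hS : ∀ J I, IsTestContinuous (S J I) :=
    isTestContinuous_componentFunctional T he hL hLe
  have hFs : ∀ {ε}, ContDiffOn ℝ ∞ (φ ε) (Ω ×ˢ univ) → ∀ J I,
      ContDiff ℝ ∞ fun z => a J I z * φ ε z := fun h J I =>
    contDiff_mul_of_support hΩ hK hKK₂ (has J I) (ha0 J I) h
  have hF0 : ∀ ε J I, ∀ x ∉ K, ∀ y, a J I (x, y) * φ ε (x, y) = 0 := fun ε J I x hx y => by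
    rw [ha0 J I x hx y, zero_mul]
  have hF0' : ∀ ε J I, ∀ x, ∀ y ∉ L, a J I (x, y) * φ ε (x, y) = 0 := fun ε J I x y hy => by
    rw [ha0' J I x y hy, zero_mul]
  have hGs : ∀ {ε}, ContDiffOn ℝ ∞ (φ ε) (Ω ×ˢ univ) → ∀ J I,
      ContDiff ℝ ∞ fun y => ∫ x, a J I (x, y) * φ ε (x, y) := fun h J I =>
    contDiff_integral_fst hK (hFs h J I) (hF0 _ J I)
  -- the components of the limit
  let B : (Fin s → Fin n) → (Fin r → Fin n) → testSpace L := fun J I =>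
    ⟨fun y => a J I (y, y), (has J I).comp (contDiff_id.prodMk contDiff_id),
      fun y hy => ha0' J I y y hy⟩
  have hB : T ζ = ∑ J, ∑ I, S J I (B J I) := by
    rw [apply_eq_sum_componentFunctional T he hL hLe ζ hζL]
    refine Finset.sum_congr rfl fun J' _ => Finset.sum_congr rfl fun I' _ => congrArg _ ?_
    ext y
    change e.target.indicator (tensorCoeff e ζ.1 J' I') y = a J' I' (y, y)
    by_cases hy : y ∈ e.target
    · have hz : (y, y) ∈ e.target ×ˢ e.target := ⟨hy, hy⟩
      -- On the diagonal the transport is the identity, so `a₀` reduces to the component of `ζ`.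
      have h1 : a₀ J' I' (y, y) = tensorCoeff e ζ.1 J' I' y := by
        simp only [ha₀, transportCoeff_self hA he _ _ _ _ hy]
        rw [Finset.sum_eq_single J', Finset.sum_eq_single I']
        · simp
        · intro I _ hI
          simp [hI]
        · simp
        · intro J _ hJ
          simp [hJ]
        · simp
      simp only [ha]
      rw [indicator_of_mem hy, indicator_of_mem hz, h1]
      by_cases hyK : y ∈ K
      · rw [hχ1 y (Or.inr hyK), one_mul]
      · rw [hc0 J' I' y hy hyK, mul_zero]
    · simp only [ha]
      rw [indicator_of_notMem hy, indicator_of_notMem fun h : (y, y) ∈ _ => hy h.1]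
  -- the components of the regularizations
  classical
  let H : (Fin s → Fin n) → (Fin r → Fin n) → ℝ → testSpace L := fun J I ε =>
    if h : ContDiffOn ℝ ∞ (φ ε) (Ω ×ˢ univ) then
      ⟨fun y => ∫ x, a J I (x, y) * φ ε (x, y), hGs h J I, fun y hy => by
        simp [ha0' J I _ y hy]⟩ else 0
  have hH : ∀ᶠ ε in 𝓝[>] (0 : ℝ), chartIntegral o e
      (fun q => contract (tangentBasis q) (regularization A T Φ ε q) (ζ.1 q)) =
        ∑ J, ∑ I, S J I (H J I ε) := by
    filter_upwards [hφ.smooth, hsupp] with ε hε hε0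
    have h1 : ∀ x ∈ e.target, chartSign o.at_ e (e.symm x) * coeff e
        (fun q => contract (tangentBasis q) (regularization A T Φ ε q) (ζ.1 q)) x =
        ∑ J, ∑ I, S J I (slice _ (hFs hε J I) (hF0' ε J I) x) := by
      intro x hx
      rw [coeff_contract_embed]
      by_cases hxK : x ∈ K
      · have hx0 := hε0 x (hKK₂ hxK)
        have ht0 : ∀ q ∉ e.symm '' L, (transportedSection A (e.symm x) (Φ ε (e.symm x))
            (scalarPart e (ζ.1 (e.symm x)))).1 q = 0 := fun q hq =>
          transportedSection_eq_zero A _ _ (hx0 q fun h => hq (image_mono hK'L h))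
        rw [apply_eq_sum_componentFunctional T he hL hLe _ ht0]
        simp only [Finset.mul_sum]
        refine Finset.sum_congr rfl fun J' _ => Finset.sum_congr rfl fun I' _ => ?_
        -- The orientation sign at `x` moves into the test function, where it is part of
        -- `chartKernel`.
        rw [← smul_eq_mul, ← map_smul]
        refine congrArg _ ?_
        ext y
        change chartSign o.at_ e (e.symm x) * e.target.indicator _ y = a J' I' (x, y) * φ ε (x, y)
        by_cases hy : y ∈ e.target
        · have hz : (x, y) ∈ e.target ×ˢ e.target := ⟨hx, hy⟩
          simp only [ha, φ, chartKernel]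
          rw [indicator_of_mem hy, indicator_of_mem hz, indicator_of_mem hy,
            tensorCoeff_transportedSection A he hx]
          change _ * (a₀ J' I' (x, y) * _) = _
          -- `χ` can differ from one only outside `K'`, where the kernel coefficient vanishes.
          by_cases hyK : y ∈ K'
          · simp only [hχ1 y (Or.inl hyK)]
            ring
          · have h0 : coeff e (Φ ε (e.symm x)).1 y = 0 := by
              rw [coeff, hx0 _ ?_]
              · rfl
              · rintro ⟨y', hy', hyy⟩
                exact hyK (e.symm.injOn (hK'e hy') hy hyy ▸ hy')
            rw [h0]
            ring
        · simp only [ha]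
          rw [indicator_of_notMem hy, indicator_of_notMem fun h : (x, y) ∈ _ => hy h.2]
          ring
      · have h0 : ζ.1 (e.symm x) = 0 := hζ _ fun ⟨y, hy, hyx⟩ =>
          hxK (e.symm.injOn (hKi hy) hx hyx ▸ hy)
        have h2 : scalarPart e (ζ.1 (e.symm x)) = 0 := by
          rw [h0]
          rfl
        rw [h2, map_zero, map_zero, mul_zero]
        symm
        refine Finset.sum_eq_zero fun J _ => Finset.sum_eq_zero fun I _ => ?_
        rw [show slice _ (hFs hε J I) (hF0' ε J I) x = 0 from
          Subtype.ext (funext fun y => hF0 ε J I x hxK y), map_zero]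
    have hsl0 : ∀ J I, ∀ x ∉ K, S J I (slice _ (hFs hε J I) (hF0' ε J I) x) = 0 :=
      fun J I x hx => by
        rw [show slice _ (hFs hε J I) (hF0' ε J I) x = 0 from
          Subtype.ext (funext fun y => hF0 ε J I x hx y), map_zero]
    rw [chartIntegral, setIntegral_congr_fun e.open_target.measurableSet h1,
      setIntegral_eq_integral_of_forall_compl_eq_zero fun x hx =>
        Finset.sum_eq_zero fun J _ => Finset.sum_eq_zero fun I _ =>
          hsl0 J I x fun h => hx (hKi h)]
    have hint : ∀ J I, Integrable fun x => S J I (slice _ (hFs hε J I) (hF0' ε J I) x) :=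
      fun J I => ((hS J I).contDiff_slice hL (hFs hε J I)
        (hF0' ε J I)).continuous.integrable_of_hasCompactSupport
          (HasCompactSupport.intro hK (hsl0 J I))
    rw [integral_finsetSum _ fun J _ => integrable_finsetSum _ fun I _ => hint J I]
    refine Finset.sum_congr rfl fun J _ => ?_
    rw [integral_finsetSum _ fun I _ => hint J I]
    refine Finset.sum_congr rfl fun I _ => ?_
    -- The functional and the integral over `x` are interchanged, leaving a single test function in
    -- `y`.
    rw [← (hS J I).integral_slice hL hK (hFs hε J I) (hF0' ε J I) (hF0 ε J I)]
    simp only [H, dif_pos hε]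
  rw [hB]
  refine Tendsto.congr' (EventuallyEq.symm hH) ?_
  refine tendsto_finsetSum _ fun J _ => tendsto_finsetSum _ fun I _ => ?_
  rw [← tendsto_sub_nhds_zero_iff]
  simp only [← map_sub]
  refine hS J I ℝ _ _ fun l δ hδ => ?_
  filter_upwards [hφ.smooth, hφ.tendsto_dirDerivs_integral hΩ (has J I) hK hL hKK₂ (ha0 J I)
    (ha0' J I) l hδ] with ε hε h y
  have h1 : (H J I ε - B J I).1 =
      fun y => (∫ x, a J I (x, y) * φ ε (x, y)) - a J I (y, y) := by
    simp only [H, dif_pos hε]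
    rfl
  rw [h1, dirDerivs_sub (hGs hε J I) (B J I).2.1]
  simpa using h y

end Convergence

/-! ### From sections supported in a chart to arbitrary test sections -/

section Globalization

variable {n : ℕ} {M : Type*} [TopologicalSpace M] [ChartedSpace (EuclideanSpace ℝ (Fin n)) M]
  [IsManifold (𝓡 n) ∞ M] [T2Space M] [SecondCountableTopology M]

local notation "E" => EuclideanSpace ℝ (Fin n)

/-- The regularizations converge weakly. -/
theorem IsSmoothingKernel.tendsto_regularDistribution {o : ManifoldOrientation n M}
    {Φ : ℝ → M → CompactForms n M} (hΦ : IsSmoothingKernel o Φ) {A : TransportOperator n M}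
    {cov : Connection n M} (hA : A.IsAssociated cov) {r s : ℕ} (T : TensorDistribution n M r s)
    (ξ : TestSections n M s r) :
    Tendsto (fun ε => regularDistribution o (regularization A T Φ ε) ξ) (𝓝[>] 0) (𝓝 (T ξ)) := by
  have : LocallyCompactSpace M := Manifold.locallyCompact_of_finiteDimensional (𝓡 n)
  obtain ⟨L, hL, h0⟩ := ξ.2.2
  set ρ := chartPartition n M with hρ
  have hρs : ∀ i, tsupport (ρ i) ⊆ (chartAt E i).source :=
    (SmoothPartitionOfUnity.exists_isSubordinate_chartAt_source (𝓡 n) M).choose_spec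
  have hfin : {i | (Function.support (ρ i) ∩ L).Nonempty}.Finite :=
    ρ.locallyFinite.finite_nonempty_inter_compact hL
  have hz : ∀ i ∉ hfin.toFinset, ∀ q, ξ.1 q ≠ 0 → ρ i q = 0 := by
    intro i hi q hq
    by_contra hne
    exact hi (hfin.mem_toFinset.2 ⟨q, hne, by_contra fun hqL => hq (h0 q hqL)⟩)
  -- The contraction is linear in the test section, so the partition function in the definition of
  -- the integral moves onto `ξ`.
  have hsmul : ∀ ε i, (fun q => ρ i q • contract (tangentBasis q) (regularization A T Φ ε q) (ξ.1 q)) =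
      fun q => contract (tangentBasis q) (regularization A T Φ ε q) ((smulSection (ρ i) ξ).1 q) := by
    intro ε i
    ext1 q
    change _ = contract (tangentBasis q) _ (ρ i q • ξ.1 q)
    simp only [contract, Finset.smul_sum, _root_.smul_apply]
    exact Finset.sum_congr rfl fun I _ => Finset.sum_congr rfl fun J _ => smul_comm _ _ _
  have hreg : ∀ ε, regularDistribution o (regularization A T Φ ε) ξ =
      ∑ i ∈ hfin.toFinset, chartIntegral o (chartAt E i) fun q =>
        contract (tangentBasis q) (regularization A T Φ ε q) ((smulSection (ρ i) ξ).1 q) := by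
    intro ε
    rw [regularDistribution, formIntegral, finsum_eq_sum_of_support_subset (s := hfin.toFinset)]
    · simp only [← hρ, hsmul]
    · intro i hi
      by_contra hne
      refine hi ?_
      change chartIntegral o (chartAt E i) (fun q => ρ i q • contract _ _ _) = 0
      have hzero : (smulSection (ρ i) ξ).1 = 0 := by
        ext1 q
        change ρ i q • ξ.1 q = 0
        by_cases hq : ξ.1 q = 0
        · rw [hq, smul_zero]
        · rw [hz i hne q hq, zero_smul]
      rw [hsmul, hzero]
      simp [chartIntegral, coeff, contract]
  simp only [hreg]
  have hT : T ξ = ∑ i ∈ hfin.toFinset, T (smulSection (ρ i) ξ) := by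
    rw [← map_sum, sum_smulSection ρ _ ξ hz]
  rw [hT]
  refine tendsto_finsetSum _ fun i _ => ?_
  have hLi : IsCompact (L ∩ tsupport (ρ i)) := hL.inter_right (isClosed_tsupport _)
  have hLe : L ∩ tsupport (ρ i) ⊆ (chartAt E i).source := inter_subset_right.trans (hρs i)
  refine hΦ.tendsto_chartIntegral hA T i
    (hLi.image_of_continuousOn ((chartAt E i).continuousOn.mono hLe)) ?_ _ fun q hq => ?_
  · rintro _ ⟨q, hq, rfl⟩
    exact (chartAt E i).map_source (hLe hq)
  · change ρ i q • ξ.1 q = 0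
    by_cases hqL : q ∈ L
    · have : q ∉ tsupport (ρ i) := fun h =>
        hq ⟨_, ⟨q, ⟨hqL, h⟩, rfl⟩, (chartAt E i).left_inv (hLe ⟨hqL, h⟩)⟩
      rw [image_eq_zero_of_notMem_tsupport this, zero_smul]
    · rw [h0 q hqL, smul_zero]

end Globalization

end TensorRegularization

end

open TensorRegularization in
theorem mainTheorem5 {n : ℕ} {M : Type*} [TopologicalSpace M]
    [ChartedSpace (EuclideanSpace ℝ (Fin n)) M] [IsManifold (𝓡 n) ∞ M]
    [T2Space M] [SecondCountableTopology M]
    (o : ManifoldOrientation n M)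
    (cov : Connection n M) [CovariantDerivative.ContMDiffCovariantDerivative cov ∞]
    (A : TransportOperator n M) (hA : A.IsAssociated cov)
    (r s : ℕ) (T : TensorDistribution n M r s)
    (Φ : ℝ → M → CompactForms n M) (hΦ : IsSmoothingKernel o Φ) :
    (∀ ε ∈ Ioc (0 : ℝ) 1, IsSmoothTensor (regularization A T Φ ε)) ∧
    ∀ ξ : TestSections n M s r,
      Tendsto (fun ε => regularDistribution o (regularization A T Φ ε) ξ) (𝓝[>] 0) (𝓝 (T ξ)) := by
  exact ⟨fun ε hε => hΦ.smooth.isSmoothTensor_regularization A T hε, fun ξ =>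
    hΦ.tendsto_regularDistribution hA T ξ⟩
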